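/- Let $G_{\mathbb R}\subset GL(n,\mathbb R)$ be a subgroup that is the set of zeros in $GL(n,\mathbb R)$ of a set of polynomial functions on $M_n(\mathbb R)$ and is invariant under transposition, and let $G$ be a real reductive group, that is, a Lie group with a finite covering homomorphism $p$ onto an open subgroup of $G_{\mathbb R}$. Let $K=p^{-1}(O(n))$, a maximal compact subgroup of $G$. Identify $\mathrm{Lie}(G)$ with its image in $M_n(\mathbb R)$ under $dp$, and let $U(\mathfrak g)$ be its universal enveloping algebra. Let $C$ and $C_K$ in $U(\mathfrak g)$ be the Casimir elements of $\mathrm{Lie}(G)$ and of $\mathrm{Lie}(K)$ with respect to the form $B(X,Y)=\mathrm{tr}(XY)$, and put $\Delta=C-2C_K$. Let $(\pi,H)$ be a Hilbert representation of $G$, that is, a strongly continuous representation of $G$ by bounded operators on a complex Hilbert space $H$ (not assumed unitary or admissible). Let $H^\infty$ be the space of the $v\in H$ for which $g\mapsto\pi(g)v$ is a $C^\infty$ map $G\to H$, on which $U(\mathfrak g)$ acts by differentiation, with its usual topology, defined by the seminorms $s_x(v)=\|xv\|$, $x\in U(\mathfrak g)$. Let $V=(H^\infty)_K$ be the space of the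 $v\in H^\infty$ for which $\pi(K)v$ spans a finite-dimensional space. Let $Z$ be the completion of $V$ with respect to the seminorms $q_l(v)=\|\Delta^l v\|$, $l=0,1,2,\dots$, and let $Z\to H$ be the canonical map, the continuous extension of the inclusion of $V$ in $H$ (it exists because $q_0=\|\cdot\|$). Then: 1. $\Delta=\sum_i X_i^2$ for every basis $X_1,\dots,X_m$ of $\mathrm{Lie}(G)$ that is orthonormal with respect to $\langle X,Y\rangle=\mathrm{tr}(XY^T)$; in particular $\Delta$ is an elliptic Laplacian. 2. $Z=H^\infty$: the canonical map $Z\to H$ is injective, its image is $H^\infty$, and it is a homeomorphism of $Z$ onto $H^\infty$ with its usual topology. 3. The usual topology of $H^\infty$ is the one defined by the seminorms $q_l(v)=\|\Delta^l v\|$, $v\in H^\infty$, $l=0,1,2,\dots$. -/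

import Mathlib

open scoped Manifold ContDiff

namespace RealReductive

attribute [local instance 100] LieRing.ofAssociativeRing

set_option linter.unusedSectionVars false

section Calculus
variable {E : Type*} [NormedAddCommGroup E] [NormedSpace ℝ E] [FiniteDimensional ℝ E]
  {G : Type*} [TopologicalSpace G] [ChartedSpace E G] [Group G] [LieGroup 𝓘(ℝ, E) ∞ G]
  {F : Type*} [NormedAddCommGroup F] [NormedSpace ℝ F]

/-- The smoothness class in which Mathlib puts the Lie algebra structure on `T_1 G`. -/
instance instLieGroupMin : LieGroup 𝓘(ℝ, E) (minSmoothness ℝ 3) G := by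
  rw [minSmoothness_of_isRCLikeNormedField]; infer_instance

/-- The left-invariant vector field of `X ∈ Lie(G)` applied to a vector-valued function `f`. -/
noncomputable def lieDeriv (X : GroupLieAlgebra 𝓘(ℝ, E) G) (f : G → F) (g : G) : F :=
  mfderiv 𝓘(ℝ, E) 𝓘(ℝ, F) f g (mulInvariantVectorField X g)

theorem lieDeriv_eq {f : G → F} (hf : ContMDiff 𝓘(ℝ, E) 𝓘(ℝ, F) ∞ f)
    (X : GroupLieAlgebra 𝓘(ℝ, E) G) (g : G) :
    lieDeriv X f g = mfderiv 𝓘(ℝ, E) 𝓘(ℝ, F) (fun h => f (g * h)) 1 X := by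
  have h1 : MDifferentiableAt 𝓘(ℝ, E) 𝓘(ℝ, F) f (g * 1) := hf.mdifferentiableAt (by simp)
  have h2 : MDifferentiableAt 𝓘(ℝ, E) 𝓘(ℝ, E) (fun h : G => g * h) 1 :=
    (contMDiff_mul_left (I := 𝓘(ℝ, E)) (n := ∞) (a := g)).mdifferentiableAt (by simp)
  have := mfderiv_comp_apply (1 : G) h1 h2 X
  simp only [Function.comp_def] at this
  rw [lieDeriv]
  refine Eq.trans ?_ this.symm
  have hg : ∀ (g' : G) (w : E), g' = g →
      (mfderiv 𝓘(ℝ, E) 𝓘(ℝ, F) f g : E →L[ℝ] F) w =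
        (mfderiv 𝓘(ℝ, E) 𝓘(ℝ, F) f g' : E →L[ℝ] F) w := by
    rintro _ _ rfl; rfl
  exact hg _ _ (mul_one g)

theorem contMDiff_lieDeriv {f : G → F} (hf : ContMDiff 𝓘(ℝ, E) 𝓘(ℝ, F) ∞ f)
    (X : GroupLieAlgebra 𝓘(ℝ, E) G) :
    ContMDiff 𝓘(ℝ, E) 𝓘(ℝ, F) ∞ (lieDeriv X f) := by
  intro g₀
  have key := ContMDiffAt.mfderiv (I := 𝓘(ℝ, E)) (J := 𝓘(ℝ, E)) (I' := 𝓘(ℝ, F)) (m := ∞)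
    (n := ∞) (x₀ := g₀) (fun g h : G => f (g * h)) (fun _ => (1 : G))
    ((hf.comp (contMDiff_mul 𝓘(ℝ, E) ∞)).contMDiffAt) contMDiffAt_const (by simp)
  have key2 := key.clm_apply (contMDiffAt_const (c := (show E from X)))
  refine key2.congr_of_eventuallyEq (Filter.Eventually.of_forall fun g => ?_)
  dsimp only
  rw [lieDeriv_eq hf]
  erw [inTangentCoordinates_eq (x := g) (x₀ := g₀) _ _ _
    (mem_chart_source _ _) (by rw [chartAt_self_eq]; trivial)]
  have h1 : ∀ v : E, (tangentBundleCore 𝓘(ℝ, E) G).coordChange (achart E (1 : G))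
      (achart E (1 : G)) 1 v = v :=
    fun v => (tangentBundleCore 𝓘(ℝ, E) G).coordChange_self _ _ (mem_chart_source _ _) v
  have h2 : ∀ (a b : F) (v : F), (tangentBundleCore 𝓘(ℝ, F) F).coordChange (achart F a)
      (achart F b) a v = v :=
    fun a b v => (tangentBundleCore 𝓘(ℝ, F) F).coordChange_self (achart F a) a
      (mem_chart_source _ _) v
  refine Eq.trans ?_ (h2 (f (g * 1)) (f (g₀ * 1)) _).symm
  exact congrArg (mfderiv 𝓘(ℝ, E) 𝓘(ℝ, F) (fun h => f (g * h)) 1 : E →L[ℝ] F) (h1 X).symm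

open VectorField in
theorem lieDeriv_lie {f : G → F} (hf : ContMDiff 𝓘(ℝ, E) 𝓘(ℝ, F) ∞ f)
    (X Y : GroupLieAlgebra 𝓘(ℝ, E) G) :
    lieDeriv ⁅X, Y⁆ f 1 = lieDeriv X (lieDeriv Y f) 1 - lieDeriv Y (lieDeriv X f) 1 := by
  set φ := extChartAt 𝓘(ℝ, E) (1 : G) with hφ
  have hch : ∀ {u : G → F} (_ : MDifferentiable 𝓘(ℝ, E) 𝓘(ℝ, F) u)
      (V : GroupLieAlgebra 𝓘(ℝ, E) G) (y : E), y ∈ φ.target →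
      fderiv ℝ (u ∘ φ.symm) y (mpullbackWithin 𝓘(ℝ, E) 𝓘(ℝ, E) φ.symm
        (mulInvariantVectorField V) (Set.range 𝓘(ℝ, E)) y) = lieDeriv V u (φ.symm y) := by
    intro u hu V y hy
    have hinv := isInvertible_mfderivWithin_extChartAt_symm (I := 𝓘(ℝ, E)) (x := (1 : G)) hy
    have hd : MDifferentiableWithinAt 𝓘(ℝ, E) 𝓘(ℝ, E) φ.symm (Set.range 𝓘(ℝ, E)) y := 
      mdifferentiableWithinAt_extChartAt_symm (I := 𝓘(ℝ, E)) (x := (1 : G)) hy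
    have huni : (Set.range 𝓘(ℝ, E)) = Set.univ := by simp
    rw [huni] at hd hinv ⊢
    rw [mdifferentiableWithinAt_univ] at hd
    rw [mfderivWithin_univ] at hinv
    rw [mpullbackWithin_univ, ← mfderiv_eq_fderiv]
    refine (mfderiv_comp_apply y (hu _) hd _).trans ?_
    rw [lieDeriv, mpullback_apply]
    exact congrArg (mfderiv 𝓘(ℝ, E) 𝓘(ℝ, F) u (φ.symm y) : E →L[ℝ] F)
      (hinv.self_apply_inverse _)
  have h1 : φ 1 ∈ φ.target := mem_extChartAt_target 1
  have hs1 : φ.symm (φ 1) = 1 := extChartAt_to_inv 1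
  have hD : ∀ {u : G → F} (_ : ContMDiff 𝓘(ℝ, E) 𝓘(ℝ, F) ∞ u),
      MDifferentiable 𝓘(ℝ, E) 𝓘(ℝ, F) u := fun hu => hu.mdifferentiable (by simp)
  have hV : ∀ V : GroupLieAlgebra 𝓘(ℝ, E) G, DifferentiableAt ℝ
      (mpullbackWithin 𝓘(ℝ, E) 𝓘(ℝ, E) φ.symm (mulInvariantVectorField V)
        (Set.range 𝓘(ℝ, E))) (φ 1) := by
    intro V
    have := ((mdifferentiableAt_mulInvariantVectorField V (g := (1 : G))).mdifferentiableWithinAt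
      (s := Set.univ)).differentiableWithinAt_mpullbackWithin_vectorField
    have huniv : (extChartAt 𝓘(ℝ, E) (1 : G)).symm ⁻¹' Set.univ ∩ Set.range 𝓘(ℝ, E) =
      Set.univ := by simp
    rw [huniv] at this
    exact differentiableWithinAt_univ.1 this
  have hev : ∀ V : GroupLieAlgebra 𝓘(ℝ, E) G,
      (fun y => fderiv ℝ (f ∘ φ.symm) y (mpullbackWithin 𝓘(ℝ, E) 𝓘(ℝ, E) φ.symm
        (mulInvariantVectorField V) (Set.range 𝓘(ℝ, E)) y)) =ᶠ[nhds (φ 1)]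
        (lieDeriv V f ∘ φ.symm) := by
    intro V
    filter_upwards [extChartAt_target_mem_nhds (I := 𝓘(ℝ, E)) (1 : G)] with y hy
    exact hch (hD hf) V y hy
  have hfc : ContDiffAt ℝ ∞ (f ∘ φ.symm) (φ 1) := by
    rw [← contMDiffAt_iff_contDiffAt]
    exact hf.contMDiffAt.comp _
      ((contMDiffOn_extChartAt_symm (1 : G)).contMDiffAt (extChartAt_target_mem_nhds (1 : G)))
  have key := fderiv_apply_lieBracket hfc
    (by rw [minSmoothness_of_isRCLikeNormedField]; exact ENat.LEInfty.out) (hV Y) (hV X)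
  rw [(hev Y).fderiv_eq, (hev X).fderiv_eq, hch (hD (contMDiff_lieDeriv hf Y)) X _ h1,
    hch (hD (contMDiff_lieDeriv hf X)) Y _ h1, hs1] at key
  rw [← key, lieDeriv]
  have huni : (Set.range 𝓘(ℝ, E)) = Set.univ := by simp
  have hbr : mulInvariantVectorField ⁅X, Y⁆ (1 : G) =
      mlieBracket 𝓘(ℝ, E) (mulInvariantVectorField X) (mulInvariantVectorField Y) (1 : G) := by
    rw [GroupLieAlgebra.bracket_def, mulInvariantVector_mlieBracket]
  have hfin : ∀ W : E,
      (mfderiv 𝓘(ℝ, E) 𝓘(ℝ, F) f 1 : E →L[ℝ] F)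
        ((mfderiv 𝓘(ℝ, E) 𝓘(ℝ, E) φ 1 : E →L[ℝ] E).inverse W) =
      fderiv ℝ (f ∘ φ.symm) (φ 1) W := by
    intro W
    have hi : (mfderiv 𝓘(ℝ, E) 𝓘(ℝ, E) φ 1 : E →L[ℝ] E).IsInvertible :=
      isInvertible_mfderiv_extChartAt (mem_extChartAt_source (1 : G))
    have hW := hi.self_apply_inverse W
    set U := (mfderiv 𝓘(ℝ, E) 𝓘(ℝ, E) φ 1 : E →L[ℝ] E).inverse W with hU
    rw [← hW]
    have hcomp : (f ∘ φ.symm) ∘ φ =ᶠ[nhds 1] f := by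
      filter_upwards [extChartAt_source_mem_nhds (I := 𝓘(ℝ, E)) (1 : G)] with g hg
      simp only [Function.comp_apply]
      rw [φ.left_inv hg]
    rw [← hcomp.mfderiv_eq]
    have hd1 : MDifferentiableAt 𝓘(ℝ, E) 𝓘(ℝ, F) (f ∘ φ.symm) (φ 1) :=
      (hfc.differentiableAt (by simp)).mdifferentiableAt
    have hd2 : MDifferentiableAt 𝓘(ℝ, E) 𝓘(ℝ, E) φ 1 :=
      mdifferentiableAt_extChartAt (mem_chart_source E (1 : G))
    rw [← mfderiv_eq_fderiv]
    exact mfderiv_comp_apply (1 : G) hd1 hd2 U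
  rw [hbr]
  refine Eq.trans ?_ (hfin _)
  have huniv : φ.symm ⁻¹' Set.univ ∩ Set.range 𝓘(ℝ, E) = Set.univ := by simp
  rw [← mlieBracketWithin_univ, mlieBracketWithin_apply, ← hφ, huniv]
  exact congrArg (fun W : E => (mfderiv 𝓘(ℝ, E) 𝓘(ℝ, F) f 1 : E →L[ℝ] F)
    ((mfderiv 𝓘(ℝ, E) 𝓘(ℝ, E) φ 1 : E →L[ℝ] E).inverse W))
    (congrFun lieBracketWithin_univ (φ 1))
end Calculus

section Representation

variable {E : Type*} [NormedAddCommGroup E] [NormedSpace ℝ E] [FiniteDimensional ℝ E]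
  {G : Type*} [TopologicalSpace G] [ChartedSpace E G] [Group G] [LieGroup 𝓘(ℝ, E) ∞ G]
  {H : Type*} [NormedAddCommGroup H] [InnerProductSpace ℂ H]

/-- A strongly continuous representation of `G` on the space `H` by bounded operators.
(They are invertible, since `G` is a group; they need not be unitary.) -/
structure HilbertRep (G : Type*) [TopologicalSpace G] [Group G]
    (H : Type*) [NormedAddCommGroup H] [InnerProductSpace ℂ H] where
  /-- the homomorphism to bounded operators -/
  toHom : G →* (H →L[ℂ] H)
  continuous_orbit : ∀ v : H, Continuous fun g : G => toHom g v

/-- The orbit map `g ↦ π(g) v`. -/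
def orbit (π : HilbertRep G H) (v : H) (g : G) : H := π.toHom g v

variable (E) in
/-- `H^∞`: the vectors whose orbit map is smooth on `G`. -/
def smoothVectors (π : HilbertRep G H) : Submodule ℂ H where
  carrier := {v | ContMDiff 𝓘(ℝ, E) 𝓘(ℝ, H) ∞ (orbit π v)}
  zero_mem' := by
    have : orbit π (0 : H) = fun _ => 0 := by ext g; simp [orbit]
    change ContMDiff _ _ _ _
    rw [this]
    exact contMDiff_const
  add_mem' := by
    intro v w hv hw
    have : orbit π (v + w) = fun g => orbit π v g + orbit π w g := by ext g; simp [orbit]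
    change ContMDiff _ _ _ _
    rw [this]
    exact ContMDiff.add hv hw
  smul_mem' := by
    intro c v hv
    have : orbit π (c • v) = fun g => (c • ContinuousLinearMap.id ℝ H) (orbit π v g) := by
      ext g; simp [orbit]
    change ContMDiff _ _ _ _
    rw [this]
    exact (c • ContinuousLinearMap.id ℝ H).contMDiff.comp hv

/-- `dπ(X) v`, the derivative at `1` of `g ↦ π(g) v` in the direction `X ∈ T_1 G = Lie(G)`. -/
noncomputable def dpi (π : HilbertRep G H) (X : GroupLieAlgebra 𝓘(ℝ, E) G) (v : H) : H :=
  mfderiv 𝓘(ℝ, E) 𝓘(ℝ, H) (orbit π v) 1 X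

theorem lieDeriv_one (π : HilbertRep G H) (X : GroupLieAlgebra 𝓘(ℝ, E) G) (v : H)
    (hv : v ∈ smoothVectors E π) : lieDeriv X (orbit π v) 1 = dpi π X v := by
  have h : (fun h => orbit π v (1 * h)) = orbit π v := by ext h; rw [one_mul]
  rw [lieDeriv_eq hv, h]
  rfl

theorem orbit_dpi (π : HilbertRep G H) (X : GroupLieAlgebra 𝓘(ℝ, E) G) (v : H)
    (hv : v ∈ smoothVectors E π) : orbit π (dpi π X v) = lieDeriv X (orbit π v) := by
  ext g
  rw [lieDeriv_eq hv]
  have h1 : (fun h => orbit π v (g * h)) =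
      ((π.toHom g).restrictScalars ℝ : H →L[ℝ] H) ∘ orbit π v := by
    ext h; simp [orbit]
  rw [h1]
  have h2 : MDifferentiableAt 𝓘(ℝ, E) 𝓘(ℝ, H) (orbit π v) 1 :=
    ContMDiff.mdifferentiableAt hv (by simp)
  have h3 := mfderiv_comp_apply (1 : G)
    ((π.toHom g).restrictScalars ℝ : H →L[ℝ] H).mdifferentiableAt h2 X
  refine Eq.trans ?_ h3.symm
  rw [ContinuousLinearMap.mfderiv_eq]
  rfl

theorem dpi_mem (π : HilbertRep G H) (X : GroupLieAlgebra 𝓘(ℝ, E) G) {v : H}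
    (hv : v ∈ smoothVectors E π) : dpi π X v ∈ smoothVectors E π := by
  change ContMDiff _ _ _ _
  rw [orbit_dpi π X v hv]
  exact contMDiff_lieDeriv hv X

theorem dpi_add (π : HilbertRep G H) (X : GroupLieAlgebra 𝓘(ℝ, E) G) {v w : H}
    (hv : v ∈ smoothVectors E π) (hw : w ∈ smoothVectors E π) :
    dpi π X (v + w) = dpi π X v + dpi π X w := by
  have h1 : MDifferentiableAt 𝓘(ℝ, E) 𝓘(ℝ, H) (orbit π v) 1 :=
    ContMDiff.mdifferentiableAt hv (by simp)
  have h2 : MDifferentiableAt 𝓘(ℝ, E) 𝓘(ℝ, H) (orbit π w) 1 :=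
    ContMDiff.mdifferentiableAt hw (by simp)
  have h : orbit π (v + w) = orbit π v + orbit π w := by ext g; simp [orbit]
  rw [dpi, h, mfderiv_add h1 h2]
  rfl

theorem dpi_smul (π : HilbertRep G H) (X : GroupLieAlgebra 𝓘(ℝ, E) G) (c : ℂ) {v : H}
    (hv : v ∈ smoothVectors E π) : dpi π X (c • v) = c • dpi π X v := by
  have h2 : MDifferentiableAt 𝓘(ℝ, E) 𝓘(ℝ, H) (orbit π v) 1 :=
    ContMDiff.mdifferentiableAt hv (by simp)
  have h : orbit π (c • v) = (c • ContinuousLinearMap.id ℝ H) ∘ orbit π v := by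
    ext g; simp [orbit]
  have h3 := mfderiv_comp_apply (1 : G)
    (c • ContinuousLinearMap.id ℝ H).mdifferentiableAt h2 X
  rw [dpi, h]
  refine h3.trans ?_
  rw [ContinuousLinearMap.mfderiv_eq]
  rfl

/-- The action `dπ` of `Lie(G)` on `H^∞`, as a homomorphism of Lie algebras. -/
noncomputable def lieAction (π : HilbertRep G H) :
    GroupLieAlgebra 𝓘(ℝ, E) G →ₗ⁅ℝ⁆ Module.End ℂ (smoothVectors E π) where
  toFun X :=
    { toFun := fun v => ⟨dpi π X v, dpi_mem π X v.2⟩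
      map_add' := fun v w => Subtype.ext (dpi_add π X v.2 w.2)
      map_smul' := fun c v => Subtype.ext (dpi_smul π X c v.2) }
  map_add' X Y := by
    ext v
    exact map_add (mfderiv 𝓘(ℝ, E) 𝓘(ℝ, H) (orbit π (v : H)) 1) X Y
  map_smul' c X := by
    ext v
    exact map_smul (mfderiv 𝓘(ℝ, E) 𝓘(ℝ, H) (orbit π (v : H)) 1) c X
  map_lie' {X Y} := by
    ext v
    have hv : (v : H) ∈ smoothVectors E π := v.2
    have h := lieDeriv_lie (f := orbit π (v : H)) hv X Y
    rw [← orbit_dpi π X _ hv, ← orbit_dpi π Y _ hv, lieDeriv_one π _ _ hv,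
      lieDeriv_one π _ _ (dpi_mem π Y hv), lieDeriv_one π _ _ (dpi_mem π X hv)] at h
    exact h

/-- The action of the universal enveloping algebra of `Lie(G)` on `H^∞`. -/
noncomputable def envAction (π : HilbertRep G H) :
    UniversalEnvelopingAlgebra ℝ (GroupLieAlgebra 𝓘(ℝ, E) G) →ₐ[ℝ]
      Module.End ℂ (smoothVectors E π) :=
  UniversalEnvelopingAlgebra.lift ℝ (lieAction π)

/-- The seminorm `s_x(v) = ‖x v‖` on `H^∞`, for `x ∈ U(Lie(G))`. -/
noncomputable def envSeminorm (π : HilbertRep G H)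
    (x : UniversalEnvelopingAlgebra ℝ (GroupLieAlgebra 𝓘(ℝ, E) G)) :
    Seminorm ℂ (smoothVectors E π) :=
  (normSeminorm ℂ H).comp ((smoothVectors E π).subtype ∘ₗ envAction π x)

/-- The uniform structure on a vector space that is defined by a family of seminorms. -/
noncomputable abbrev seminormUniformity {V ι : Type*} [AddCommGroup V] [Module ℂ V]
    (q : ι → Seminorm ℂ V) : UniformSpace V :=
  ⨅ i, (q i).toAddGroupSeminorm.toSeminormedAddCommGroup.toPseudoMetricSpace.toUniformSpace

/-- The (locally convex) topology on a vector space that is defined by a family of seminorms. -/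
noncomputable abbrev seminormTopology {V ι : Type*} [AddCommGroup V] [Module ℂ V]
    (q : ι → Seminorm ℂ V) : TopologicalSpace V :=
  (seminormUniformity q).toTopologicalSpace

end Representation

section Reductive

variable {E : Type*} [NormedAddCommGroup E] [NormedSpace ℝ E] [FiniteDimensional ℝ E]
  {G : Type*} [TopologicalSpace G] [ChartedSpace E G] [Group G] [LieGroup 𝓘(ℝ, E) ∞ G]
  {H : Type*} [NormedAddCommGroup H] [InnerProductSpace ℂ H] {n : ℕ}

/-- The data that exhibit the Lie group `G` as a real reductive group: a subgroup `G_ℝ` of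
`GL(n, ℝ)` that is the set of zeros in `GL(n, ℝ)` of polynomial functions on `M_n(ℝ)` and is
invariant under transposition, and a finite covering homomorphism `p` (of Lie groups) from `G`
onto an open subgroup of `G_ℝ`. -/
structure ReductiveGroup (n : ℕ) (E : Type*) [NormedAddCommGroup E] [NormedSpace ℝ E]
    (G : Type*) [TopologicalSpace G] [ChartedSpace E G] [Group G] where
  /-- the group `G_ℝ` of real points -/
  GR : Subgroup (GL (Fin n) ℝ)
  /-- the polynomial equations of `G_ℝ` -/
  eqs : Set (MvPolynomial (Fin n × Fin n) ℝ)
  mem_GR_iff : ∀ g : GL (Fin n) ℝ, g ∈ GR ↔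
    ∀ f ∈ eqs, MvPolynomial.eval (fun ij => (g : Matrix (Fin n) (Fin n) ℝ) ij.1 ij.2) f = 0
  transpose_mem : ∀ g ∈ GR, ∃ h ∈ GR,
    (h : Matrix (Fin n) (Fin n) ℝ) = (g : Matrix (Fin n) (Fin n) ℝ).transpose
  /-- the covering homomorphism -/
  p : G →* GL (Fin n) ℝ
  isOpen_range : ∃ U : Set (GL (Fin n) ℝ), IsOpen U ∧ (p.range : Set (GL (Fin n) ℝ)) = U ∩ GR
  isCoveringMap : IsCoveringMap p.rangeRestrict
  finite_ker : Finite p.ker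
  contMDiff_p : ∀ i j, ContMDiff 𝓘(ℝ, E) 𝓘(ℝ, ℝ) ∞
    fun g => (p g : Matrix (Fin n) (Fin n) ℝ) i j
  immersion_p : ∀ X : GroupLieAlgebra 𝓘(ℝ, E) G,
    (∀ i j, mfderiv 𝓘(ℝ, E) 𝓘(ℝ, ℝ)
      (fun g => (p g : Matrix (Fin n) (Fin n) ℝ) i j) 1 X = 0) → X = 0

variable (R : ReductiveGroup n E G)

/-- The differential of `p` at `1`, which identifies `Lie(G)` with a Lie algebra of real
`n × n` matrices. -/
noncomputable def dp : GroupLieAlgebra 𝓘(ℝ, E) G →ₗ[ℝ] Matrix (Fin n) (Fin n) ℝ where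
  toFun X := Matrix.of fun i j => (mfderiv 𝓘(ℝ, E) 𝓘(ℝ, ℝ)
    (fun g => (R.p g : Matrix (Fin n) (Fin n) ℝ) i j) 1 : E →L[ℝ] ℝ) X
  map_add' X Y := by
    ext i j
    exact map_add (mfderiv 𝓘(ℝ, E) 𝓘(ℝ, ℝ)
      (fun g => (R.p g : Matrix (Fin n) (Fin n) ℝ) i j) 1 : E →L[ℝ] ℝ) X Y
  map_smul' c X := by
    ext i j
    exact map_smul (mfderiv 𝓘(ℝ, E) 𝓘(ℝ, ℝ)
      (fun g => (R.p g : Matrix (Fin n) (Fin n) ℝ) i j) 1 : E →L[ℝ] ℝ) c X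

/-- The maximal compact subgroup `K = p⁻¹(O(n))` of `G`. -/
def maxCompact : Subgroup G where
  carrier := {g | (R.p g : Matrix (Fin n) (Fin n) ℝ) ∈ Matrix.orthogonalGroup (Fin n) ℝ}
  one_mem' := by simp [one_mem]
  mul_mem' := by
    intro a b ha hb
    simpa using mul_mem ha hb
  inv_mem' := by
    intro a ha
    have h : (R.p a : Matrix (Fin n) (Fin n) ℝ) *
        (R.p a : Matrix (Fin n) (Fin n) ℝ).transpose = 1 :=
      (Matrix.mem_orthogonalGroup_iff _ _).1 ha
    have h2 : ((R.p a⁻¹ : GL (Fin n) ℝ) : Matrix (Fin n) (Fin n) ℝ) =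
        (R.p a : Matrix (Fin n) (Fin n) ℝ).transpose := by
      rw [map_inv, Matrix.coe_units_inv]
      exact Matrix.inv_eq_right_inv h
    change ((R.p a⁻¹ : GL (Fin n) ℝ) : Matrix (Fin n) (Fin n) ℝ) ∈
      Matrix.orthogonalGroup (Fin n) ℝ
    rw [h2, Matrix.mem_orthogonalGroup_iff, Matrix.transpose_transpose]
    exact mul_eq_one_comm.1 h

/-- `Lie(K)`: the elements of `Lie(G)` that `dp` maps to `Lie(O(n))`, that is, to
skew-symmetric matrices. -/
noncomputable def lieK : Submodule ℝ (GroupLieAlgebra 𝓘(ℝ, E) G) where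
  carrier := {X | (dp R X).transpose = -dp R X}
  zero_mem' := by simp
  add_mem' := by
    intro X Y hX hY
    simp only [Set.mem_ofPred_eq] at *
    rw [map_add, Matrix.transpose_add, hX, hY, neg_add]
  smul_mem' := by
    intro c X hX
    simp only [Set.mem_ofPred_eq] at *
    rw [map_smul, Matrix.transpose_smul, hX, smul_neg]

/-- The bilinear form `B(X, Y) = tr(XY)` on `Lie(G)`. -/
noncomputable def formB (X Y : GroupLieAlgebra 𝓘(ℝ, E) G) : ℝ :=
  (dp R X * dp R Y).trace

/-- The Casimir element of a Lie subalgebra `W` of `Lie(G)` with respect to (the restriction to `W`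
of) the form `B`: it is `∑ b_i b^i`, where `b` is a basis of `W` and
`b^i = ∑_j (B(b_i, b_j))⁻¹_{ij} b_j` is the dual basis of `W` with respect to `B`. -/
noncomputable def casimir (W : Submodule ℝ (GroupLieAlgebra 𝓘(ℝ, E) G)) :
    UniversalEnvelopingAlgebra ℝ (GroupLieAlgebra 𝓘(ℝ, E) G) :=
  letI : FiniteDimensional ℝ (GroupLieAlgebra 𝓘(ℝ, E) G) := inferInstanceAs (FiniteDimensional ℝ E)
  let b := Module.finBasis ℝ W
  ∑ i, ∑ j, (Matrix.of fun k l => formB R (b k) (b l))⁻¹ i j •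
    (UniversalEnvelopingAlgebra.ι ℝ (b i : GroupLieAlgebra 𝓘(ℝ, E) G) *
      UniversalEnvelopingAlgebra.ι ℝ (b j : GroupLieAlgebra 𝓘(ℝ, E) G))

/-- `Δ = C - 2 C_K`, with `C` and `C_K` the Casimir elements of `G` and `K`. -/
noncomputable def laplacian : UniversalEnvelopingAlgebra ℝ (GroupLieAlgebra 𝓘(ℝ, E) G) :=
  casimir R ⊤ - (2 : ℝ) • casimir R (lieK R)

/-- `V = (H^∞)_K`: the smooth vectors `v` for which the span of `π(K) v` is finite-dimensional. -/
def kFinite (π : HilbertRep G H) : Submodule ℂ (smoothVectors E π) where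
  carrier := {v | FiniteDimensional ℂ
    (Submodule.span ℂ ((fun k => π.toHom k (v : H)) '' (maxCompact R : Set G)))}
  zero_mem' := by
    have h : Submodule.span ℂ ((fun k => π.toHom k ((0 : smoothVectors E π) : H)) ''
        (maxCompact R : Set G)) ≤ ⊥ := by
      rw [Submodule.span_le]
      rintro _ ⟨k, _, rfl⟩
      simp
    rw [le_bot_iff] at h
    simp only [Set.mem_ofPred_eq]
    rw [h]
    infer_instance
  add_mem' := by
    intro v w hv hw
    simp only [Set.mem_ofPred_eq] at *
    refine Submodule.finiteDimensional_of_le (Submodule.span_le.2 ?_ :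
      _ ≤ Submodule.span ℂ ((fun k => π.toHom k (v : H)) '' (maxCompact R : Set G)) ⊔
        Submodule.span ℂ ((fun k => π.toHom k (w : H)) '' (maxCompact R : Set G)))
    rintro _ ⟨k, hk, rfl⟩
    simp only [Submodule.coe_add, map_add]
    exact Submodule.add_mem_sup (Submodule.subset_span ⟨k, hk, rfl⟩)
      (Submodule.subset_span ⟨k, hk, rfl⟩)
  smul_mem' := by
    intro c v hv
    simp only [Set.mem_ofPred_eq] at *
    refine Submodule.finiteDimensional_of_le (Submodule.span_le.2 ?_ :
      _ ≤ Submodule.span ℂ ((fun k => π.toHom k (v : H)) '' (maxCompact R : Set G)))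
    rintro _ ⟨k, hk, rfl⟩
    simp only [Submodule.coe_smul, map_smul]
    exact Submodule.smul_mem _ _ (Submodule.subset_span ⟨k, hk, rfl⟩)

/-- The seminorms `q_l(v) = ‖Δ^l v‖` on `H^∞`. -/
noncomputable def lapSeminorm (π : HilbertRep G H) (l : ℕ) : Seminorm ℂ (smoothVectors E π) :=
  envSeminorm π (laplacian R ^ l)

/-- The uniform structure on `V = (H^∞)_K` that is defined by the seminorms `q_l`. -/
noncomputable abbrev kFiniteUniformity (π : HilbertRep G H) : UniformSpace (kFinite R π) :=
  seminormUniformity fun l => (lapSeminorm R π l).comp (kFinite R π).subtype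

/-- `Z`: the completion of `V = (H^∞)_K` with respect to the seminorms `q_l`. -/
abbrev lapCompletion (π : HilbertRep G H) : Type _ :=
  @UniformSpace.Completion (kFinite R π) (kFiniteUniformity R π)

/-- The topology of the completion `Z`. -/
noncomputable abbrev lapCompletionTopology (π : HilbertRep G H) :
    TopologicalSpace (lapCompletion R π) :=
  (@UniformSpace.Completion.uniformSpace (kFinite R π)
    (kFiniteUniformity R π)).toTopologicalSpace

/-- The usual topology of `H^∞`, defined by the seminorms `v ↦ ‖x v‖`, `x ∈ U(Lie(G))`.
(It is not the topology that `H^∞` inherits from `H`.) -/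
noncomputable abbrev smoothTopology (E : Type*) [NormedAddCommGroup E] [NormedSpace ℝ E]
    [FiniteDimensional ℝ E] [ChartedSpace E G] [LieGroup 𝓘(ℝ, E) ∞ G] (π : HilbertRep G H) :
    TopologicalSpace (smoothVectors E π) :=
  seminormTopology (envSeminorm π)

/-- The canonical map `Z → H`: the extension to the completion of the inclusion of `V` in `H`
(which is uniformly continuous, since `q_0 = ‖·‖`). -/
noncomputable def lapCompletionToH (π : HilbertRep G H) : lapCompletion R π → H :=
  @UniformSpace.Completion.extension (kFinite R π) (kFiniteUniformity R π) H _
    (fun v => ((v : smoothVectors E π) : H))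

end Reductive

end RealReductive

namespace RealReductive

attribute [local instance 100] LieRing.ofAssociativeRing

set_option linter.unusedSectionVars false

/-! ### Properness of the covering, compactness of `K`, and a Lipschitz cut-off function -/

section GroupTopology

variable {E : Type*} [NormedAddCommGroup E] [NormedSpace ℝ E]
  {G : Type*} [TopologicalSpace G] [ChartedSpace E G] [Group G] {n : ℕ}

/-! The Lie algebra is stable under transposition (`exists_dp_eq_transpose`), so it splits into its
skew part Lie(K) and its symmetric part, orthogonal for both tr(XY) and tr(XYᵀ). The two forms agree
on the symmetric part and are opposite on the skew part. Hence C is the sum of squares over the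
symmetric part minus the sum over the skew part, C_K is minus the latter, and C - 2C_K is the full
sum of squares (`laplacian_eq`).

The analytic core is an elliptic estimate that needs no unitarity. Averaging the inner products
⟨π(g⁻¹)v, π(g⁻¹)w⟩ against a compactly supported cut-off on G gives a form B, coercive on H. Moving
both arguments by a group element only translates the cut-off, so every X in Lie(G) is skew for B up
to a bounded form (`exists_almost_invariant_form`). Thus Re B(Xv, Xv) is -Re B(v, X²v) plus an error
of order ‖v‖‖Xv‖. Summing over a basis gives ∑‖X_i v‖² ≤ C(‖v‖² + ‖v‖‖Δv‖) (`first_order_estimate`).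
Since [Δ, X_j] has order two, induction with a small constant (`sobolev_succ_le`) bounds every ‖xv‖,
x in U(g), by finitely many ‖Δ^l v‖. The estimate gains only one derivative for each Δ, which
suffices to compare topologies.

It remains to see that H^∞ is a Hausdorff completion of V. It is complete because the derivative of
an orbit map is expressed by orbit maps of the vectors X_i v with smooth coefficients, so limits in
all seminorms are smooth (`exists_smooth_of_tendsto`). V is dense: Δ commutes with K, so v ↦ (v, Δv,
…, Δ^N v) maps H^∞ equivariantly into the Hilbert space H^(N+1), where the spectral theorem for
compact operators approximates by K-finite vectors that stay in the image
(`mem_closure_finiteVectors`, `exists_kFinite_near`). Uniqueness of completions then identifies Z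
with H^∞. -/

theorem continuous_p (R : ReductiveGroup n E G) : Continuous R.p :=
  continuous_subtype_val.comp R.isCoveringMap.continuous

/-- An open subgroup of a closed subgroup is closed. -/
theorem isClosed_of_relatively_open {Γ : Type*} [TopologicalSpace Γ] [Group Γ]
    [IsTopologicalGroup Γ] {S T : Subgroup Γ} (hT : IsClosed (T : Set Γ))
    (h : ∃ U : Set Γ, IsOpen U ∧ (S : Set Γ) = U ∩ T) : IsClosed (S : Set Γ) := by
  obtain ⟨U, hU, hS⟩ := h
  have hST : S ≤ T := fun x hx => (hS.subset hx).2
  have ho : IsOpen ((S.subgroupOf T : Subgroup T) : Set T) := by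
    have : ((S.subgroupOf T : Subgroup T) : Set T) = Subtype.val ⁻¹' U := by
      ext x
      have := Set.ext_iff.1 hS (x : Γ)
      simp only [Subgroup.mem_subgroupOf, SetLike.mem_coe, Set.mem_inter_iff, Set.mem_preimage] at *
      simp [this]
    rw [this]
    exact hU.preimage continuous_subtype_val
  have hc := (S.subgroupOf T).isClosed_of_isOpen ho
  have := hT.isClosedEmbedding_subtypeVal.isClosedMap _ hc
  convert this using 1
  ext x
  constructor
  · intro hx
    exact ⟨⟨x, hST hx⟩, hx, rfl⟩
  · rintro ⟨y, hy, rfl⟩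
    exact hy

theorem isClosed_GR (R : ReductiveGroup n E G) : IsClosed (R.GR : Set (GL (Fin n) ℝ)) := by
  have : (R.GR : Set (GL (Fin n) ℝ)) = ⋂ f ∈ R.eqs, {g : GL (Fin n) ℝ |
      MvPolynomial.eval (fun ij => (g : Matrix (Fin n) (Fin n) ℝ) ij.1 ij.2) f = 0} := by
    ext g
    simp [R.mem_GR_iff]
  rw [this]
  refine isClosed_biInter fun f _ => isClosed_eq ?_ continuous_const
  exact (MvPolynomial.continuous_eval f).comp
    (continuous_pi fun ij => Units.continuous_val.matrix_elem ij.1 ij.2)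

theorem isClosed_range_p (R : ReductiveGroup n E G) :
    IsClosed (R.p.range : Set (GL (Fin n) ℝ)) :=
  isClosed_of_relatively_open (isClosed_GR R) R.isOpen_range

variable [FiniteDimensional ℝ E] [LieGroup 𝓘(ℝ, E) ∞ G]

/-- The saturation of a closed set under the finite kernel is a finite union of translates, hence
closed. As the covering is a quotient map onto a closed subgroup, images of closed sets are closed;
the fibres are finite. -/
theorem isProperMap_p (R : ReductiveGroup n E G) : IsProperMap R.p := by
  have : IsTopologicalGroup G := topologicalGroup_of_lieGroup 𝓘(ℝ, E) ∞
  have := R.finite_ker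
  refine isProperMap_iff_isClosedMap_and_compact_fibers.2 ⟨continuous_p R, ?_, ?_⟩
  · refine (isClosed_range_p R).isClosedEmbedding_subtypeVal.isClosedMap.comp
      (f := R.p.rangeRestrict) ?_
    intro C hC
    have hq : Topology.IsQuotientMap R.p.rangeRestrict :=
      R.isCoveringMap.isQuotientMap R.p.rangeRestrict_surjective
    rw [← hq.isClosed_preimage]
    have : R.p.rangeRestrict ⁻¹' (R.p.rangeRestrict '' C) =
        ⋃ k : R.p.ker, (fun g => g * (k : G)) ⁻¹' C := by
      ext g
      simp only [Set.mem_preimage, Set.mem_image, Set.mem_iUnion]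
      constructor
      · rintro ⟨c, hc, h⟩
        have h' : R.p c = R.p g := congrArg Subtype.val h
        refine ⟨⟨g⁻¹ * c, ?_⟩, by simpa using hc⟩
        simp [MonoidHom.mem_ker, h']
      · rintro ⟨k, hk⟩
        refine ⟨_, hk, Subtype.ext ?_⟩
        have : R.p k = 1 := k.2
        simp [this]
    rw [this]
    exact isClosed_iUnion_of_finite fun k => hC.preimage (continuous_mul_const _)
  · intro y
    have hfin : (R.p ⁻¹' {y}).Finite := by
      by_cases hy : ∃ g, R.p g = y
      · obtain ⟨g, rfl⟩ := hy
        refine (Set.finite_range fun k : R.p.ker => g * (k : G)).subset ?_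
        intro h hh
        refine ⟨⟨g⁻¹ * h, ?_⟩, by simp⟩
        have : R.p h = R.p g := hh
        simp [MonoidHom.mem_ker, this]
      · convert Set.finite_empty
        ext g
        simpa using fun h => hy ⟨g, h⟩
    exact hfin.isCompact

/-- The topology of the unit group is induced by g ↦ (g, g⁻¹). The image of this set is a compact
box cut by the closed equations ab = ba = 1, which is why both g and g⁻¹ must be bounded. -/
theorem isCompact_boundedGL (C : ℝ) : IsCompact {g : GL (Fin n) ℝ |
    (∀ i j, |(g : Matrix (Fin n) (Fin n) ℝ) i j| ≤ C) ∧
    ∀ i j, |((g⁻¹ : GL (Fin n) ℝ) : Matrix (Fin n) (Fin n) ℝ) i j| ≤ C} := by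
  have hM : IsCompact {A : Matrix (Fin n) (Fin n) ℝ | ∀ i j, |A i j| ≤ C} := by
    have h1 : IsCompact (Set.univ.pi fun _ : Fin n => Set.univ.pi fun _ : Fin n =>
        Set.Icc (-C) C) :=
      isCompact_univ_pi fun _ => isCompact_univ_pi fun _ => isCompact_Icc
    have h2 : {A : Fin n → Fin n → ℝ | ∀ i j, |A i j| ≤ C} =
        Set.univ.pi fun _ : Fin n => Set.univ.pi fun _ : Fin n => Set.Icc (-C) C := by
      ext A
      simp only [Set.mem_ofPred_eq, Set.mem_pi, Set.mem_univ, true_imp_iff, Set.mem_Icc, abs_le]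
    rw [← h2] at h1
    exact h1
  have hc : IsCompact (({A : Matrix (Fin n) (Fin n) ℝ | ∀ i j, |A i j| ≤ C} ×ˢ
      (MulOpposite.op '' {A : Matrix (Fin n) (Fin n) ℝ | ∀ i j, |A i j| ≤ C})) ∩
      {x : Matrix (Fin n) (Fin n) ℝ × (Matrix (Fin n) (Fin n) ℝ)ᵐᵒᵖ |
        x.1 * x.2.unop = 1 ∧ x.2.unop * x.1 = 1}) := by
    refine (hM.prod (hM.image MulOpposite.continuous_op)).inter_right ?_
    have h2 : Continuous fun x : Matrix (Fin n) (Fin n) ℝ × (Matrix (Fin n) (Fin n) ℝ)ᵐᵒᵖ =>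
      x.2.unop := MulOpposite.continuous_unop.comp continuous_snd
    exact (isClosed_eq (continuous_fst.mul h2) continuous_const).inter
      (isClosed_eq (h2.mul continuous_fst) continuous_const)
  refine Units.isEmbedding_embedProduct.isCompact_iff.2 ?_
  convert hc using 1
  ext ⟨a, b⟩
  simp only [Set.mem_image, Set.mem_ofPred_eq, Set.mem_inter_iff, Set.mem_prod]
  constructor
  · rintro ⟨g, ⟨h1, h2⟩, h⟩
    obtain ⟨rfl, rfl⟩ := Prod.mk.inj h
    exact ⟨⟨h1, _, h2, rfl⟩, by simp, by simp⟩
  · rintro ⟨⟨h1, b, h2, rfl⟩, h3, h4⟩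
    exact ⟨⟨a, b, h3, h4⟩, ⟨h1, h2⟩, rfl⟩

theorem isCompact_maxCompact (R : ReductiveGroup n E G) : IsCompact (maxCompact R : Set G) := by
  have : IsTopologicalGroup G := topologicalGroup_of_lieGroup 𝓘(ℝ, E) ∞
  have hb := (isProperMap_p R).isCompact_preimage (isCompact_boundedGL (n := n) 1)
  have hent : ∀ g ∈ maxCompact R, ∀ i j, |(R.p g : Matrix (Fin n) (Fin n) ℝ) i j| ≤ 1 :=
    fun g hg i j => entry_norm_bound_of_unitary (𝕜 := ℝ) (U := (R.p g).1) hg i j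
  refine hb.of_isClosed_subset ?_ fun g hg =>
    ⟨hent g hg, by rw [← map_inv]; exact hent _ (inv_mem hg)⟩
  have : (maxCompact R : Set G) = {g | (R.p g : Matrix (Fin n) (Fin n) ℝ) *
      (R.p g : Matrix (Fin n) (Fin n) ℝ).transpose = 1} := by
    ext g
    exact Matrix.mem_orthogonalGroup_iff _ _
  rw [this]
  have hc := Units.continuous_val.comp (continuous_p R)
  exact isClosed_eq (hc.matrix_mul hc.matrix_transpose) continuous_const

/-- The sum of the absolute values of the entries of a matrix. -/
def entrySum (A : Matrix (Fin n) (Fin n) ℝ) : ℝ := ∑ i, ∑ j, |A i j|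

theorem entrySum_nonneg (A : Matrix (Fin n) (Fin n) ℝ) : 0 ≤ entrySum A :=
  Finset.sum_nonneg fun _ _ => Finset.sum_nonneg fun _ _ => abs_nonneg _

theorem abs_le_entrySum (A : Matrix (Fin n) (Fin n) ℝ) (i j : Fin n) : |A i j| ≤ entrySum A :=
  (Finset.single_le_sum (f := fun j => |A i j|) (fun _ _ => abs_nonneg _) (Finset.mem_univ j)).trans
    (Finset.single_le_sum (f := fun i => ∑ j, |A i j|)
      (fun _ _ => Finset.sum_nonneg fun _ _ => abs_nonneg _) (Finset.mem_univ i))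

theorem entrySum_add_le (A B : Matrix (Fin n) (Fin n) ℝ) :
    entrySum (A + B) ≤ entrySum A + entrySum B := by
  simp only [entrySum, ← Finset.sum_add_distrib]
  exact Finset.sum_le_sum fun i _ => Finset.sum_le_sum fun j _ => abs_add_le _ _

theorem entrySum_mul_le (A B : Matrix (Fin n) (Fin n) ℝ) :
    entrySum (A * B) ≤ entrySum A * entrySum B := by
  calc entrySum (A * B) ≤ ∑ i, ∑ j, ∑ k, |A i k| * |B k j| :=
        Finset.sum_le_sum fun i _ => Finset.sum_le_sum fun j _ => by
          rw [Matrix.mul_apply]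
          exact (Finset.abs_sum_le_sum_abs _ _).trans_eq (by simp [abs_mul])
    _ = ∑ i, ∑ k, |A i k| * ∑ j, |B k j| := by
        refine Finset.sum_congr rfl fun i _ => ?_
        rw [Finset.sum_comm]
        simp [Finset.mul_sum]
    _ ≤ ∑ i, ∑ k, |A i k| * entrySum B := by
        gcongr with i _ k _
        exact Finset.single_le_sum (f := fun k => ∑ j, |B k j|)
          (fun _ _ => Finset.sum_nonneg fun _ _ => abs_nonneg _) (Finset.mem_univ k)
    _ = entrySum A * entrySum B := by simp [entrySum, Finset.sum_mul]

theorem continuous_entrySum : Continuous (entrySum : Matrix (Fin n) (Fin n) ℝ → ℝ) :=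
  continuous_finsetSum _ fun i _ => continuous_finsetSum _ fun j _ =>
    (continuous_id.matrix_elem i j).abs

theorem entrySum_neg (A : Matrix (Fin n) (Fin n) ℝ) : entrySum (-A) = entrySum A := by
  simp [entrySum]

theorem abs_entrySum_sub_le (A B : Matrix (Fin n) (Fin n) ℝ) :
    |entrySum A - entrySum B| ≤ entrySum (A - B) := by
  have h1 := entrySum_add_le (A - B) B
  have h2 := entrySum_add_le (B - A) A
  rw [sub_add_cancel] at h1 h2
  rw [← neg_sub A B, entrySum_neg] at h2
  exact abs_le.2 ⟨by linarith, by linarith⟩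

/-- A continuous cut-off function at the identity of `GL(n, ℝ)`. -/
def cutoffGL (g : GL (Fin n) ℝ) : ℝ :=
  max 0 (1 - entrySum ((g : Matrix (Fin n) (Fin n) ℝ) - 1) -
    entrySum (((g⁻¹ : GL (Fin n) ℝ) : Matrix (Fin n) (Fin n) ℝ) - 1))

theorem continuous_cutoffGL : Continuous (cutoffGL : GL (Fin n) ℝ → ℝ) :=
  continuous_const.max ((continuous_const.sub
    (continuous_entrySum.comp (Units.continuous_val.sub continuous_const))).sub
    (continuous_entrySum.comp ((Units.continuous_val.comp continuous_inv).sub continuous_const)))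

/-- From ag - g = (a - 1)g and (ag)⁻¹ - g⁻¹ = g⁻¹(a⁻¹ - 1). This Lipschitz bound under left
translation replaces smoothness of the cut-off. -/
theorem cutoffGL_mul_sub_le (a g : GL (Fin n) ℝ) :
    |cutoffGL (a * g) - cutoffGL g| ≤
      entrySum ((a : Matrix (Fin n) (Fin n) ℝ) - 1) * entrySum (g : Matrix (Fin n) (Fin n) ℝ) +
      entrySum ((g⁻¹ : GL (Fin n) ℝ) : Matrix (Fin n) (Fin n) ℝ) *
        entrySum (((a⁻¹ : GL (Fin n) ℝ) : Matrix (Fin n) (Fin n) ℝ) - 1) := by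
  have h0 := abs_max_sub_max_le_abs
    (1 - entrySum (((a * g : GL (Fin n) ℝ) : Matrix (Fin n) (Fin n) ℝ) - 1) -
      entrySum ((((a * g)⁻¹ : GL (Fin n) ℝ) : Matrix (Fin n) (Fin n) ℝ) - 1))
    (1 - entrySum ((g : Matrix (Fin n) (Fin n) ℝ) - 1) -
      entrySum (((g⁻¹ : GL (Fin n) ℝ) : Matrix (Fin n) (Fin n) ℝ) - 1)) 0
  rw [max_comm _ (0 : ℝ), max_comm _ (0 : ℝ)] at h0
  refine h0.trans ?_
  have h1 := abs_entrySum_sub_le (((a * g : GL (Fin n) ℝ) : Matrix (Fin n) (Fin n) ℝ) - 1)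
    ((g : Matrix (Fin n) (Fin n) ℝ) - 1)
  have h2 := abs_entrySum_sub_le ((((a * g)⁻¹ : GL (Fin n) ℝ) : Matrix (Fin n) (Fin n) ℝ) - 1)
    (((g⁻¹ : GL (Fin n) ℝ) : Matrix (Fin n) (Fin n) ℝ) - 1)
  have e1 : ((a * g : GL (Fin n) ℝ) : Matrix (Fin n) (Fin n) ℝ) - 1 -
      ((g : Matrix (Fin n) (Fin n) ℝ) - 1) =
      ((a : Matrix (Fin n) (Fin n) ℝ) - 1) * (g : Matrix (Fin n) (Fin n) ℝ) := by
    rw [Units.val_mul, sub_mul, one_mul]; abel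
  have e2 : (((a * g)⁻¹ : GL (Fin n) ℝ) : Matrix (Fin n) (Fin n) ℝ) - 1 -
      (((g⁻¹ : GL (Fin n) ℝ) : Matrix (Fin n) (Fin n) ℝ) - 1) =
      ((g⁻¹ : GL (Fin n) ℝ) : Matrix (Fin n) (Fin n) ℝ) *
      (((a⁻¹ : GL (Fin n) ℝ) : Matrix (Fin n) (Fin n) ℝ) - 1) := by
    rw [mul_inv_rev, Units.val_mul, mul_sub, mul_one]; abel
  rw [e1] at h1
  rw [e2] at h2
  have h3 := h1.trans (entrySum_mul_le _ _)
  have h4 := h2.trans (entrySum_mul_le _ _)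
  rw [abs_le] at *
  constructor <;> linarith [h3.1, h3.2, h4.1, h4.2]

theorem hasCompactSupport_cutoffGL : HasCompactSupport (cutoffGL : GL (Fin n) ℝ → ℝ) := by
  refine HasCompactSupport.intro (isCompact_boundedGL (1 + entrySum (1 : Matrix (Fin n) (Fin n) ℝ)))
    fun g hg => ?_
  by_contra h
  refine hg ?_
  have hpos : 0 < 1 - entrySum ((g : Matrix (Fin n) (Fin n) ℝ) - 1) -
      entrySum (((g⁻¹ : GL (Fin n) ℝ) : Matrix (Fin n) (Fin n) ℝ) - 1) := by
    by_contra h'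
    exact h (max_eq_left (not_lt.1 h'))
  have n1 := entrySum_nonneg ((g : Matrix (Fin n) (Fin n) ℝ) - 1)
  have n2 := entrySum_nonneg (((g⁻¹ : GL (Fin n) ℝ) : Matrix (Fin n) (Fin n) ℝ) - 1)
  have t1 := entrySum_add_le ((g : Matrix (Fin n) (Fin n) ℝ) - 1) 1
  have t2 := entrySum_add_le (((g⁻¹ : GL (Fin n) ℝ) : Matrix (Fin n) (Fin n) ℝ) - 1) 1
  rw [sub_add_cancel] at t1 t2
  exact ⟨fun i j => (abs_le_entrySum _ i j).trans (by linarith),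
    fun i j => (abs_le_entrySum _ i j).trans (by linarith)⟩

theorem hasCompactSupport_cutoffGL_comp (R : ReductiveGroup n E G) :
    HasCompactSupport fun g => cutoffGL (R.p g) := by
  refine HasCompactSupport.intro' ((isProperMap_p R).isCompact_preimage
    (hasCompactSupport_cutoffGL (n := n))) ?_ fun g hg => ?_
  · exact (isClosed_tsupport _).preimage (continuous_p R)
  · exact image_eq_zero_of_notMem_tsupport hg

end GroupTopology

/-! ### Differential calculus in the chart at the identity -/

section ChartCalculus

variable {E : Type*} [NormedAddCommGroup E] [NormedSpace ℝ E] [FiniteDimensional ℝ E]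
  {G : Type*} [TopologicalSpace G] [ChartedSpace E G] [Group G] [LieGroup 𝓘(ℝ, E) ∞ G]
  {H : Type*} [NormedAddCommGroup H] [InnerProductSpace ℂ H]
  {F : Type*} [NormedAddCommGroup F] [NormedSpace ℝ F]

variable (E G) in
/-- The preferred chart of `G` at the identity. -/
noncomputable abbrev chartOne : PartialEquiv G E := extChartAt 𝓘(ℝ, E) (1 : G)

theorem chartOne_symm_one : (chartOne E G).symm (chartOne E G 1) = 1 := extChartAt_to_inv 1

theorem isOpen_chartOne_target : IsOpen (chartOne E G).target := isOpen_extChartAt_target 1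

theorem chartOne_one_mem : chartOne E G 1 ∈ (chartOne E G).target := mem_extChartAt_target 1

theorem contMDiffOn_chartOne_symm :
    ContMDiffOn 𝓘(ℝ, E) 𝓘(ℝ, E) ∞ (chartOne E G).symm (chartOne E G).target :=
  contMDiffOn_extChartAt_symm 1

theorem contDiffOn_comp_chartOne_symm {f : G → F} (hf : ContMDiff 𝓘(ℝ, E) 𝓘(ℝ, F) ∞ f) :
    ContDiffOn ℝ ∞ (f ∘ (chartOne E G).symm) (chartOne E G).target :=
  contMDiffOn_iff_contDiffOn.1 (hf.comp_contMDiffOn contMDiffOn_chartOne_symm)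

/-- The differential at `1` is the derivative in the preferred chart. -/
theorem hasFDerivAt_comp_chartOne_symm {f : G → F} (hf : ContMDiff 𝓘(ℝ, E) 𝓘(ℝ, F) ∞ f) :
    HasFDerivAt (f ∘ (chartOne E G).symm)
      (mfderiv 𝓘(ℝ, E) 𝓘(ℝ, F) f 1 : E →L[ℝ] F) (chartOne E G 1) := by
  have hd : MDifferentiableAt 𝓘(ℝ, E) 𝓘(ℝ, F) f 1 := hf.mdifferentiableAt (by simp)
  have h1 : DifferentiableAt ℝ (f ∘ (chartOne E G).symm) (chartOne E G 1) :=
    ((contDiffOn_comp_chartOne_symm hf).contDiffAt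
      (isOpen_chartOne_target.mem_nhds chartOne_one_mem)).differentiableAt (by simp)
  have h2 := hd.mfderiv
  rw [show Set.range 𝓘(ℝ, E) = Set.univ by simp, fderivWithin_univ] at h2
  have h3 : writtenInExtChartAt 𝓘(ℝ, E) 𝓘(ℝ, F) 1 f = f ∘ (chartOne E G).symm := by
    ext y; simp [writtenInExtChartAt, chartAt_self_eq]
  rw [h3] at h2
  exact h2 ▸ h1.hasFDerivAt

/-- The map `(y, z) ↦ y⁻¹ z` in the chart at the identity. -/
noncomputable def chartDiv (y z : E) : E :=
  chartOne E G (((chartOne E G).symm y)⁻¹ * (chartOne E G).symm z)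

theorem chartDiv_self {y : E} : chartDiv (G := G) y y = chartOne E G 1 := by
  simp [chartDiv]

theorem contDiffAt_chartDiv {y : E} (hy : y ∈ (chartOne E G).target) :
    ContDiffAt ℝ ∞ (Function.uncurry (chartDiv (G := G))) (y, y) := by
  rw [← contMDiffAt_iff_contDiffAt]
  have hs : ContMDiffAt 𝓘(ℝ, E) 𝓘(ℝ, E) ∞ (chartOne E G).symm y :=
    contMDiffOn_chartOne_symm.contMDiffAt (isOpen_chartOne_target.mem_nhds hy)
  have h1 : ContMDiffAt 𝓘(ℝ, E × E) 𝓘(ℝ, E) ∞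
      (fun q : E × E => ((chartOne E G).symm q.1)⁻¹ * (chartOne E G).symm q.2) (y, y) := by
    have f1 : ContMDiffAt 𝓘(ℝ, E × E) 𝓘(ℝ, E) ∞ (fun q : E × E => (chartOne E G).symm q.1)
        (y, y) := ContMDiffAt.comp (I' := 𝓘(ℝ, E)) (y, y) hs contDiff_fst.contMDiff.contMDiffAt
    have f2 : ContMDiffAt 𝓘(ℝ, E × E) 𝓘(ℝ, E) ∞ (fun q : E × E => (chartOne E G).symm q.2)
        (y, y) := ContMDiffAt.comp (I' := 𝓘(ℝ, E)) (y, y) hs contDiff_snd.contMDiff.contMDiffAt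
    exact f1.inv.mul f2
  have h2 : ContMDiffAt 𝓘(ℝ, E) 𝓘(ℝ, E) ∞ (chartOne E G)
      ((fun q : E × E => ((chartOne E G).symm q.1)⁻¹ * (chartOne E G).symm q.2) (y, y)) := by
    simp only [inv_mul_cancel]
    exact contMDiffAt_extChartAt
  exact h2.comp (y, y) h1

variable (G) in
/-- The Maurer–Cartan form in the chart at the identity. -/
noncomputable def chartFrame (y : E) : E →L[ℝ] E := fderiv ℝ (chartDiv (G := G) y) y

theorem contDiffOn_chartFrame :
    ContDiffOn ℝ ∞ (chartFrame (E := E) G) (chartOne E G).target := fun y hy =>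
  (ContDiffAt.fderiv (m := ∞) (n := ∞) (contDiffAt_chartDiv hy) contDiffAt_id
    (by simp)).contDiffWithinAt

theorem hasFDerivAt_chartDiv {y : E} (hy : y ∈ (chartOne E G).target) :
    HasFDerivAt (chartDiv (G := G) y) (chartFrame G y) y := by
  have h1 : ContDiffAt ℝ ∞ (fun z => Function.uncurry (chartDiv (G := G)) (y, z)) y :=
    ContDiffAt.comp (g := Function.uncurry (chartDiv (G := G))) (f := fun z => (y, z)) y
      (contDiffAt_chartDiv hy) (contDiffAt_const.prodMk contDiffAt_id)
  exact (h1.differentiableAt (by simp)).hasFDerivAt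

theorem chartFrame_one : chartFrame G (chartOne E G 1) = ContinuousLinearMap.id ℝ E := by
  have h : chartDiv (G := G) (chartOne E G 1) =ᶠ[nhds (chartOne E G 1)] id := by
    filter_upwards [isOpen_chartOne_target.mem_nhds chartOne_one_mem] with z hz
    rw [chartDiv, chartOne_symm_one, inv_one, one_mul]
    exact (chartOne E G).right_inv hz
  rw [chartFrame, h.fderiv_eq, fderiv_id]

variable (E) in
/-- The differential at `1` of the orbit map of `v`. -/
noncomputable def dpiCLM (π : HilbertRep G H) (v : H) : E →L[ℝ] H :=
  mfderiv 𝓘(ℝ, E) 𝓘(ℝ, H) (orbit π v) 1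

theorem orbit_mul (π : HilbertRep G H) (v : H) (g h : G) :
    orbit π v (g * h) = π.toHom g (orbit π v h) := by simp [orbit]

/-- The orbit map in the chart at the identity, and its derivative. -/
theorem hasFDerivAt_orbit_chart (π : HilbertRep G H) {v : H} (hv : v ∈ smoothVectors E π)
    {y : E} (hy : y ∈ (chartOne E G).target) :
    HasFDerivAt (orbit π v ∘ (chartOne E G).symm)
      (((π.toHom ((chartOne E G).symm y)).restrictScalars ℝ).comp
        ((dpiCLM E π v).comp (chartFrame G y))) y := by
  -- Near y the orbit map is π(y) applied to π(y⁻¹z)v, so its derivative anywhere in the chart is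
  -- determined by the one at the identity. The vector v enters only through `dpiCLM`, which later
  -- makes limits of derivatives controllable.
  have h1 : HasFDerivAt (orbit π v ∘ (chartOne E G).symm) (dpiCLM E π v)
      (chartDiv (G := G) y y) := by
    rw [chartDiv_self]
    exact hasFDerivAt_comp_chartOne_symm hv
  have h2 := ((π.toHom ((chartOne E G).symm y)).restrictScalars ℝ).hasFDerivAt.comp y
    (h1.comp y (hasFDerivAt_chartDiv hy))
  refine h2.congr_of_eventuallyEq ?_
  have : IsTopologicalGroup G := topologicalGroup_of_lieGroup 𝓘(ℝ, E) ∞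
  have hc : ContinuousAt (fun z => ((chartOne E G).symm y)⁻¹ * (chartOne E G).symm z) y :=
    continuousAt_const.mul
      ((continuousOn_extChartAt_symm (1 : G)).continuousAt (isOpen_chartOne_target.mem_nhds hy))
  have hn := hc.preimage_mem_nhds (t := (chartOne E G).source) (by
    simp only [inv_mul_cancel]
    exact extChartAt_source_mem_nhds (1 : G))
  filter_upwards [hn] with z hz
  simp only [Function.comp_apply, ContinuousLinearMap.coe_restrictScalars', chartDiv]
  rw [(chartOne E G).left_inv hz, ← orbit_mul, mul_inv_cancel_left]

/-- A coordinate line through the identity. -/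
noncomputable def chartLine (X : E) (t : ℝ) : G := (chartOne E G).symm (chartOne E G 1 + t • X)

theorem chartLine_zero (X : E) : chartLine (G := G) X 0 = 1 := by
  simp [chartLine]

theorem continuousAt_chartLine (X : E) : ContinuousAt (chartLine (G := G) X) 0 := by
  refine ContinuousAt.comp (f := fun t : ℝ => chartOne E G 1 + t • X)
    (g := (chartOne E G).symm) ?_ (by fun_prop)
  simpa using (continuousAt_extChartAt_symm (I := 𝓘(ℝ, E)) (1 : G))

/-- Only the velocity at 0 is ever used, so coordinate lines do the work of one-parameter subgroups
and no exponential map is needed. -/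
theorem hasDerivAt_comp_chartLine {f : G → F} (hf : ContMDiff 𝓘(ℝ, E) 𝓘(ℝ, F) ∞ f) (X : E) :
    HasDerivAt (fun t => f (chartLine X t)) ((mfderiv 𝓘(ℝ, E) 𝓘(ℝ, F) f 1 : E →L[ℝ] F) X) 0 := by
  have h1 : HasDerivAt (fun t : ℝ => chartOne E G 1 + t • X) X 0 := by
    simpa using ((hasDerivAt_id (0 : ℝ)).smul_const X).const_add (chartOne E G 1)
  have h2 := hasFDerivAt_comp_chartOne_symm hf
  have h3 : HasFDerivAt (f ∘ (chartOne E G).symm)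
      (mfderiv 𝓘(ℝ, E) 𝓘(ℝ, F) f 1 : E →L[ℝ] F) (chartOne E G 1 + (0 : ℝ) • X) := by
    simpa using h2
  exact h3.comp_hasDerivAt (0 : ℝ) h1

end ChartCalculus

/-! ### Invariance of the Lie algebra under transposition -/

section Transpose

variable {E : Type*} [NormedAddCommGroup E] [NormedSpace ℝ E] [FiniteDimensional ℝ E]
  {G : Type*} [TopologicalSpace G] [ChartedSpace E G] [Group G] [LieGroup 𝓘(ℝ, E) ∞ G] {n : ℕ}
  (R : ReductiveGroup n E G)

theorem dp_injective : Function.Injective (dp R) := by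
  refine (injective_iff_map_eq_zero _).2 fun X hX => R.immersion_p X fun i j => ?_
  exact congrFun (congrFun hX i) j

/-- `dp` as a continuous linear map into the normed space of functions of two indices. -/
noncomputable def dpCLM : E →L[ℝ] (Fin n → Fin n → ℝ) :=
  LinearMap.toContinuousLinearMap
    { toFun := fun X => dp R X
      map_add' := fun X Y => (dp R).map_add X Y
      map_smul' := fun c X => (dp R).map_smul c X }

theorem dpCLM_injective : Function.Injective (dpCLM R) := dp_injective R

/-- The entries of the covering homomorphism. -/
def entriesP (g : G) (i j : Fin n) : ℝ := (R.p g : Matrix (Fin n) (Fin n) ℝ) i j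

/-- The entries of the covering homomorphism in the chart at the identity. -/
noncomputable def chartP (y : E) : Fin n → Fin n → ℝ := entriesP R ((chartOne E G).symm y)

theorem hasFDerivAt_chartP : HasFDerivAt (chartP R) (dpCLM R) (chartOne E G 1) :=
  hasFDerivAt_pi.2 fun i => hasFDerivAt_pi.2 fun j =>
    hasFDerivAt_comp_chartOne_symm (R.contMDiff_p i j)

/-- Transposition on `GL(n, ℝ)`. -/
def transposeGL (g : GL (Fin n) ℝ) : GL (Fin n) ℝ where
  val := (g : Matrix (Fin n) (Fin n) ℝ).transpose
  inv := ((g⁻¹ : GL (Fin n) ℝ) : Matrix (Fin n) (Fin n) ℝ).transpose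
  val_inv := by rw [← Matrix.transpose_mul, Units.inv_mul, Matrix.transpose_one]
  inv_val := by rw [← Matrix.transpose_mul, Units.mul_inv, Matrix.transpose_one]

theorem continuous_transposeGL : Continuous (transposeGL : GL (Fin n) ℝ → GL (Fin n) ℝ) :=
  Units.continuous_iff.2 ⟨Units.continuous_val.matrix_transpose,
    (Units.continuous_val.comp continuous_inv).matrix_transpose⟩

theorem transposeGL_one : transposeGL (1 : GL (Fin n) ℝ) = 1 :=
  Units.ext (by simp [transposeGL])

theorem transposeGL_mem {g : GL (Fin n) ℝ} (hg : g ∈ R.GR) : transposeGL g ∈ R.GR := by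
  obtain ⟨h, hh, e⟩ := R.transpose_mem g hg
  have : transposeGL g = h := Units.ext e.symm
  rwa [this]

theorem range_p_le : R.p.range ≤ R.GR := by
  obtain ⟨U, -, hU⟩ := R.isOpen_range
  exact fun x hx => (hU.subset hx).2

/-- The transpose of p(g) lies in `G_ℝ` and tends to 1, so it eventually enters the relatively open
image of p. Since a covering is an open map, the lift may be taken in any prescribed neighbourhood
of 1. -/
theorem exists_lift_transposeGL {s : Set G} (hs : s ∈ nhds (1 : G)) :
    ∀ᶠ g in nhds (1 : G), ∃ d ∈ s, R.p d = transposeGL (R.p g) := by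
  obtain ⟨U, hUo, hU⟩ := R.isOpen_range
  have h1 : R.p.rangeRestrict '' s ∈ nhds (1 : R.p.range) := by
    have := R.isCoveringMap.isLocalHomeomorph.isOpenMap.image_mem_nhds hs
    rwa [map_one] at this
  obtain ⟨V, hV, hVs⟩ := mem_nhds_subtype _ _ _ |>.1 h1
  have hc : Filter.Tendsto (fun g => transposeGL (R.p g)) (nhds (1 : G)) (nhds 1) := by
    have := (continuous_transposeGL.comp (continuous_p R)).tendsto (1 : G)
    simpa only [Function.comp_def, map_one, transposeGL_one] using this
  have hUm : U ∈ nhds (1 : GL (Fin n) ℝ) := hUo.mem_nhds (hU.subset (one_mem R.p.range)).1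
  filter_upwards [hc hV, hc hUm] with g hgV hgU
  have hr : transposeGL (R.p g) ∈ R.p.range :=
    hU.superset ⟨hgU, transposeGL_mem R (range_p_le R ⟨g, rfl⟩)⟩
  obtain ⟨d, hd, e⟩ := hVs (show (⟨_, hr⟩ : R.p.range) ∈ Subtype.val ⁻¹' V from hgV)
  exact ⟨d, hd, congrArg Subtype.val e⟩

open Asymptotics Filter Topology in
/-- The Lie algebra of a real reductive group is invariant under transposition. -/
theorem exists_dp_eq_transpose (X : GroupLieAlgebra 𝓘(ℝ, E) G) :
    ∃ Y : GroupLieAlgebra 𝓘(ℝ, E) G, dp R Y = (dp R X).transpose := by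
  obtain ⟨x, rfl⟩ : ∃ x : E, x = X := ⟨X, rfl⟩
  set D := dpCLM R
  set y₀ : E := chartOne E G 1
  set XT : Fin n → Fin n → ℝ := fun i j => dp R x j i with hXT
  -- No regular choice of lift is made. The filter collects all pairs (d, t) with d → 1, t → 0, t ≠
  -- 0 and p(d) = p(line(t))ᵀ; existence of lifts near 1 makes it proper.
  set l : Filter (G × ℝ) := (𝓝 (1 : G) ×ˢ 𝓝[≠] (0 : ℝ)) ⊓
    𝓟 {q | R.p q.1 = transposeGL (R.p (chartLine x q.2))} with hl
  have hne : l.NeBot := by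
    refine inf_principal_neBot_iff.2 fun S hS => ?_
    obtain ⟨s, hs, t, ht, hst⟩ := mem_prod_iff.1 hS
    have h0 : Tendsto (chartLine (G := G) x) (𝓝[≠] (0 : ℝ)) (𝓝 1) := by
      have := (continuousAt_chartLine (G := G) x).tendsto
      rw [chartLine_zero] at this
      exact this.mono_left nhdsWithin_le_nhds
    obtain ⟨τ, ⟨d, hd, e⟩, hτ⟩ := ((h0.eventually (exists_lift_transposeGL R hs)).and ht).exists
    exact ⟨(d, τ), hst ⟨hd, hτ⟩, e⟩
  have hl1 : Tendsto Prod.fst l (𝓝 (1 : G)) := tendsto_fst.mono_left inf_le_left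
  have hl2 : Tendsto Prod.snd l (𝓝[≠] (0 : ℝ)) := tendsto_snd.mono_left inf_le_left
  have hl3 : ∀ᶠ q in l, R.p q.1 = transposeGL (R.p (chartLine x q.2)) :=
    mem_inf_of_right (mem_principal_self _)
  have hy : Tendsto (fun q : G × ℝ => chartOne E G q.1) l (𝓝 y₀) :=
    (continuousAt_extChartAt (I := 𝓘(ℝ, E)) (1 : G)).tendsto.comp hl1
  -- the two first-order expansions
  have hP : (fun q : G × ℝ => entriesP R q.1 -
      chartP R y₀ - D (chartOne E G q.1 - y₀)) =o[l] fun q => chartOne E G q.1 - y₀ := by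
    have := (hasFDerivAt_chartP R).isLittleO.comp_tendsto hy
    refine this.congr' ?_ EventuallyEq.rfl
    filter_upwards [hl1 (extChartAt_source_mem_nhds (I := 𝓘(ℝ, E)) (1 : G))] with q hq
    have hq' : chartP R (chartOne E G q.1) = entriesP R q.1 :=
      congrArg (entriesP R) ((chartOne E G).left_inv hq)
    simp only [Function.comp_apply, hq']
    rfl
  have hT : (fun q : G × ℝ => entriesP R q.1 -
      chartP R y₀ - q.2 • XT) =o[l] fun q => q.2 := by
    have h1 : HasDerivAt (fun t => fun i j => entriesP R (chartLine x t) j i) XT 0 :=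
      hasDerivAt_pi.2 fun i => hasDerivAt_pi.2 fun j =>
        hasDerivAt_comp_chartLine (R.contMDiff_p j i) x
    have h2 := h1.isLittleO.comp_tendsto (hl2.mono_right nhdsWithin_le_nhds)
    refine h2.congr' ?_ ?_
    · filter_upwards [hl3] with q hq
      have e1 : entriesP R q.1 = fun i j => entriesP R (chartLine x q.2) j i := by
        ext i j
        rw [entriesP, hq]
        rfl
      have e2 : chartP R y₀ = fun i j => entriesP R (chartLine x 0) j i := by
        ext i j
        rw [chartLine_zero, chartP, chartOne_symm_one]
        simp [entriesP, Matrix.one_apply, eq_comm]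
      simp only [Function.comp_apply, e1, e2, sub_zero]
    · exact Eventually.of_forall fun q => by simp
  obtain ⟨c, -, hc⟩ : ∃ c > 0, AntilipschitzWith c D :=
    (D : E →ₗ[ℝ] (Fin n → Fin n → ℝ)).exists_antilipschitzWith
      (LinearMap.ker_eq_bot.2 (dpCLM_injective R))
  have hB : (fun q : G × ℝ => chartOne E G q.1 - y₀) =O[l]
      fun q => D (chartOne E G q.1 - y₀) :=
    IsBigO.of_bound c (Eventually.of_forall fun q => by
      simpa only [map_zero, neg_zero, zero_add] using
        hc.le_mul_norm_sub 0 (chartOne E G q.1 - y₀))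
  have hS : (fun q : G × ℝ => entriesP R q.1 -
      chartP R y₀) =O[l] fun q => q.2 := by
    have h1 : (fun q : G × ℝ => q.2 • XT) =O[l] fun q => q.2 :=
      IsBigO.of_bound ‖XT‖ (Eventually.of_forall fun q => by rw [norm_smul, mul_comm])
    simpa using hT.isBigO.add h1
  -- The immersion property makes D injective, hence bounded below, so p(d) - 1 and D(d - y₀) in the
  -- chart are asymptotically equivalent. The former is O(t), and therefore so is the chart
  -- displacement of d.
  have hu : (fun q : G × ℝ => chartOne E G q.1 - y₀) =O[l] fun q => q.2 :=
    hB.trans ((show IsEquivalent l _ _ from hP.trans_isBigO hB).isBigO_symm.trans hS)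
  have hfin : (fun q : G × ℝ => D (chartOne E G q.1 - y₀) - q.2 • XT) =o[l] fun q => q.2 := by
    refine (hT.sub (hP.trans_isBigO hu)).congr_left fun q => by abel
  have hlim : Tendsto (fun q : G × ℝ => D (q.2⁻¹ • (chartOne E G q.1 - y₀))) l (𝓝 XT) := by
    rw [tendsto_iff_norm_sub_tendsto_zero]
    have h1 := hfin.norm_left.tendsto_div_nhds_zero
    have h2 := h1.norm
    rw [norm_zero] at h2
    refine h2.congr' ?_
    filter_upwards [hl2 self_mem_nhdsWithin] with q hq
    have hq : q.2 ≠ 0 := hq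
    rw [map_smul, norm_div, norm_norm, div_eq_inv_mul, ← norm_inv, ← norm_smul, smul_sub,
      smul_smul, inv_mul_cancel₀ hq, one_smul]
  -- The difference quotients lie in the range of D and converge to Xᵀ. A finite-dimensional range
  -- is closed, so Xᵀ belongs to it although the quotients upstairs need not have been shown to
  -- converge.
  have hcl : IsClosed ((LinearMap.range (D : E →ₗ[ℝ] (Fin n → Fin n → ℝ)) : Submodule ℝ _) :
      Set (Fin n → Fin n → ℝ)) :=
    (LinearMap.range (D : E →ₗ[ℝ] (Fin n → Fin n → ℝ))).closed_of_finiteDimensional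
  obtain ⟨Y, hY⟩ := hcl.mem_of_tendsto hlim (Eventually.of_forall fun q => ⟨_, rfl⟩)
  exact ⟨Y, hY⟩

end Transpose

/-! ### Independence of the Casimir contraction from the basis -/

section Contraction

variable {W U : Type*} [AddCommGroup W] [Module ℝ W] [AddCommGroup U] [Module ℝ U]
  {ι κ : Type*} [Fintype ι] [Fintype κ] [DecidableEq ι] [DecidableEq κ]

open Matrix in
-- If P is the transition matrix, the Gram matrix Γ becomes PᵀΓP, and P(PᵀΓP)⁻¹Pᵀ = Γ⁻¹. Only P has
-- to be invertible: the identity also holds for the conventional inverse of a singular Γ, so the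
-- form need not be nondegenerate.
theorem contraction_congr_aux (b c : Module.Basis ι ℝ W)
    (B : W →ₗ[ℝ] W →ₗ[ℝ] ℝ) (m : W →ₗ[ℝ] W →ₗ[ℝ] U) :
    ∑ i, ∑ j, (Matrix.of fun k l => B (b k) (b l))⁻¹ i j • m (b i) (b j) =
      ∑ i, ∑ j, (Matrix.of fun k l => B (c k) (c l))⁻¹ i j • m (c i) (c j) := by
  set P := c.toMatrix b with hP
  have hb : ∀ i, b i = ∑ k, P k i • c k := fun i => (c.sum_toMatrix_smul_self b i).symm
  have hinv : P * b.toMatrix c = 1 := c.toMatrix_mul_toMatrix_flip b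
  have hu : IsUnit P.det := (Matrix.isUnit_iff_isUnit_det _).1
    (IsUnit.of_mul_eq_one _ hinv)
  set Γ := Matrix.of fun k l => B (c k) (c l) with hΓ
  have hgram : (Matrix.of fun k l => B (b k) (b l)) = Pᵀ * Γ * P := by
    ext i j
    simp only [Matrix.of_apply, hb, map_sum, map_smul, LinearMap.sum_apply, LinearMap.smul_apply,
      smul_eq_mul, Matrix.mul_apply, Matrix.transpose_apply, hΓ, Finset.sum_mul, Finset.mul_sum]
    exact Finset.sum_congr rfl fun k _ => Finset.sum_congr rfl fun l _ => by ring
  have hfin : P * (Pᵀ * Γ * P)⁻¹ * Pᵀ = Γ⁻¹ := by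
    have hut : IsUnit Pᵀ.det := by rwa [Matrix.det_transpose]
    rw [Matrix.mul_inv_rev, Matrix.mul_inv_rev, ← mul_assoc, Matrix.mul_nonsing_inv _ hu, one_mul,
      mul_assoc, Matrix.nonsing_inv_mul _ hut, mul_one]
  rw [hgram]
  set Q := (Pᵀ * Γ * P)⁻¹
  rw [← hfin]
  have h1 : ∀ i j, Q i j • m (b i) (b j) =
      ∑ k, ∑ l, (P k i * Q i j * P l j) • m (c k) (c l) := by
    intro i j
    simp only [hb, map_sum, map_smul, LinearMap.sum_apply, LinearMap.smul_apply, Finset.smul_sum,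
      smul_smul]
    rw [Finset.sum_comm]
    exact Finset.sum_congr rfl fun k _ => Finset.sum_congr rfl fun l _ => by congr 1; ring
  have h2 : ∀ k l, (P * Q * Pᵀ) k l • m (c k) (c l) =
      ∑ i, ∑ j, (P k i * Q i j * P l j) • m (c k) (c l) := by
    intro k l
    simp only [Matrix.mul_apply, Matrix.transpose_apply, Finset.sum_mul, Finset.sum_smul]
    rw [Finset.sum_comm]
  simp only [h1, h2]
  calc _ = ∑ i, ∑ k, ∑ j, ∑ l, (P k i * Q i j * P l j) • m (c k) (c l) :=
        Finset.sum_congr rfl fun i _ => Finset.sum_comm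
    _ = ∑ k, ∑ i, ∑ j, ∑ l, (P k i * Q i j * P l j) • m (c k) (c l) := Finset.sum_comm
    _ = ∑ k, ∑ i, ∑ l, ∑ j, (P k i * Q i j * P l j) • m (c k) (c l) :=
        Finset.sum_congr rfl fun k _ => Finset.sum_congr rfl fun i _ => Finset.sum_comm
    _ = _ := Finset.sum_congr rfl fun k _ => Finset.sum_comm

/-- The contraction of a bilinear map with the inverse of the Gram matrix of a bilinear form does
not depend on the basis. -/
theorem contraction_congr (b : Module.Basis ι ℝ W) (c : Module.Basis κ ℝ W)
    (B : W →ₗ[ℝ] W →ₗ[ℝ] ℝ) (m : W →ₗ[ℝ] W →ₗ[ℝ] U) :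
    ∑ i, ∑ j, (Matrix.of fun k l => B (b k) (b l))⁻¹ i j • m (b i) (b j) =
      ∑ i, ∑ j, (Matrix.of fun k l => B (c k) (c l))⁻¹ i j • m (c i) (c j) := by
  set e := b.indexEquiv c
  rw [contraction_congr_aux b (c.reindex e.symm) B m, ← e.sum_comp]
  refine Finset.sum_congr rfl fun i _ => ?_
  rw [← e.sum_comp]
  refine Finset.sum_congr rfl fun j _ => ?_
  have h : (Matrix.of fun k l => B (c.reindex e.symm k) (c.reindex e.symm l)) =
      (Matrix.of fun k l => B (c k) (c l)).submatrix e e := by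
    ext k l; simp
  rw [h, Matrix.inv_submatrix_equiv]
  simp

/-- The contraction with respect to a basis in which the form is diagonal with entries `±1`. -/
theorem contraction_eq_of_diagonal (b : Module.Basis ι ℝ W) (c : Module.Basis κ ℝ W)
    (B : W →ₗ[ℝ] W →ₗ[ℝ] ℝ) (m : W →ₗ[ℝ] W →ₗ[ℝ] U) (ε : κ → ℝ) (hε : ∀ i, ε i * ε i = 1)
    (hB : ∀ i j, B (c i) (c j) = if i = j then ε i else 0) :
    ∑ i, ∑ j, (Matrix.of fun k l => B (b k) (b l))⁻¹ i j • m (b i) (b j) =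
      ∑ i, ε i • m (c i) (c i) := by
  rw [contraction_congr b c]
  have h : (Matrix.of fun k l => B (c k) (c l)) = Matrix.diagonal ε := by
    ext i j
    rw [Matrix.of_apply, hB, Matrix.diagonal_apply]
  have h2 : (Matrix.diagonal ε)⁻¹ = Matrix.diagonal ε := by
    refine Matrix.inv_eq_right_inv ?_
    rw [Matrix.diagonal_mul_diagonal]
    simp [hε]
  rw [h, h2]
  refine Finset.sum_congr rfl fun i _ => ?_
  rw [Finset.sum_eq_single i]
  · simp
  · intro j _ hj
    rw [Matrix.diagonal_apply_ne _ hj.symm, zero_smul]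
  · simp

end Contraction

/-! ### The Cartan decomposition and the formula for `Δ` -/

section Laplacian

variable {E : Type*} [NormedAddCommGroup E] [NormedSpace ℝ E] [FiniteDimensional ℝ E]
  {G : Type*} [TopologicalSpace G] [ChartedSpace E G] [Group G] [LieGroup 𝓘(ℝ, E) ∞ G] {n : ℕ}
  (R : ReductiveGroup n E G)

/-- The form `B` as a bilinear map. -/
noncomputable def formBilin : GroupLieAlgebra 𝓘(ℝ, E) G →ₗ[ℝ] GroupLieAlgebra 𝓘(ℝ, E) G →ₗ[ℝ] ℝ :=
  LinearMap.mk₂ ℝ (fun X Y => (dp R X * dp R Y).trace)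
    (fun X Y Z => by simp [add_mul]) (fun c X Y => by simp)
    (fun X Y Z => by simp [mul_add]) (fun c X Y => by simp)

/-- The positive definite form `tr(XYᵀ)` as a bilinear map. -/
noncomputable def innerBilin :
    GroupLieAlgebra 𝓘(ℝ, E) G →ₗ[ℝ] GroupLieAlgebra 𝓘(ℝ, E) G →ₗ[ℝ] ℝ :=
  LinearMap.mk₂ ℝ (fun X Y => (dp R X * (dp R Y).transpose).trace)
    (fun X Y Z => by simp [add_mul]) (fun c X Y => by simp)
    (fun X Y Z => by simp [mul_add]) (fun c X Y => by simp)

theorem innerBilin_apply (X Y : GroupLieAlgebra 𝓘(ℝ, E) G) :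
    innerBilin R X Y = (dp R X * (dp R Y).transpose).trace := rfl

variable (E G) in
/-- The product in the enveloping algebra of two elements of the Lie algebra. -/
noncomputable def envMul : GroupLieAlgebra 𝓘(ℝ, E) G →ₗ[ℝ] GroupLieAlgebra 𝓘(ℝ, E) G →ₗ[ℝ]
    UniversalEnvelopingAlgebra ℝ (GroupLieAlgebra 𝓘(ℝ, E) G) :=
  LinearMap.mk₂ ℝ
    (fun X Y => UniversalEnvelopingAlgebra.ι ℝ X * UniversalEnvelopingAlgebra.ι ℝ Y)
    (fun X Y Z => by rw [map_add, add_mul]) (fun c X Y => by rw [map_smul, smul_mul_assoc])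
    (fun X Y Z => by rw [map_add, mul_add]) (fun c X Y => by rw [map_smul, mul_smul_comm])

theorem envMul_apply (X Y : GroupLieAlgebra 𝓘(ℝ, E) G) : envMul E G X Y =
    UniversalEnvelopingAlgebra.ι ℝ X * UniversalEnvelopingAlgebra.ι ℝ Y := rfl

instance : FiniteDimensional ℝ (GroupLieAlgebra 𝓘(ℝ, E) G) :=
  inferInstanceAs (FiniteDimensional ℝ E)

theorem casimir_eq {κ : Type*} [Fintype κ] [DecidableEq κ]
    (W : Submodule ℝ (GroupLieAlgebra 𝓘(ℝ, E) G)) (c : Module.Basis κ ℝ W) (ε : κ → ℝ)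
    (hε : ∀ i, ε i * ε i = 1)
    (hB : ∀ i j, (dp R (c i) * dp R (c j)).trace = if i = j then ε i else 0) :
    casimir R W = ∑ i, ε i • (UniversalEnvelopingAlgebra.ι ℝ (c i : GroupLieAlgebra 𝓘(ℝ, E) G) *
      UniversalEnvelopingAlgebra.ι ℝ (c i : GroupLieAlgebra 𝓘(ℝ, E) G)) :=
  contraction_eq_of_diagonal (Module.finBasis ℝ W) c
    ((formBilin R).compl₁₂ W.subtype W.subtype) ((envMul E G).compl₁₂ W.subtype W.subtype) ε hε hB

/-- Every subspace has a basis that is orthonormal with respect to `tr(XYᵀ)`. -/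
theorem exists_orthonormal_basis (W : Submodule ℝ (GroupLieAlgebra 𝓘(ℝ, E) G)) :
    ∃ (m : ℕ) (b : Module.Basis (Fin m) ℝ W),
      ∀ i j, (dp R (b i) * (dp R (b j)).transpose).trace = if i = j then 1 else 0 := by
  -- The matrix entries embed Lie(G) in a Euclidean space in which tr(XYᵀ) is the standard inner
  -- product.
  let j : GroupLieAlgebra 𝓘(ℝ, E) G →ₗ[ℝ] EuclideanSpace ℝ (Fin n × Fin n) :=
    { toFun := fun X => WithLp.toLp 2 fun ij => dp R X ij.1 ij.2
      map_add' := fun X Y => by ext ij; simp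
      map_smul' := fun c X => by ext ij; simp }
  have hj : Function.Injective j := fun X Y h => dp_injective R (by
    ext a b
    exact congrArg (fun v : EuclideanSpace ℝ (Fin n × Fin n) => v (a, b)) h)
  have hin : ∀ X Y, (dp R X * (dp R Y).transpose).trace = inner ℝ (j X) (j Y) := by
    intro X Y
    simp only [Matrix.trace, Matrix.diag_apply, Matrix.mul_apply, Matrix.transpose_apply,
      PiLp.inner_apply, Fintype.sum_prod_type, j]
    simp [mul_comm]
  let e := Submodule.equivMapOfInjective j hj W
  let o := stdOrthonormalBasis ℝ (W.map j)
  refine ⟨_, o.toBasis.map e.symm, fun a b => ?_⟩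
  rw [hin]
  have he : ∀ i, j ((o.toBasis.map e.symm i : W) : GroupLieAlgebra 𝓘(ℝ, E) G) = (o i : _) := by
    intro i
    rw [← Submodule.coe_equivMapOfInjective_apply j hj W]
    simp [e]
  rw [he, he, ← Submodule.coe_inner, o.inner_eq_ite]

/-- The subspace of the elements of `Lie(G)` that `dp` maps to symmetric matrices. -/
noncomputable def lieP : Submodule ℝ (GroupLieAlgebra 𝓘(ℝ, E) G) where
  carrier := {X | (dp R X).transpose = dp R X}
  zero_mem' := by simp
  add_mem' := by
    intro X Y hX hY
    simp only [Set.mem_ofPred_eq] at *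
    rw [map_add, Matrix.transpose_add, hX, hY]
  smul_mem' := by
    intro c X hX
    simp only [Set.mem_ofPred_eq] at *
    rw [map_smul, Matrix.transpose_smul, hX]

/-- The Cartan decomposition. -/
theorem isCompl_lieK_lieP : IsCompl (lieK R) (lieP R) := by
  constructor
  · rw [Submodule.disjoint_def]
    intro X hK hP
    refine dp_injective R ?_
    have h1 : (dp R X).transpose = -dp R X := hK
    have h2 : (dp R X).transpose = dp R X := hP
    rw [h1] at h2
    rw [map_zero]
    ext i j
    have h3 : -(dp R X i j) = dp R X i j := congrFun (congrFun h2 i) j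
    rw [Matrix.zero_apply]
    linarith
  · rw [codisjoint_iff, Submodule.eq_top_iff']
    intro X
    obtain ⟨Y, hY⟩ := exists_dp_eq_transpose R X
    have h : X = (1 / 2 : ℝ) • (X - Y) + (1 / 2 : ℝ) • (X + Y) := by module
    rw [h]
    refine Submodule.add_mem_sup (Submodule.smul_mem _ _ ?_) (Submodule.smul_mem _ _ ?_)
    · change (dp R (X - Y)).transpose = -dp R (X - Y)
      rw [map_sub, hY, Matrix.transpose_sub, Matrix.transpose_transpose, neg_sub]
    · change (dp R (X + Y)).transpose = dp R (X + Y)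
      rw [map_add, hY, Matrix.transpose_add, Matrix.transpose_transpose, add_comm]

theorem trace_mul_eq_zero {A B : Matrix (Fin n) (Fin n) ℝ} (hA : A.transpose = -A)
    (hB : B.transpose = B) : (A * B).trace = 0 := by
  have h := Matrix.trace_transpose (A * B)
  rw [Matrix.transpose_mul, hA, hB, mul_neg, Matrix.trace_neg, Matrix.trace_mul_comm] at h
  linarith

/-- `Δ` is the sum of the squares of an orthonormal basis. -/
theorem laplacian_eq {m : ℕ} (X : Module.Basis (Fin m) ℝ (GroupLieAlgebra 𝓘(ℝ, E) G))
    (hX : ∀ i j, (dp R (X i) * (dp R (X j)).transpose).trace = if i = j then 1 else 0) :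
    laplacian R = ∑ i, UniversalEnvelopingAlgebra.ι ℝ (X i) ^ 2 := by
  obtain ⟨d, b, hb⟩ := exists_orthonormal_basis R (lieK R)
  obtain ⟨d', b', hb'⟩ := exists_orthonormal_basis R (lieP R)
  -- A basis adapted to the Cartan decomposition diagonalizes both forms: tr(XY) has entries -1 on
  -- the skew part and +1 on the symmetric part, while tr(XYᵀ) has all entries 1.
  let c : Module.Basis (Fin d ⊕ Fin d') ℝ (GroupLieAlgebra 𝓘(ℝ, E) G) :=
    (b.prod b').map (Submodule.prodEquivOfIsCompl _ _ (isCompl_lieK_lieP R))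
  have hl : ∀ i, c (Sum.inl i) = b i := fun i => by simp [c]
  have hr : ∀ i, c (Sum.inr i) = b' i := fun i => by simp [c]
  have hk : ∀ i, (dp R (b i)).transpose = -dp R (b i) := fun i => (b i).2
  have hp : ∀ i, (dp R (b' i)).transpose = dp R (b' i) := fun i => (b' i).2
  have hbk : ∀ i j, (dp R (b i) * dp R (b j)).trace = if i = j then -1 else 0 := by
    intro i j
    have := hb i j
    rw [hk, mul_neg, Matrix.trace_neg, neg_eq_iff_eq_neg] at this
    rw [this]
    split_ifs <;> simp
  have hbp : ∀ i j, (dp R (b' i) * dp R (b' j)).trace = if i = j then 1 else 0 := by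
    intro i j
    have := hb' i j
    rwa [hp] at this
  have hbkp : ∀ i j, (dp R (b i) * dp R (b' j)).trace = 0 := fun i j =>
    trace_mul_eq_zero (hk i) (hp j)
  have hbpk : ∀ i j, (dp R (b' i) * dp R (b j)).trace = 0 := fun i j => by
    rw [Matrix.trace_mul_comm]; exact hbkp j i
  have hC : casimir R ⊤ = ∑ i, Sum.elim (fun _ => (-1 : ℝ)) (fun _ => 1) i •
      (UniversalEnvelopingAlgebra.ι ℝ (c i) * UniversalEnvelopingAlgebra.ι ℝ (c i)) := by
    refine casimir_eq R ⊤ (c.map Submodule.topEquiv.symm) _ (by rintro (i | i) <;> simp) ?_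
    rintro (i | i) (j | j)
    · simpa [hl] using hbk i j
    · simpa [hl, hr] using hbkp i j
    · simpa [hl, hr] using hbpk i j
    · simpa [hr] using hbp i j
  -- On Lie(K) all signs are -1, so subtracting 2C_K turns the negative half of C positive.
  have hCK := casimir_eq R (lieK R) b (fun _ => -1) (by simp) hbk
  -- Contraction against tr(XYᵀ), whose Gram matrix is the identity in both bases, carries the sum
  -- of squares from the given basis X to the adapted basis.
  have hS := contraction_eq_of_diagonal X c (innerBilin R) (envMul E G) (fun _ => 1) (by simp) (by
    simp only [innerBilin_apply]
    rintro (i | i) (j | j)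
    · simpa [hl] using hb i j
    · simpa [hl, hr, hp] using hbkp i j
    · simpa [hl, hr, hk] using hbpk i j
    · simpa [hr] using hb' i j)
  rw [contraction_eq_of_diagonal X X (innerBilin R) (envMul E G) (fun _ => 1) (by simp) hX] at hS
  simp only [one_smul, envMul_apply, ← sq] at hS
  rw [hS, laplacian, hC, hCK]
  simp only [Fintype.sum_sum_type, hl, hr, Sum.elim_inl, Sum.elim_inr, neg_smul, one_smul,
    Finset.sum_neg_distrib, ← sq]
  module

end Laplacian

/-! ### Averaging inner products along a family of operators -/

section AveragedForm

open MeasureTheory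

variable {H : Type*} [NormedAddCommGroup H] [InnerProductSpace ℂ H]
  {S : Type*} [TopologicalSpace S]

/-- A strongly continuous family of operators is bounded on compact sets. -/
theorem exists_bound_of_strongly_continuous [CompleteSpace H] {T : S → H →L[ℂ] H}
    (hT : ∀ v, Continuous fun x => T x v) {K : Set S} (hK : IsCompact K) :
    ∃ M, 0 < M ∧ ∀ x ∈ K, ‖T x‖ ≤ M := by
  obtain ⟨C, hC⟩ := banach_steinhaus (g := fun x : K => T x) fun v => by
    obtain ⟨C, hC⟩ := hK.exists_bound_of_continuousOn (hT v).continuousOn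
    exact ⟨C, fun x => hC x x.2⟩
  exact ⟨max C 1, by positivity, fun x hx => (hC ⟨x, hx⟩).trans (le_max_left _ _)⟩

variable [MeasurableSpace S] [BorelSpace S] (μ : Measure S) [IsFiniteMeasureOnCompacts μ]

theorem integrable_weighted_inner {T : S → H →L[ℂ] H} (hT : ∀ v, Continuous fun x => T x v)
    {χ : S → ℝ} (hχ : Continuous χ) (hc : HasCompactSupport χ) (v w : H) :
    Integrable (fun x => (χ x : ℂ) * inner ℂ (T x v) (T x w)) μ := by
  refine Continuous.integrable_of_hasCompactSupport ?_ ?_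
  · exact (Complex.continuous_ofReal.comp hχ).mul ((hT v).inner (hT w))
  · exact (hc.comp_left (g := fun r : ℝ => (r : ℂ)) Complex.ofReal_zero).mul_right

/-- The weighted average of the inner products that are transported by a family of operators. -/
theorem exists_averaged_form [CompleteSpace H] {T : S → H →L[ℂ] H}
    (hT : ∀ v, Continuous fun x => T x v) {χ : S → ℝ} (hχ : Continuous χ)
    (hc : HasCompactSupport χ) :
    ∃ B : H →L⋆[ℂ] H →L[ℂ] ℂ,
      ∀ v w, B v w = ∫ x, (χ x : ℂ) * inner ℂ (T x v) (T x w) ∂μ := by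
  obtain ⟨M, hM0, hM⟩ := exists_bound_of_strongly_continuous hT (K := tsupport χ) hc
  have hint := integrable_weighted_inner μ hT hχ hc
  let L : H →ₗ⋆[ℂ] H →ₗ[ℂ] ℂ := LinearMap.mk₂'ₛₗ (starRingEnd ℂ) (RingHom.id ℂ)
    (fun v w => ∫ x, (χ x : ℂ) * inner ℂ (T x v) (T x w) ∂μ)
    (fun v v' w => by
      simp only [map_add, inner_add_left, mul_add]
      exact integral_add (hint v w) (hint v' w))
    (fun c v w => by
      simp only [map_smul, inner_smul_left, smul_eq_mul]
      rw [← integral_const_mul]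
      congr 1; ext x; ring)
    (fun v w w' => by
      simp only [map_add, inner_add_right, mul_add]
      exact integral_add (hint v w) (hint v w'))
    (fun c v w => by
      simp only [map_smul, inner_smul_right, smul_eq_mul, RingHom.id_apply]
      rw [← integral_const_mul]
      congr 1; ext x; ring)
  refine ⟨L.mkContinuous₂ ((∫ x, |χ x| ∂μ) * M ^ 2) fun v w => ?_, fun v w => rfl⟩
  have h1 : ‖L v w‖ ≤ ∫ x, |χ x| * (M ^ 2 * ‖v‖ * ‖w‖) ∂μ := by
    refine norm_integral_le_of_norm_le
      ((hχ.abs.integrable_of_hasCompactSupport hc.abs).mul_const _)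
      (Filter.Eventually.of_forall fun x => ?_)
    rw [norm_mul, Complex.norm_real, Real.norm_eq_abs]
    by_cases hx : x ∈ tsupport χ
    · refine mul_le_mul_of_nonneg_left ?_ (abs_nonneg _)
      calc ‖inner ℂ (T x v) (T x w)‖ ≤ ‖T x v‖ * ‖T x w‖ := norm_inner_le_norm _ _
        _ ≤ (M * ‖v‖) * (M * ‖w‖) := by
            gcongr
            · exact (T x).le_of_opNorm_le (hM x hx) v
            · exact (T x).le_of_opNorm_le (hM x hx) w
        _ = M ^ 2 * ‖v‖ * ‖w‖ := by ring
    · simp [image_eq_zero_of_notMem_tsupport hx]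
  refine h1.trans_eq ?_
  rw [integral_mul_const]
  ring

/-- On the support ‖T x v‖ is at least ‖v‖/M, and a nonnegative weight that is not identically zero
has positive integral. -/
theorem averaged_form_coercive [μ.IsOpenPosMeasure] {T : S → H →L[ℂ] H}
    (hT : ∀ v, Continuous fun x => T x v) {χ : S → ℝ} (hχ : Continuous χ)
    (hc : HasCompactSupport χ) (hpos : ∀ x, 0 ≤ χ x) (x₀ : S) (hx₀ : χ x₀ ≠ 0)
    {B : H →L⋆[ℂ] H →L[ℂ] ℂ}
    (hB : ∀ v w, B v w = ∫ x, (χ x : ℂ) * inner ℂ (T x v) (T x w) ∂μ)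
    {M : ℝ} (hM : 0 < M) (hinv : ∀ x ∈ tsupport χ, ∀ v, ‖v‖ ≤ M * ‖T x v‖) :
    ∃ c, 0 < c ∧ ∀ v, c * ‖v‖ ^ 2 ≤ (B v v).re := by
  have hI : 0 < ∫ x, χ x ∂μ := hχ.integral_pos_of_hasCompactSupport_nonneg_nonzero hc hpos hx₀
  refine ⟨(∫ x, χ x ∂μ) * (M⁻¹) ^ 2, by positivity, fun v => ?_⟩
  have hre : (B v v).re = ∫ x, χ x * ‖T x v‖ ^ 2 ∂μ := by
    rw [hB]
    have h := integral_re (integrable_weighted_inner μ hT hχ hc v v)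
    refine Eq.trans h.symm (integral_congr_ae (Filter.Eventually.of_forall fun x => ?_))
    simp only [inner_self_eq_norm_sq_to_K]
    change ((χ x : ℂ) * (‖T x v‖ : ℂ) ^ 2).re = _
    rw [← Complex.ofReal_pow, ← Complex.ofReal_mul, Complex.ofReal_re]
  rw [hre, mul_assoc, ← integral_mul_const]
  refine integral_mono ((hχ.integrable_of_hasCompactSupport hc).mul_const _) ?_ fun x => ?_
  · exact (hχ.mul ((hT v).norm.pow 2)).integrable_of_hasCompactSupport hc.mul_right
  · by_cases hx : x ∈ tsupport χ
    · refine mul_le_mul_of_nonneg_left ?_ (hpos x)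
      rw [← mul_pow]
      gcongr
      rw [inv_mul_le_iff₀ hM]
      exact hinv x hx v
    · simp [image_eq_zero_of_notMem_tsupport hx]

end AveragedForm

/-- Real scalars are fixed by conjugation, so a sesquilinear form is real bilinear and obeys the
product rule. -/
theorem isBoundedBilinearMap_of_sesquilinear {H : Type*} [NormedAddCommGroup H]
    [InnerProductSpace ℂ H] (B : H →L⋆[ℂ] H →L[ℂ] ℂ) :
    IsBoundedBilinearMap ℝ fun q : H × H => B q.1 q.2 where
  add_left x y z := by simp
  smul_left c x y := by
    rw [RCLike.real_smul_eq_coe_smul (K := ℂ), map_smulₛₗ]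
    simp
  add_right x y z := by simp
  smul_right c x y := by
    rw [RCLike.real_smul_eq_coe_smul (K := ℂ), map_smul]
    simp
  bound := ⟨‖B‖ + 1, by positivity, fun x y => (B.le_opNorm₂ x y).trans (by gcongr; linarith)⟩

/-! ### An inner product that is almost invariant under the group -/

section FirstOrder

variable {E : Type*} [NormedAddCommGroup E] [NormedSpace ℝ E] [FiniteDimensional ℝ E]
  {G : Type*} [TopologicalSpace G] [ChartedSpace E G] [Group G] [LieGroup 𝓘(ℝ, E) ∞ G]
  {H : Type*} [NormedAddCommGroup H] [InnerProductSpace ℂ H] {n : ℕ} (R : ReductiveGroup n E G)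

open Asymptotics Topology Filter in
theorem entrySum_chartLine_isBigO (X : E) :
    (fun t : ℝ => entrySum ((R.p (chartLine X t) : Matrix (Fin n) (Fin n) ℝ) - 1))
      =O[𝓝 0] fun t => t := by
  refine IsBigO.fun_sum fun i _ => IsBigO.fun_sum fun j _ => ?_
  have h := (hasDerivAt_comp_chartLine (R.contMDiff_p i j) X).isBigO_sub
  simp only [chartLine_zero, sub_zero, map_one, Units.val_one] at h
  exact h.abs_left

open Asymptotics Topology Filter in
-- Uniformity over compact sets is what allows the difference quotient of the cut-off to be
-- estimated under an integral.
theorem cutoff_chartLine_le (X : E) {K : Set G} (hK : IsCompact K) :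
    ∃ C, 0 ≤ C ∧ ∀ᶠ t in 𝓝 (0 : ℝ), ∀ g ∈ K,
      |cutoffGL (R.p (chartLine X t * g)) - cutoffGL (R.p g)| ≤ C * |t| := by
  obtain ⟨A, hA0, hA⟩ := (entrySum_chartLine_isBigO R X).exists_pos
  have hc1 : Continuous fun g : G => entrySum (R.p g : Matrix (Fin n) (Fin n) ℝ) :=
    continuous_entrySum.comp (Units.continuous_val.comp (continuous_p R))
  have hc2 : Continuous fun g : G =>
      entrySum (((R.p g)⁻¹ : GL (Fin n) ℝ) : Matrix (Fin n) (Fin n) ℝ) :=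
    continuous_entrySum.comp (Units.continuous_val.comp (continuous_inv.comp (continuous_p R)))
  obtain ⟨M₁, hM₁⟩ := hK.exists_bound_of_continuousOn hc1.continuousOn
  obtain ⟨M₂, hM₂⟩ := hK.exists_bound_of_continuousOn hc2.continuousOn
  -- At t = 0 the inverse has entry sum equal to that of 1, so D bounds it for all small t. It turns
  -- a bound on a - 1 into one on a⁻¹ - 1 = -a⁻¹(a - 1).
  set D := entrySum (1 : Matrix (Fin n) (Fin n) ℝ) + 1 with hD
  have hev : ∀ᶠ t in 𝓝 (0 : ℝ), entrySum
      (((R.p (chartLine X t))⁻¹ : GL (Fin n) ℝ) : Matrix (Fin n) (Fin n) ℝ) < D := by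
    have h := hc2.continuousAt.comp (continuousAt_chartLine (G := G) X)
    refine h.eventually_lt continuousAt_const ?_
    simp [chartLine_zero, hD]
  refine ⟨|A * M₁ + M₂ * (D * A)|, abs_nonneg _, ?_⟩
  filter_upwards [hA.bound, hev] with t ht1 ht2 g hg
  rw [Real.norm_of_nonneg (entrySum_nonneg _), Real.norm_eq_abs] at ht1
  rw [map_mul]
  refine (cutoffGL_mul_sub_le _ _).trans ?_
  have b1 := (le_abs_self _).trans (hM₁ g hg)
  have b2 := (le_abs_self _).trans (hM₂ g hg)
  have b3 : entrySum ((((R.p (chartLine X t))⁻¹ : GL (Fin n) ℝ) : Matrix (Fin n) (Fin n) ℝ) - 1) ≤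
      D * (A * |t|) := by
    have e : (((R.p (chartLine X t))⁻¹ : GL (Fin n) ℝ) : Matrix (Fin n) (Fin n) ℝ) - 1 =
        -((((R.p (chartLine X t))⁻¹ : GL (Fin n) ℝ) : Matrix (Fin n) (Fin n) ℝ) *
          ((R.p (chartLine X t) : Matrix (Fin n) (Fin n) ℝ) - 1)) := by
      rw [mul_sub, Units.inv_mul, mul_one, neg_sub]
    rw [e, entrySum_neg]
    exact (entrySum_mul_le _ _).trans
      (mul_le_mul ht2.le ht1 (entrySum_nonneg _) ((entrySum_nonneg _).trans ht2.le))
  calc _ ≤ (A * |t|) * M₁ + M₂ * (D * (A * |t|)) :=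
        add_le_add (mul_le_mul ht1 b1 (entrySum_nonneg _) (by positivity))
          (mul_le_mul b2 b3 (entrySum_nonneg _) ((entrySum_nonneg _).trans b2))
    _ = (A * M₁ + M₂ * (D * A)) * |t| := by ring
    _ ≤ _ := mul_le_mul_of_nonneg_right (le_abs_self _) (abs_nonneg _)

open MeasureTheory Topology Filter Pointwise in
/-- An equivalent inner product on `H` for which the operators of `Lie(G)` are skew-symmetric
up to bounded operators. -/
theorem exists_almost_invariant_form [CompleteSpace H] (R : ReductiveGroup n E G)
    (π : HilbertRep G H) :
    ∃ B : H →L⋆[ℂ] H →L[ℂ] ℂ, (∃ c, 0 < c ∧ ∀ v, c * ‖v‖ ^ 2 ≤ (B v v).re) ∧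
      ∀ X : E, ∃ C, ∀ v ∈ smoothVectors E π, ∀ w ∈ smoothVectors E π,
        ‖B (dpiCLM E π v X) w + B v (dpiCLM E π w X)‖ ≤ C * ‖v‖ * ‖w‖ := by
  have : IsTopologicalGroup G := topologicalGroup_of_lieGroup 𝓘(ℝ, E) ∞
  have : LocallyCompactSpace G := Manifold.locallyCompact_of_finiteDimensional 𝓘(ℝ, E)
  borelize G
  let μ : Measure G := Measure.haar
  set χ : G → ℝ := fun g => cutoffGL (R.p g) with hχdef
  have hχ : Continuous χ := continuous_cutoffGL.comp (continuous_p R)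
  have hc : HasCompactSupport χ := hasCompactSupport_cutoffGL_comp R
  set T : G → H →L[ℂ] H := fun g => π.toHom g⁻¹ with hTdef
  have hT : ∀ v, Continuous fun g => T g v := fun v =>
    (π.continuous_orbit v).comp continuous_inv
  obtain ⟨B, hB⟩ := exists_averaged_form μ hT hχ hc
  refine ⟨B, ?_, fun X => ?_⟩
  · obtain ⟨M, hM0, hM⟩ := exists_bound_of_strongly_continuous
      (T := fun g => π.toHom g) π.continuous_orbit (K := tsupport χ) hc
    refine averaged_form_coercive μ hT hχ hc (fun g => le_max_left _ _) 1 ?_ hB hM0 ?_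
    · simp [hχdef, cutoffGL, entrySum]
    · intro g hg v
      have h := (π.toHom g).le_of_opNorm_le (hM g hg) (T g v)
      rwa [hTdef, ← mul_apply_eq_comp, ← map_mul, mul_inv_cancel, map_one] at h
  · obtain ⟨N, hN, hN1⟩ := exists_compact_mem_nhds (1 : G)
    -- One compact set that contains the supports of χ and of all its translates g ↦ χ(cg), c in N.
    set K : Set G := N⁻¹ * tsupport χ with hKdef
    have hK : IsCompact K := hN.inv.mul hc
    obtain ⟨M, hM0, hM⟩ := exists_bound_of_strongly_continuous hT hK
    obtain ⟨C, hC0, hC⟩ := cutoff_chartLine_le R X hK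
    refine ⟨C * M ^ 2 * μ.real K, fun v hv w hw => ?_⟩
    have hdv := hasDerivAt_comp_chartLine (F := H) hv X
    have hdw := hasDerivAt_comp_chartLine (F := H) hw X
    have hder : HasDerivAt (fun t => B (orbit π v (chartLine X t)) (orbit π w (chartLine X t)))
        (B (dpiCLM E π v X) w + B v (dpiCLM E π w X)) 0 := by
      have h := (isBoundedBilinearMap_of_sesquilinear B).hasFDerivAt
        (orbit π v (chartLine (G := G) X 0), orbit π w (chartLine (G := G) X 0))
      refine (h.comp_hasDerivAt (0 : ℝ) (hdv.prodMk hdw)).congr_deriv ?_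
      simp only [IsBoundedBilinearMap.deriv_apply, chartLine_zero]
      simp only [orbit, map_one, dpiCLM, one_apply_eq_self]
      exact add_comm _ _
    -- The derivative of t ↦ B(π(c_t)v, π(c_t)w) at 0 is bounded by any Lipschitz constant at 0, so
    -- χ need not be differentiable.
    refine hder.le_of_lip' (by positivity) ?_
    have hnear : ∀ᶠ t in 𝓝 (0 : ℝ), chartLine (G := G) X t ∈ N := by
      refine (continuousAt_chartLine (G := G) X).eventually_mem ?_
      rwa [chartLine_zero]
    filter_upwards [hC, hnear] with t ht htN
    set c := chartLine (G := G) X t with hcdef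
    -- Substituting cg for g in the Haar integral, π((cg)⁻¹)π(c) = π(g⁻¹): the group element moves
    -- from the vectors to the cut-off. Thus the estimate involves no derivative of v or w.
    have e1 : B (orbit π v c) (orbit π w c) =
        ∫ g, (χ (c * g) : ℂ) * inner ℂ (T g v) (T g w) ∂μ := by
      rw [hB, ← integral_mul_left_eq_self _ c]
      refine integral_congr_ae (Eventually.of_forall fun g => ?_)
      have : ∀ u, T (c * g) (orbit π u c) = T g u := fun u => by
        simp only [hTdef, orbit]
        rw [← mul_apply_eq_comp, ← map_mul, mul_inv_rev, inv_mul_cancel_right]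
      simp only [this]
    have e0 : B (orbit π v (chartLine X 0)) (orbit π w (chartLine X 0)) =
        ∫ g, (χ g : ℂ) * inner ℂ (T g v) (T g w) ∂μ := by
      rw [← hB, chartLine_zero]; simp [orbit]
    have hcl : HasCompactSupport fun g => χ (c * g) :=
      hc.comp_homeomorph (Homeomorph.mulLeft c)
    rw [e1, e0, ← integral_sub (integrable_weighted_inner μ hT
      (χ := fun g => χ (c * g)) (hχ.comp (continuous_const_mul c)) hcl v w)
      (integrable_weighted_inner μ hT hχ hc v w)]
    have hzero : ∀ g, g ∉ K → (χ (c * g) : ℂ) * inner ℂ (T g v) (T g w) -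
        (χ g : ℂ) * inner ℂ (T g v) (T g w) = 0 := by
      intro g hg
      have z1 : χ g = 0 := image_eq_zero_of_notMem_tsupport fun h => hg
        ⟨1, by simpa using mem_of_mem_nhds hN1, g, h, one_mul g⟩
      have z2 : χ (c * g) = 0 := image_eq_zero_of_notMem_tsupport fun h => hg
        ⟨c⁻¹, by simpa using htN, c * g, h, inv_mul_cancel_left c g⟩
      simp [z1, z2]
    rw [← setIntegral_eq_integral_of_forall_compl_eq_zero hzero]
    refine (norm_setIntegral_le_of_norm_le_const (C := C * |t| * ((M * ‖v‖) * (M * ‖w‖)))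
      hK.measure_lt_top fun g hg => ?_).trans_eq ?_
    · rw [← sub_mul, norm_mul, ← Complex.ofReal_sub, Complex.norm_real, Real.norm_eq_abs]
      have hCt := ht g hg
      refine mul_le_mul hCt ((norm_inner_le_norm _ _).trans ?_) (norm_nonneg _)
        ((abs_nonneg _).trans hCt)
      gcongr
      · exact (T g).le_of_opNorm_le (hM g hg) v
      · exact (T g).le_of_opNorm_le (hM g hg) w
    · rw [sub_zero, Real.norm_eq_abs]; ring

end FirstOrder

/-! ### An induction principle for the enveloping algebra -/

section EnvelopingAlgebra

theorem envelopingAlgebra_induction {L : Type*} [LieRing L] [LieAlgebra ℝ L]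
    {C : UniversalEnvelopingAlgebra ℝ L → Prop}
    (algebraMap : ∀ r, C (algebraMap ℝ (UniversalEnvelopingAlgebra ℝ L) r))
    (ι : ∀ x, C (UniversalEnvelopingAlgebra.ι ℝ x))
    (mul : ∀ a b, C a → C b → C (a * b)) (add : ∀ a b, C a → C b → C (a + b))
    (a : UniversalEnvelopingAlgebra ℝ L) : C a := by
  obtain ⟨t, rfl⟩ : ∃ t, UniversalEnvelopingAlgebra.mkAlgHom ℝ L t = a :=
    Quotient.exists_rep a
  induction t using TensorAlgebra.induction with
  | algebraMap r => rw [AlgHom.commutes]; exact algebraMap r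
  | ι x => exact ι x
  | mul a b ha hb => rw [map_mul]; exact mul _ _ ha hb
  | add a b ha hb => rw [map_add]; exact add _ _ ha hb

end EnvelopingAlgebra

/-! ### The abstract elliptic estimate -/

section Sobolev

variable {V ι : Type*} [AddCommGroup V] [Module ℂ V] [Fintype ι] (ν : Seminorm ℂ V)
  (A : ι → Module.End ℂ V)

/-- The Sobolev seminorms defined by a seminorm and a family of operators. -/
noncomputable def sobolev : ℕ → Seminorm ℂ V
  | 0 => ν
  | k + 1 => sobolev k + ∑ i, (sobolev k).comp (A i)

theorem sobolev_zero (v : V) : sobolev ν A 0 v = ν v := rfl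

theorem sobolev_succ (k : ℕ) (v : V) :
    sobolev ν A (k + 1) v = sobolev ν A k v + ∑ i, sobolev ν A k (A i v) := by
  simp [sobolev]

theorem sobolev_le_succ (k : ℕ) (v : V) : sobolev ν A k v ≤ sobolev ν A (k + 1) v := by
  rw [sobolev_succ]
  exact le_add_of_nonneg_right (Finset.sum_nonneg fun i _ => apply_nonneg _ _)

theorem sobolev_mono {k l : ℕ} (h : k ≤ l) (v : V) : sobolev ν A k v ≤ sobolev ν A l v :=
  monotone_nat_of_le_succ (fun k => sobolev_le_succ ν A k v) h

theorem sobolev_apply_le (k : ℕ) (i : ι) (v : V) :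
    sobolev ν A k (A i v) ≤ sobolev ν A (k + 1) v := by
  rw [sobolev_succ]
  exact (Finset.single_le_sum (f := fun i => sobolev ν A k (A i v))
    (fun i _ => apply_nonneg _ _) (Finset.mem_univ i)).trans
    (le_add_of_nonneg_left (apply_nonneg _ _))

/-- An operator has order `≤ d` if it is bounded from each Sobolev space to the one of
index lower by `d`. -/
def HasOrder (d : ℕ) (T : Module.End ℂ V) : Prop :=
  ∀ k, ∃ C, 0 ≤ C ∧ ∀ v, sobolev ν A k (T v) ≤ C * sobolev ν A (k + d) v

variable {ν A}

theorem HasOrder.mono {d e : ℕ} {T : Module.End ℂ V} (hT : HasOrder ν A d T) (h : d ≤ e) :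
    HasOrder ν A e T := fun k => by
  obtain ⟨C, hC0, hC⟩ := hT k
  exact ⟨C, hC0, fun v => (hC v).trans
    (mul_le_mul_of_nonneg_left (sobolev_mono ν A (by omega) v) hC0)⟩

theorem HasOrder.add {d : ℕ} {T U : Module.End ℂ V} (hT : HasOrder ν A d T)
    (hU : HasOrder ν A d U) : HasOrder ν A d (T + U) := fun k => by
  obtain ⟨C, hC0, hC⟩ := hT k
  obtain ⟨D, hD0, hD⟩ := hU k
  refine ⟨C + D, add_nonneg hC0 hD0, fun v => ?_⟩
  rw [LinearMap.add_apply, add_mul]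
  exact (map_add_le_add _ _ _).trans (add_le_add (hC v) (hD v))

theorem HasOrder.mul {d e : ℕ} {T U : Module.End ℂ V} (hT : HasOrder ν A d T)
    (hU : HasOrder ν A e U) : HasOrder ν A (d + e) (T * U) := fun k => by
  obtain ⟨C, hC0, hC⟩ := hT k
  obtain ⟨D, hD0, hD⟩ := hU (k + d)
  refine ⟨C * D, mul_nonneg hC0 hD0, fun v => (hC _).trans ?_⟩
  rw [mul_assoc, ← add_assoc]
  exact mul_le_mul_of_nonneg_left (hD v) hC0

theorem HasOrder.complex_smul {d : ℕ} {T : Module.End ℂ V} (hT : HasOrder ν A d T) (c : ℂ) :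
    HasOrder ν A d (c • T) := fun k => by
  obtain ⟨C, hC0, hC⟩ := hT k
  refine ⟨‖c‖ * C, by positivity, fun v => ?_⟩
  rw [LinearMap.smul_apply, map_smul_eq_mul, mul_assoc]
  exact mul_le_mul_of_nonneg_left (hC v) (norm_nonneg _)

theorem HasOrder.zero (d : ℕ) : HasOrder ν A d (0 : Module.End ℂ V) := fun k =>
  ⟨0, le_rfl, fun v => by simp⟩

theorem HasOrder.one : HasOrder ν A 0 (1 : Module.End ℂ V) := fun k =>
  ⟨1, zero_le_one, fun v => by simp⟩

theorem HasOrder.sum {d : ℕ} {κ : Type*} (s : Finset κ) {T : κ → Module.End ℂ V}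
    (hT : ∀ i ∈ s, HasOrder ν A d (T i)) : HasOrder ν A d (∑ i ∈ s, T i) := by
  classical
  induction s using Finset.induction_on with
  | empty => simpa using HasOrder.zero d
  | insert i s hi ih =>
    rw [Finset.sum_insert hi]
    exact (hT i (Finset.mem_insert_self i s)).add
      (ih fun j hj => hT j (Finset.mem_insert_of_mem hj))

theorem HasOrder.generator (i : ι) : HasOrder ν A 1 (A i) := fun k =>
  ⟨1, zero_le_one, fun v => by rw [one_mul]; exact sobolev_apply_le ν A k i v⟩

/-- If commutators of the generators have order one, those of `∑ A_i²` with a generator have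
order two. -/
theorem hasOrder_commutator (hcomm : ∀ i j, HasOrder ν A 1 (A i * A j - A j * A i)) (j : ι) :
    HasOrder ν A 2 ((∑ i, A i ^ 2) * A j - A j * ∑ i, A i ^ 2) := by
  have h : (∑ i, A i ^ 2) * A j - A j * ∑ i, A i ^ 2 =
      ∑ i, (A i * (A i * A j - A j * A i) + (A i * A j - A j * A i) * A i) := by
    rw [Finset.sum_mul, Finset.mul_sum, ← Finset.sum_sub_distrib]
    exact Finset.sum_congr rfl fun i _ => by noncomm_ring
  rw [h]
  exact HasOrder.sum _ fun i _ =>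
    ((HasOrder.generator i).mul (hcomm i j)).add ((hcomm i j).mul (HasOrder.generator i))

/-- The elliptic estimate with a small constant, by induction from the first-order estimate. -/
theorem sobolev_succ_le (hcomm : ∀ i j, HasOrder ν A 1 (A i * A j - A j * A i))
    (hfirst : ∃ C, 0 ≤ C ∧ ∀ v, ∑ i, ν (A i v) ^ 2 ≤ C * (ν v ^ 2 + ν v * ν ((∑ i, A i ^ 2) v)))
    (k : ℕ) : ∀ ε > 0, ∃ C, 0 ≤ C ∧ ∀ v, sobolev ν A (k + 1) v ≤
      ε * sobolev ν A k ((∑ i, A i ^ 2) v) + C * sobolev ν A k v := by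
  set D := ∑ i, A i ^ 2 with hD
  set m : ℝ := (Fintype.card ι : ℝ) with hm
  have hm0 : 0 ≤ m := Nat.cast_nonneg _
  induction k with
  | zero =>
    intro ε hε
    obtain ⟨C, hC0, hC⟩ := hfirst
    set δ := ε / (m + 1) with hδ
    have hδ0 : 0 < δ := by positivity
    -- Chosen so that C ≤ C'² and C ≤ 2δC'. Then C(a² + ab) ≤ (δb + C'a)², and taking roots makes
    -- the coefficient of ‖Dv‖ small.
    set C' := C / δ + C + 1 with hC'
    have hC'0 : 0 ≤ C' := by positivity
    refine ⟨1 + m * C', by positivity, fun v => ?_⟩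
    have hi : ∀ i, ν (A i v) ≤ δ * ν (D v) + C' * ν v := by
      intro i
      have ha : 0 ≤ ν v := apply_nonneg _ _
      have hb : 0 ≤ ν (D v) := apply_nonneg _ _
      refine abs_le_of_sq_le_sq' ?_ (by positivity) |>.2
      have h1 : ν (A i v) ^ 2 ≤ ∑ i, ν (A i v) ^ 2 :=
        Finset.single_le_sum (f := fun i => ν (A i v) ^ 2) (fun _ _ => sq_nonneg _)
          (Finset.mem_univ i)
      refine (h1.trans (hC v)).trans ?_
      have e1 : C ≤ C' ^ 2 := by
        have h2 : 0 ≤ C / δ := by positivity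
        have h3 : C + 1 ≤ C' := by rw [hC']; linarith
        nlinarith
      have e2 : C ≤ 2 * δ * C' := by
        have : δ * C' = C + δ * (C + 1) := by rw [hC']; field_simp; ring
        nlinarith [mul_nonneg hδ0.le (by linarith : (0 : ℝ) ≤ C + 1)]
      nlinarith [mul_le_mul_of_nonneg_right e1 (sq_nonneg (ν v)),
        mul_le_mul_of_nonneg_right e2 (mul_nonneg ha hb), sq_nonneg (δ * ν (D v))]
    rw [sobolev_succ]
    simp only [sobolev_zero]
    have hs : ∑ i, ν (A i v) ≤ m * (δ * ν (D v) + C' * ν v) := by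
      refine (Finset.sum_le_sum fun i _ => hi i).trans_eq ?_
      rw [Finset.sum_const, Finset.card_univ, nsmul_eq_mul]
    have hmd : m * δ ≤ ε := by
      rw [hδ, mul_div_assoc', div_le_iff₀ (by positivity)]
      nlinarith
    nlinarith [mul_le_mul_of_nonneg_right hmd (apply_nonneg ν (D v))]
  | succ k ih =>
    intro ε hε
    -- Applying the induction hypothesis to A_i v produces a commutator [D, A_i] of order two, which
    -- costs the very seminorm of index k + 2 that is being estimated. It can be absorbed only if
    -- its coefficient is small; this is why the statement is proved for every ε.
    obtain ⟨K, hK0, hK⟩ : ∃ K, 0 ≤ K ∧ ∀ i v,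
        sobolev ν A k ((D * A i - A i * D) v) ≤ K * sobolev ν A (k + 2) v := by
      choose K hK0 hK using fun i => hasOrder_commutator hcomm i k
      refine ⟨∑ i, K i, Finset.sum_nonneg fun i _ => hK0 i, fun i v => (hK i v).trans ?_⟩
      exact mul_le_mul_of_nonneg_right
        (Finset.single_le_sum (f := K) (fun i _ => hK0 i) (Finset.mem_univ i)) (apply_nonneg _ _)
    -- The first bound leaves ε/2 in front of D, the second leaves at most 1/2 in front of the
    -- absorbed term. Moving that term to the left doubles everything else.
    set δ := min (ε / (2 * (m + 1))) (1 / (2 * (m + 1) * (K + 1))) with hδ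
    have hδ0 : 0 < δ := by positivity
    obtain ⟨C, hC0, hC⟩ := ih δ hδ0
    refine ⟨2 * (1 + m * C), by positivity, fun v => ?_⟩
    have hi : ∀ i, sobolev ν A (k + 1) (A i v) ≤ δ * (sobolev ν A (k + 1) (D v) +
        K * sobolev ν A (k + 2) v) + C * sobolev ν A (k + 1) v := by
      intro i
      refine (hC (A i v)).trans (add_le_add (mul_le_mul_of_nonneg_left ?_ hδ0.le)
        (mul_le_mul_of_nonneg_left (sobolev_apply_le ν A k i v) hC0))
      have e : D (A i v) = A i (D v) + (D * A i - A i * D) v := by simp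
      rw [e]
      exact (map_add_le_add _ _ _).trans (add_le_add (sobolev_apply_le ν A k i _) (hK i v))
    have hs : ∑ i, sobolev ν A (k + 1) (A i v) ≤ m * (δ * (sobolev ν A (k + 1) (D v) +
        K * sobolev ν A (k + 2) v) + C * sobolev ν A (k + 1) v) := by
      refine (Finset.sum_le_sum fun i _ => hi i).trans_eq ?_
      rw [Finset.sum_const, Finset.card_univ, nsmul_eq_mul]
    have h0 := sobolev_succ ν A (k + 1) v
    have d1 : m * δ ≤ ε / 2 := by
      calc m * δ ≤ (m + 1) * (ε / (2 * (m + 1))) := by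
            gcongr
            · linarith
            · exact min_le_left _ _
        _ = ε / 2 := by field_simp
    have d2 : m * δ * K ≤ 1 / 2 := by
      calc m * δ * K ≤ (m + 1) * (1 / (2 * (m + 1) * (K + 1))) * (K + 1) := by
            gcongr
            · linarith
            · exact min_le_right _ _
            · linarith
        _ = 1 / 2 := by field_simp
    have p1 := mul_le_mul_of_nonneg_right d1 (apply_nonneg (sobolev ν A (k + 1)) (D v))
    have p2 := mul_le_mul_of_nonneg_right d2 (apply_nonneg (sobolev ν A (k + 2)) v)
    change sobolev ν A (k + 2) v ≤ _
    change sobolev ν A (k + 2) v = _ at h0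
    linarith

/-- The powers of `∑ A_i²` dominate the Sobolev seminorms. -/
theorem sobolev_le_sum (hcomm : ∀ i j, HasOrder ν A 1 (A i * A j - A j * A i))
    (hfirst : ∃ C, 0 ≤ C ∧ ∀ v, ∑ i, ν (A i v) ^ 2 ≤ C * (ν v ^ 2 + ν v * ν ((∑ i, A i ^ 2) v)))
    (k : ℕ) : ∃ C, 0 ≤ C ∧ ∀ v, sobolev ν A k v ≤
      C * ∑ l ∈ Finset.range (k + 1), ν (((∑ i, A i ^ 2) ^ l) v) := by
  set D := ∑ i, A i ^ 2 with hD
  induction k with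
  | zero => exact ⟨1, zero_le_one, fun v => by simp [sobolev_zero]⟩
  | succ k ih =>
    obtain ⟨C, hC0, hC⟩ := ih
    obtain ⟨C', hC'0, hC'⟩ := sobolev_succ_le hcomm hfirst k 1 one_pos
    refine ⟨C + C' * C, by positivity, fun v => (hC' v).trans ?_⟩
    have h1 : ∑ l ∈ Finset.range (k + 1), ν ((D ^ l) (D v)) ≤
        ∑ l ∈ Finset.range (k + 1 + 1), ν ((D ^ l) v) := by
      rw [Finset.sum_range_succ' (fun l => ν ((D ^ l) v)) (k + 1)]
      refine le_add_of_le_of_nonneg (le_of_eq (Finset.sum_congr rfl fun l _ => ?_))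
        (apply_nonneg _ _)
      rw [pow_succ, Module.End.mul_apply]
    have h2 : ∑ l ∈ Finset.range (k + 1), ν ((D ^ l) v) ≤
        ∑ l ∈ Finset.range (k + 1 + 1), ν ((D ^ l) v) := by
      rw [Finset.sum_range_succ _ (k + 1)]
      exact le_add_of_nonneg_right (apply_nonneg _ _)
    rw [add_mul, one_mul, mul_assoc]
    exact add_le_add ((hC _).trans (mul_le_mul_of_nonneg_left h1 hC0))
      (mul_le_mul_of_nonneg_left ((hC v).trans (mul_le_mul_of_nonneg_left h2 hC0)) hC'0)

end Sobolev

/-! ### Elliptic estimates on the smooth vectors -/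

section SmoothEstimates

variable {E : Type*} [NormedAddCommGroup E] [NormedSpace ℝ E] [FiniteDimensional ℝ E]
  {G : Type*} [TopologicalSpace G] [ChartedSpace E G] [Group G] [LieGroup 𝓘(ℝ, E) ∞ G]
  {H : Type*} [NormedAddCommGroup H] [InnerProductSpace ℂ H] {n : ℕ} (R : ReductiveGroup n E G)
  (π : HilbertRep G H)

variable (E) in
/-- The norm of `H` as a seminorm on `H^∞`. -/
noncomputable def baseSeminorm : Seminorm ℂ (smoothVectors E π) :=
  (normSeminorm ℂ H).comp (smoothVectors E π).subtype

theorem envAction_ι (X : GroupLieAlgebra 𝓘(ℝ, E) G) :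
    envAction π (UniversalEnvelopingAlgebra.ι ℝ X) = lieAction π X :=
  UniversalEnvelopingAlgebra.lift_ι_apply ℝ (lieAction π) X

theorem HasOrder.real_smul {V ι : Type*} [AddCommGroup V] [Module ℂ V] [Fintype ι]
    {ν : Seminorm ℂ V} {A : ι → Module.End ℂ V} {d : ℕ} {T : Module.End ℂ V}
    (hT : HasOrder ν A d T) (c : ℝ) : HasOrder ν A d (c • T) := by
  have h : c • T = (c : ℂ) • T := by
    ext v; simp
  rw [h]
  exact hT.complex_smul _

variable {κ : Type*} [Fintype κ] (X : Module.Basis κ ℝ (GroupLieAlgebra 𝓘(ℝ, E) G))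

theorem hasOrder_lieAction (Y : GroupLieAlgebra 𝓘(ℝ, E) G) :
    HasOrder (baseSeminorm E π) (fun i => lieAction π (X i)) 1 (lieAction π Y) := by
  have h : lieAction π Y = ∑ i, X.repr Y i • lieAction π (X i) := by
    conv_lhs => rw [← X.sum_repr Y]
    simp only [← LieHom.coe_toLinearMap, map_sum, map_smul]
  rw [h]
  exact HasOrder.sum _ fun i _ =>
    (HasOrder.generator (A := fun i => lieAction π (X i)) i).real_smul _

/-- A commutator of two generators is the action of a Lie bracket, again a combination of
generators, so its order is one rather than two. -/
theorem hasOrder_lieAction_commutator (i j : κ) :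
    HasOrder (baseSeminorm E π) (fun i => lieAction π (X i)) 1
      (lieAction π (X i) * lieAction π (X j) - lieAction π (X j) * lieAction π (X i)) := by
  have h := hasOrder_lieAction π X ⁅X i, X j⁆
  rwa [LieHom.map_lie, LieRing.of_associative_ring_bracket] at h

/-- Every element of the enveloping algebra acts by an operator of finite order. -/
theorem exists_hasOrder_envAction
    (x : UniversalEnvelopingAlgebra ℝ (GroupLieAlgebra 𝓘(ℝ, E) G)) :
    ∃ d, HasOrder (baseSeminorm E π) (fun i => lieAction π (X i)) d (envAction π x) := by
  induction x using envelopingAlgebra_induction with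
  | algebraMap r =>
    refine ⟨0, ?_⟩
    rw [AlgHom.commutes, Algebra.algebraMap_eq_smul_one]
    exact HasOrder.one.real_smul r
  | ι Y => exact ⟨1, by rw [envAction_ι]; exact hasOrder_lieAction π X Y⟩
  | mul a b ha hb =>
    obtain ⟨d, hd⟩ := ha
    obtain ⟨e, he⟩ := hb
    exact ⟨d + e, by rw [map_mul]; exact hd.mul he⟩
  | add a b ha hb =>
    obtain ⟨d, hd⟩ := ha
    obtain ⟨e, he⟩ := hb
    exact ⟨max d e, by
      rw [map_add]
      exact (hd.mono (le_max_left d e)).add (he.mono (le_max_right d e))⟩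

/-- The first-order estimate of elliptic regularity. -/
theorem first_order_estimate [CompleteSpace H] (R : ReductiveGroup n E G) :
    ∃ C, 0 ≤ C ∧ ∀ v : smoothVectors E π,
      ∑ i, baseSeminorm E π (lieAction π (X i) v) ^ 2 ≤ C * (baseSeminorm E π v ^ 2 +
        baseSeminorm E π v * baseSeminorm E π ((∑ i, lieAction π (X i) ^ 2) v)) := by
  obtain ⟨B, ⟨c, hc0, hc⟩, hskew⟩ := exists_almost_invariant_form R π
  choose K hK using fun i => hskew (X i)
  set K' : ℝ := ∑ i, |K i| ^ 2 / c with hK'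
  have hK'0 : 0 ≤ K' := Finset.sum_nonneg fun i _ => by positivity
  refine ⟨(2 / c) * (K' + ‖B‖), by positivity, fun v => ?_⟩
  set a := baseSeminorm E π v with ha
  have ha0 : 0 ≤ a := apply_nonneg _ _
  set b := baseSeminorm E π ((∑ i, lieAction π (X i) ^ 2) v) with hb
  have hb0 : 0 ≤ b := apply_nonneg _ _
  set u : κ → ℝ := fun i => baseSeminorm E π (lieAction π (X i) v) with hu
  have hu0 : ∀ i, 0 ≤ u i := fun i => apply_nonneg _ _
  -- Coercivity bounds c‖X_i v‖² by Re B(X_i v, X_i v), and almost skewness for the pair v, X_i v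
  -- replaces this by -Re B(v, X_i² v) plus K‖v‖‖X_i v‖. Half of the left side absorbs that error.
  have hi : ∀ i, c / 2 * u i ^ 2 ≤
      -(B v ((lieAction π (X i) ^ 2) v : smoothVectors E π)).re + |K i| ^ 2 / c * a ^ 2 := by
    intro i
    have h1 := hc (lieAction π (X i) v : smoothVectors E π)
    have h2 := hK i v v.2 (lieAction π (X i) v : smoothVectors E π) (lieAction π (X i) v).2
    have h3 := (Complex.abs_re_le_norm _).trans h2
    rw [Complex.add_re] at h3
    change |(B (lieAction π (X i) v : smoothVectors E π)
      (lieAction π (X i) v : smoothVectors E π)).re +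
      (B v ((lieAction π (X i) ^ 2) v : smoothVectors E π)).re| ≤ K i * a * u i at h3
    change c * u i ^ 2 ≤ _ at h1
    have h4 := (abs_le.1 h3).2
    have h5 : K i * a * u i ≤ c / 2 * u i ^ 2 + |K i| ^ 2 / c * a ^ 2 := by
      have h6 : K i * a * u i ≤ |K i| * a * u i := by
        gcongr
        exact le_abs_self _
      have h7 : c / 2 * u i ^ 2 + |K i| ^ 2 / c * a ^ 2 - |K i| * a * u i =
          ((c * u i - |K i| * a) ^ 2 + (|K i| * a) ^ 2) / (2 * c) := by
        field_simp; ring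
      have h8 : 0 ≤ ((c * u i - |K i| * a) ^ 2 + (|K i| * a) ^ 2) / (2 * c) := by positivity
      linarith
    linarith
  have hsum := Finset.sum_le_sum fun i (_ : i ∈ Finset.univ) => hi i
  rw [← Finset.mul_sum, Finset.sum_add_distrib, ← Finset.sum_mul, Finset.sum_neg_distrib] at hsum
  -- Only after summation does the second-order term become Δv.
  have hB : -∑ i, (B v ((lieAction π (X i) ^ 2) v : smoothVectors E π)).re ≤ ‖B‖ * a * b := by
    have e : ∑ i, (B v ((lieAction π (X i) ^ 2) v : smoothVectors E π)).re =
        (B v (((∑ i, lieAction π (X i) ^ 2) v : smoothVectors E π) : H)).re := by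
      rw [LinearMap.sum_apply, Submodule.coe_sum, map_sum, Complex.re_sum]
    rw [e]
    exact (neg_le_abs _).trans ((Complex.abs_re_le_norm _).trans (B.le_opNorm₂ _ _))
  have hfin : c / 2 * ∑ i, u i ^ 2 ≤ (K' + ‖B‖) * (a ^ 2 + a * b) := by
    have := mul_nonneg hK'0 (mul_nonneg ha0 hb0)
    have := mul_nonneg (norm_nonneg B) (sq_nonneg a)
    nlinarith
  calc ∑ i, u i ^ 2 = (2 / c) * (c / 2 * ∑ i, u i ^ 2) := by field_simp
    _ ≤ (2 / c) * ((K' + ‖B‖) * (a ^ 2 + a * b)) := by gcongr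
    _ = _ := by ring

theorem envAction_laplacian {m : ℕ} (X : Module.Basis (Fin m) ℝ (GroupLieAlgebra 𝓘(ℝ, E) G))
    (hX : ∀ i j, (dp R (X i) * (dp R (X j)).transpose).trace = if i = j then 1 else 0) :
    envAction π (laplacian R) = ∑ i, lieAction π (X i) ^ 2 := by
  rw [laplacian_eq R X hX, map_sum]
  simp only [map_pow, envAction_ι]

theorem exists_orthonormal_basis_top :
    ∃ (m : ℕ) (X : Module.Basis (Fin m) ℝ (GroupLieAlgebra 𝓘(ℝ, E) G)),
      ∀ i j, (dp R (X i) * (dp R (X j)).transpose).trace = if i = j then 1 else 0 := by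
  obtain ⟨m, b, hb⟩ := exists_orthonormal_basis R ⊤
  exact ⟨m, b.map Submodule.topEquiv, fun i j => by simpa using hb i j⟩

/-- Elliptic regularity: the powers of `Δ` dominate the enveloping algebra. -/
theorem envSeminorm_le [CompleteSpace H]
    (x : UniversalEnvelopingAlgebra ℝ (GroupLieAlgebra 𝓘(ℝ, E) G)) :
    ∃ (C : ℝ) (k : ℕ), 0 ≤ C ∧ ∀ v, envSeminorm π x v ≤
      C * ∑ l ∈ Finset.range k, lapSeminorm R π l v := by
  obtain ⟨m, X, hX⟩ := exists_orthonormal_basis_top R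
  obtain ⟨d, hd⟩ := exists_hasOrder_envAction π X x
  obtain ⟨C, hC0, hC⟩ := hd 0
  obtain ⟨C', hC'0, hC'⟩ := sobolev_le_sum (hasOrder_lieAction_commutator π X)
    (first_order_estimate π X R) (0 + d)
  refine ⟨C * C', 0 + d + 1, by positivity, fun v => (hC v).trans ?_⟩
  rw [mul_assoc]
  refine mul_le_mul_of_nonneg_left ((hC' v).trans_eq ?_) hC0
  rw [← envAction_laplacian R π X hX]
  simp only [← map_pow]
  rfl

end SmoothEstimates

/-! ### Comparison of uniformities defined by seminorms -/

section SeminormUniformity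

variable {V : Type*} [AddCommGroup V] [Module ℂ V]

theorem hasBasis_seminorm_uniformity (q : Seminorm ℂ V) :
    (@uniformity V
      q.toAddGroupSeminorm.toSeminormedAddCommGroup.toPseudoMetricSpace.toUniformSpace).HasBasis
      (fun ε : ℝ => 0 < ε) fun ε => {p | q (p.1 - p.2) < ε} := by
  have h := @Metric.uniformity_basis_dist V
    q.toAddGroupSeminorm.toSeminormedAddCommGroup.toPseudoMetricSpace
  refine h.congr (fun _ => Iff.rfl) fun ε _ => ?_
  ext p
  have : @dist V q.toAddGroupSeminorm.toSeminormedAddCommGroup.toPseudoMetricSpace.toDist p.1 p.2 =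
      q (p.1 - p.2) := by
    let := q.toAddGroupSeminorm.toSeminormedAddCommGroup
    exact dist_eq_norm p.1 p.2
  simp only [Set.mem_ofPred_eq, this]

theorem seminorm_uniformity_eq_comap {F : Type*} [NormedAddCommGroup F] [NormedSpace ℂ F]
    (T : V →ₗ[ℂ] F) : ((normSeminorm ℂ F).comp
      T).toAddGroupSeminorm.toSeminormedAddCommGroup.toPseudoMetricSpace.toUniformSpace =
      UniformSpace.comap T inferInstance := by
  refine UniformSpace.ext ((hasBasis_seminorm_uniformity _).eq_of_same_basis ?_)
  have h := (Metric.uniformity_basis_dist (α := F)).comap (Prod.map T T)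
  refine h.congr (fun _ => Iff.rfl) fun ε _ => ?_
  ext p
  simp [dist_eq_norm, Seminorm.comp_apply]

/-- It turns questions about families ‖T_i v‖ into questions about the image of v ↦ (T_i v)_i in a
product of copies of F: completeness becomes closedness, and density can be tested there. -/
theorem seminormUniformity_eq_comap {ι F : Type*} [NormedAddCommGroup F] [NormedSpace ℂ F]
    (T : ι → V →ₗ[ℂ] F) :
    seminormUniformity (fun i => (normSeminorm ℂ F).comp (T i)) =
      UniformSpace.comap (fun v i => T i v) (Pi.uniformSpace fun _ => F) := by
  rw [Pi.uniformSpace_eq, UniformSpace.comap_iInf]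
  refine iInf_congr fun i => ?_
  rw [← UniformSpace.comap_comap]
  exact seminorm_uniformity_eq_comap (T i)

theorem seminormUniformity_le {ι κ : Type*} (q : ι → Seminorm ℂ V) (r : κ → Seminorm ℂ V)
    (h : ∀ i, ∃ (C : ℝ) (s : Finset κ), 0 ≤ C ∧ ∀ v, q i v ≤ C * ∑ j ∈ s, r j v) :
    seminormUniformity r ≤ seminormUniformity q := by
  refine le_iInf fun i => ?_
  obtain ⟨C, s, hC0, hC⟩ := h i
  change @uniformity V (seminormUniformity r) ≤ @uniformity V
    (q i).toAddGroupSeminorm.toSeminormedAddCommGroup.toPseudoMetricSpace.toUniformSpace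
  refine (hasBasis_seminorm_uniformity (q i)).ge_iff.2 fun ε hε => ?_
  -- The added ones allow C = 0 and empty s, and keep the final inequality strict.
  set δ : ℝ := ε / ((C + 1) * (s.card + 1)) with hδ
  have hδ0 : 0 < δ := by positivity
  have hmem : (⋂ j ∈ s, {p : V × V | r j (p.1 - p.2) < δ}) ∈
      @uniformity V (seminormUniformity r) := by
    refine (Filter.biInter_finset_mem s).2 fun j _ => ?_
    rw [iInf_uniformity]
    exact Filter.mem_iInf_of_mem j ((hasBasis_seminorm_uniformity (r j)).mem_of_mem hδ0)
  refine Filter.mem_of_superset hmem fun p hp => ?_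
  have hp' : ∀ j ∈ s, r j (p.1 - p.2) ≤ δ := fun j hj => (Set.mem_iInter₂.1 hp j hj).le
  have h1 : ∑ j ∈ s, r j (p.1 - p.2) ≤ s.card * δ := by
    simpa using Finset.sum_le_card_nsmul s _ δ hp'
  calc q i (p.1 - p.2) ≤ C * (s.card * δ) := (hC _).trans (mul_le_mul_of_nonneg_left h1 hC0)
    _ < (C + 1) * (s.card + 1) * δ := by
      have h2 : 0 < δ * (C + 1) := by positivity
      have h3 : 0 ≤ (s.card : ℝ) * δ := by positivity
      nlinarith
    _ = ε := by rw [hδ]; field_simp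

end SeminormUniformity

/-! ### Equality of the two uniformities on the smooth vectors -/

section Elliptic

variable {E : Type*} [NormedAddCommGroup E] [NormedSpace ℝ E] [FiniteDimensional ℝ E]
  {G : Type*} [TopologicalSpace G] [ChartedSpace E G] [Group G] [LieGroup 𝓘(ℝ, E) ∞ G]
  {H : Type*} [NormedAddCommGroup H] [InnerProductSpace ℂ H] {n : ℕ} (R : ReductiveGroup n E G)
  (π : HilbertRep G H)

/-- The uniform structure of `H^∞` is defined by the powers of `Δ`. -/
theorem seminormUniformity_env_eq_lap [CompleteSpace H] :
    seminormUniformity (envSeminorm (E := E) π) = seminormUniformity (lapSeminorm R π) := by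
  refine le_antisymm (seminormUniformity_le _ _ fun l => ⟨1, {laplacian R ^ l}, zero_le_one, ?_⟩)
    (seminormUniformity_le _ _ fun x => ?_)
  · intro v
    simp [lapSeminorm]
  · obtain ⟨C, k, hC0, hC⟩ := envSeminorm_le R π x
    exact ⟨C, Finset.range k, hC0, hC⟩

end Elliptic

/-! ### Completeness of the space of smooth vectors -/

section Complete

open Filter Topology

variable {E : Type*} [NormedAddCommGroup E] [NormedSpace ℝ E] [FiniteDimensional ℝ E]
  {G : Type*} [TopologicalSpace G] [ChartedSpace E G] [Group G] [LieGroup 𝓘(ℝ, E) ∞ G]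
  {H : Type*} [NormedAddCommGroup H] [InnerProductSpace ℂ H]
  {F : Type*} [NormedAddCommGroup F] [NormedSpace ℝ F]

variable (E) in
/-- The coordinate functionals of a basis of a finite-dimensional space. -/
noncomputable def coordCLM (i : Fin (Module.finrank ℝ E)) : E →L[ℝ] ℝ :=
  LinearMap.toContinuousLinearMap ((Module.finBasis ℝ E).coord i)

theorem clm_eq_sum_smulRight (T : E →L[ℝ] F) :
    T = ∑ i, (coordCLM E i).smulRight (T (Module.finBasis ℝ E i)) := by
  ext X
  conv_lhs => rw [← (Module.finBasis ℝ E).sum_repr X, map_sum]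
  simp [coordCLM]

/-- With a finite-dimensional domain, pointwise convergence on a basis is already convergence in
operator norm. -/
theorem tendsto_clm_of_forall {ι : Type*} {l : Filter ι} {T : ι → E →L[ℝ] F} {S : E →L[ℝ] F}
    (h : ∀ X, Tendsto (fun i => T i X) l (𝓝 (S X))) : Tendsto T l (𝓝 S) := by
  rw [clm_eq_sum_smulRight S, funext fun i => clm_eq_sum_smulRight (T i)]
  refine tendsto_finsetSum _ fun j _ => ?_
  have hc : Continuous fun w : F => (coordCLM E j).smulRight w :=
    (ContinuousLinearMap.smulRightL ℝ E F (coordCLM E j)).continuous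
  exact (hc.tendsto _).comp (h _)

variable (π : HilbertRep G H)

theorem continuousOn_orbit_chart (v : H) :
    ContinuousOn (orbit π v ∘ (chartOne E G).symm) (chartOne E G).target :=
  (π.continuous_orbit v).comp_continuousOn (continuousOn_extChartAt_symm (1 : G))

/-- A vector is smooth if its orbit map is smooth at the identity in the chart. -/
theorem mem_smoothVectors_of_contDiffOn {v : H}
    (h : ContDiffOn ℝ ∞ (orbit π v ∘ (chartOne E G).symm) (chartOne E G).target) :
    v ∈ smoothVectors E π := by
  have h1 : ContMDiffAt 𝓘(ℝ, E) 𝓘(ℝ, H) ∞ (orbit π v) 1 := by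
    have h2 : ContMDiffAt 𝓘(ℝ, E) 𝓘(ℝ, H) ∞ (orbit π v ∘ (chartOne E G).symm)
        (chartOne E G 1) := contMDiffAt_iff_contDiffAt.2
      (h.contDiffAt (isOpen_chartOne_target.mem_nhds chartOne_one_mem))
    refine (h2.comp (1 : G) (contMDiffAt_extChartAt (I := 𝓘(ℝ, E)))).congr_of_eventuallyEq ?_
    filter_upwards [extChartAt_source_mem_nhds (I := 𝓘(ℝ, E)) (1 : G)] with g hg
    simp only [Function.comp_apply]
    rw [(chartOne E G).left_inv hg]
  intro g
  have h3 : orbit π v = ((π.toHom g).restrictScalars ℝ) ∘ orbit π v ∘ fun h => g⁻¹ * h := by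
    ext h
    simp only [Function.comp_apply, ContinuousLinearMap.coe_restrictScalars']
    rw [← orbit_mul, mul_inv_cancel_left]
  rw [h3]
  refine ((π.toHom g).restrictScalars ℝ).contMDiff.contMDiffAt.comp g ?_
  refine ContMDiffAt.comp g (I' := 𝓘(ℝ, E)) ?_
    (contMDiff_mul_left (I := 𝓘(ℝ, E)) (n := ∞) (a := g⁻¹)).contMDiffAt
  simpa using h1

/-- The action of `U(Lie(G))` on `H^∞` is closed: a limit, in all its seminorms, of smooth vectors
is a smooth vector. -/
theorem exists_smooth_of_tendsto [CompleteSpace H] {l : Filter (smoothVectors E π)} [l.NeBot]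
    {Φ : UniversalEnvelopingAlgebra ℝ (GroupLieAlgebra 𝓘(ℝ, E) G) → H}
    (hΦ : ∀ x, Tendsto (fun v => (envAction π x v : H)) l (𝓝 (Φ x))) :
    ∃ v : smoothVectors E π, ∀ x, (envAction π x v : H) = Φ x := by
  have hadd : ∀ x y, Φ (x + y) = Φ x + Φ y := fun x y =>
    tendsto_nhds_unique (hΦ (x + y)) (((hΦ x).add (hΦ y)).congr fun v => by simp)
  have hsmul : ∀ (c : ℝ) x, Φ (c • x) = c • Φ x := fun c x =>
    tendsto_nhds_unique (hΦ (c • x)) (((hΦ x).const_smul c).congr fun v => by simp)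
  -- The candidate for the differential at 1 of the orbit map of Φ(x), namely X ↦ Φ(Xx). It is
  -- linear because Φ is a pointwise limit of linear maps.
  let Ψ : UniversalEnvelopingAlgebra ℝ (GroupLieAlgebra 𝓘(ℝ, E) G) → E →L[ℝ] H := fun x =>
    LinearMap.toContinuousLinearMap
      { toFun := fun X => Φ (UniversalEnvelopingAlgebra.ι ℝ
          (show GroupLieAlgebra 𝓘(ℝ, E) G from X) * x)
        map_add' := fun X Y => by
          rw [← hadd, ← add_mul]
          congr 2
          exact map_add (UniversalEnvelopingAlgebra.ι ℝ)
            (show GroupLieAlgebra 𝓘(ℝ, E) G from X) (show GroupLieAlgebra 𝓘(ℝ, E) G from Y)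
        map_smul' := fun c X => by
          rw [RingHom.id_apply, ← hsmul, ← smul_mul_assoc]
          congr 2
          exact map_smul (UniversalEnvelopingAlgebra.ι ℝ) c
            (show GroupLieAlgebra 𝓘(ℝ, E) G from X) }
  have hΨ : ∀ x, Tendsto (fun v => dpiCLM E π (envAction π x v : H)) l (𝓝 (Ψ x)) := by
    intro x
    refine tendsto_clm_of_forall fun X => ?_
    refine (hΦ (UniversalEnvelopingAlgebra.ι ℝ
      (show GroupLieAlgebra 𝓘(ℝ, E) G from X) * x)).congr fun v => ?_
    rw [map_mul, envAction_ι]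
    rfl
  -- the derivative of the limit orbit maps
  have hder : ∀ x, ∀ y ∈ (chartOne E G).target,
      HasFDerivAt (orbit π (Φ x) ∘ (chartOne E G).symm)
        (((π.toHom ((chartOne E G).symm y)).restrictScalars ℝ).comp
          ((Ψ x).comp (chartFrame G y))) y := by
    intro x y hy
    refine hasFDerivAt_of_tendstoLocallyUniformlyOn (l := l)
      (f := fun v => orbit π (envAction π x v : H) ∘ (chartOne E G).symm)
      (f' := fun (v : smoothVectors E π) y =>
        ((π.toHom ((chartOne E G).symm y)).restrictScalars ℝ).comp
          ((dpiCLM E π (envAction π x v : H)).comp (chartFrame G y)))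
      (g' := fun y => ((π.toHom ((chartOne E G).symm y)).restrictScalars ℝ).comp
          ((Ψ x).comp (chartFrame G y)))
      isOpen_chartOne_target ?_ (fun v z hz => hasFDerivAt_orbit_chart π (envAction π x v).2 hz)
      (fun z hz => ?_) hy
    -- In the derivative formula only the middle factor varies with v, and it converges in norm. The
    -- outer factors are bounded on compact sets, the operators π(g) by uniform boundedness and the
    -- frame by continuity.
    · rw [Metric.tendstoLocallyUniformlyOn_iff]
      intro ε hε z hz
      obtain ⟨N, hN, hNt, hNc⟩ := local_compact_nhds
        (isOpen_chartOne_target.mem_nhds hz)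
      obtain ⟨M, hM0, hM⟩ := exists_bound_of_strongly_continuous
        (T := fun g => π.toHom g) π.continuous_orbit
        (hNc.image_of_continuousOn ((continuousOn_extChartAt_symm (1 : G)).mono hNt))
      obtain ⟨M', hM'⟩ := hNc.exists_bound_of_continuousOn
        ((contDiffOn_chartFrame (E := E) (G := G)).continuousOn.mono hNt)
      set δ := ε / (M * (|M'| + 1)) with hδ
      have hδ0 : 0 < δ := by positivity
      refine ⟨N, mem_nhdsWithin_of_mem_nhds hN, ?_⟩
      filter_upwards [Metric.tendsto_nhds.1 (hΨ x) δ hδ0] with v hv w hw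
      rw [dist_comm, dist_eq_norm, ← ContinuousLinearMap.comp_sub,
        ← ContinuousLinearMap.sub_comp]
      rw [dist_eq_norm] at hv
      have b1 : ‖(π.toHom ((chartOne E G).symm w)).restrictScalars ℝ‖ ≤ M := by
        rw [ContinuousLinearMap.norm_restrictScalars]
        exact hM _ ⟨w, hw, rfl⟩
      calc _ ≤ M * (‖dpiCLM E π (envAction π x v : H) - Ψ x‖ * ‖chartFrame G w‖) :=
            (ContinuousLinearMap.opNorm_comp_le _ _).trans (mul_le_mul b1
              (ContinuousLinearMap.opNorm_comp_le _ _) (norm_nonneg _) hM0.le)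
        _ ≤ M * (‖dpiCLM E π (envAction π x v : H) - Ψ x‖ * (|M'| + 1)) := by
            gcongr
            exact (hM' w hw).trans ((le_abs_self _).trans (by linarith))
        _ < M * (δ * (|M'| + 1)) := by gcongr
        _ = ε := by rw [hδ]; field_simp
    · exact ((π.toHom ((chartOne E G).symm z)).continuous.tendsto _).comp (hΦ x)
  have hsm : ∀ k : ℕ, ∀ x, ContDiffOn ℝ k (orbit π (Φ x) ∘ (chartOne E G).symm)
      (chartOne E G).target := by
    intro k
    induction k with
    | zero => exact fun x => contDiffOn_zero.2 (continuousOn_orbit_chart π (Φ x))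
    | succ k ih =>
      intro x
      push_cast
      rw [contDiffOn_succ_iff_fderiv_of_isOpen isOpen_chartOne_target]
      refine ⟨fun y hy => (hder x y hy).differentiableAt.differentiableWithinAt, by simp, ?_⟩
      -- The derivative is a combination, with smooth coefficients, of orbit maps of other vectors
      -- of the form Φ(x'). Hence the induction on k must treat all x at once.
      have hform : ∀ y ∈ (chartOne E G).target,
          fderiv ℝ (orbit π (Φ x) ∘ (chartOne E G).symm) y =
          ∑ i, ((coordCLM E i).comp (chartFrame G y)).smulRight
            ((orbit π (Ψ x (Module.finBasis ℝ E i)) ∘ (chartOne E G).symm) y) := by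
        intro y hy
        rw [(hder x y hy).fderiv]
        conv_lhs => rw [clm_eq_sum_smulRight (Ψ x)]
        ext X
        simp [orbit]
      refine ContDiffOn.congr ?_ hform
      refine ContDiffOn.sum fun i _ => ?_
      refine ContDiffOn.smulRight ?_ (ih _)
      exact contDiffOn_const.clm_comp (contDiffOn_chartFrame.of_le (by exact_mod_cast le_top))
  have hmem : ∀ x, Φ x ∈ smoothVectors E π := fun x =>
    mem_smoothVectors_of_contDiffOn π (contDiffOn_infty.2 fun k => hsm k x)
  have hstep : ∀ (X : GroupLieAlgebra 𝓘(ℝ, E) G) x,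
      dpi π X (Φ x) = Φ (UniversalEnvelopingAlgebra.ι ℝ X * x) := by
    intro X x
    have h1 : HasFDerivAt (orbit π (Φ x) ∘ (chartOne E G).symm) (dpiCLM E π (Φ x))
        (chartOne E G 1) := hasFDerivAt_comp_chartOne_symm (f := orbit π (Φ x)) (hmem x)
    have h4 : dpiCLM E π (Φ x) = Ψ x := by
      rw [h1.unique (hder x _ chartOne_one_mem), chartFrame_one, chartOne_symm_one, map_one]
      rfl
    exact congrArg (fun T : E →L[ℝ] H => T X) h4
  have hall : ∀ x y, (envAction π x ⟨Φ y, hmem y⟩ : H) = Φ (x * y) := by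
    intro x
    induction x using envelopingAlgebra_induction with
    | algebraMap r =>
      intro y
      rw [AlgHom.commutes, Algebra.algebraMap_eq_smul_one, Algebra.algebraMap_eq_smul_one,
        smul_mul_assoc, one_mul, hsmul]
      rfl
    | ι X => intro y; rw [envAction_ι]; exact hstep X y
    | mul a b ha hb =>
      intro y
      have : envAction π b ⟨Φ y, hmem y⟩ = ⟨Φ (b * y), hmem _⟩ := Subtype.ext (hb y)
      rw [map_mul, Module.End.mul_apply, this, ha, mul_assoc]
    | add a b ha hb =>
      intro y
      rw [map_add, LinearMap.add_apply, Submodule.coe_add, ha, hb, add_mul, hadd]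
  exact ⟨⟨Φ 1, hmem 1⟩, fun x => by rw [hall, mul_one]⟩

variable (E) in
-- The map v ↦ (xv)_x induces the uniformity from a complete product. A point of the closure of its
-- image is a limit along a filter on H^∞, and closedness of the U(g)-action returns a smooth
-- vector.
theorem completeSpace_smoothVectors [CompleteSpace H] :
    @CompleteSpace (smoothVectors E π) (seminormUniformity (envSeminorm π)) := by
  let f : smoothVectors E π →
      UniversalEnvelopingAlgebra ℝ (GroupLieAlgebra 𝓘(ℝ, E) G) → H :=
    fun v x => (envAction π x v : H)
  let u : UniformSpace (smoothVectors E π) := seminormUniformity (envSeminorm π)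
  have hu : u = UniformSpace.comap f (Pi.uniformSpace fun _ => H) :=
    seminormUniformity_eq_comap fun x => (smoothVectors E π).subtype ∘ₗ envAction π x
  have hind : @IsUniformInducing _ _ u _ f :=
    @IsUniformInducing.mk _ _ u _ f (by rw [hu]; rfl)
  rw [completeSpace_iff_isComplete_range hind]
  refine IsClosed.isComplete (isClosed_of_closure_subset fun Φ hΦ => ?_)
  have hne : (comap f (𝓝 Φ)).NeBot := by
    rw [comap_neBot_iff]
    intro t ht
    obtain ⟨_, h1, v, rfl⟩ := mem_closure_iff_nhds.1 hΦ t ht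
    exact ⟨v, h1⟩
  obtain ⟨v, hv⟩ := exists_smooth_of_tendsto π (l := comap f (𝓝 Φ)) (Φ := Φ) fun x =>
    ((continuous_apply x).tendsto Φ).comp tendsto_comap
  exact ⟨v, funext hv⟩

/-- Completeness transfers to the powers of Δ because they define the same uniformity. The countable
product lets limits be taken along sequences. -/
theorem isClosed_range_laplacian_powers [CompleteSpace H] {n : ℕ} (R : ReductiveGroup n E G) :
    IsClosed (Set.range fun (v : smoothVectors E π) (l : ℕ) =>
      (envAction π (laplacian R ^ l) v : H)) := by
  let u : UniformSpace (smoothVectors E π) := seminormUniformity (envSeminorm π)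
  have hu : u = UniformSpace.comap (fun (v : smoothVectors E π) (l : ℕ) =>
      (envAction π (laplacian R ^ l) v : H)) (Pi.uniformSpace fun _ => H) :=
    (seminormUniformity_env_eq_lap R π).trans (seminormUniformity_eq_comap fun l =>
      (smoothVectors E π).subtype ∘ₗ envAction π (laplacian R ^ l))
  have hind : @IsUniformInducing _ _ u _ fun (v : smoothVectors E π) (l : ℕ) =>
      (envAction π (laplacian R ^ l) v : H) :=
    @IsUniformInducing.mk _ _ u _ _ (by rw [hu]; rfl)
  exact ((completeSpace_iff_isComplete_range hind).1 (completeSpace_smoothVectors E π)).isClosed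

end Complete

/-! ### Density of finite vectors for compact groups -/

section CompactGroup

open MeasureTheory

variable {K : Type*} [Group K] [TopologicalSpace K] [IsTopologicalGroup K] [CompactSpace K]
  [MeasurableSpace K] [BorelSpace K]
  {W : Type*} [NormedAddCommGroup W] [InnerProductSpace ℂ W] [CompleteSpace W]

/-- A strongly continuous representation of a compact group on a Hilbert space is similar to one
that preserves the inner product. -/
theorem exists_unitarizing_operator (μ : Measure K) [IsProbabilityMeasure μ]
    [μ.IsMulLeftInvariant] [μ.IsOpenPosMeasure]
    (ρ : K →* (W →L[ℂ] W)) (hρ : ∀ v, Continuous fun k => ρ k v) :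
    ∃ (T : W →L[ℂ] W) (c : NNReal), AntilipschitzWith c T ∧
      ∀ k v w, (inner ℂ (T (ρ k v)) (T (ρ k w)) : ℂ) = inner ℂ (T v) (T w) := by
  have hT : ∀ v, Continuous fun k => ρ k⁻¹ v := fun v => (hρ v).comp continuous_inv
  have hc : HasCompactSupport fun _ : K => (1 : ℝ) := HasCompactSupport.of_compactSpace _
  obtain ⟨B, hB⟩ := exists_averaged_form μ hT continuous_const hc
  simp only [Complex.ofReal_one, one_mul] at hB
  obtain ⟨M, hM0, hM⟩ := exists_bound_of_strongly_continuous hρ (isCompact_univ (X := K))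
  obtain ⟨c, hc0, hcoer⟩ := averaged_form_coercive μ hT continuous_const hc
    (fun _ => zero_le_one) 1 one_ne_zero (B := B) (by simpa using hB) hM0 (by
      intro k _ v
      have h := (ρ k).le_of_opNorm_le (hM k trivial) (ρ k⁻¹ v)
      rwa [← mul_apply_eq_comp, ← map_mul, mul_inv_cancel, map_one] at h)
  have hinv : ∀ k v w, B (ρ k v) (ρ k w) = B v w := by
    intro k v w
    rw [hB, hB, ← integral_mul_left_eq_self _ k]
    refine integral_congr_ae (Filter.Eventually.of_forall fun x => ?_)
    have : ∀ u, ρ (k * x)⁻¹ (ρ k u) = ρ x⁻¹ u := fun u => by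
      rw [← mul_apply_eq_comp, ← map_mul, mul_inv_rev, inv_mul_cancel_right]
    simp only [this]
  -- Instead of giving W a new inner product, the invariant form B is written ⟨Sv, w⟩ = ⟨Tv, Tw⟩
  -- with T the positive square root of S. Coercivity bounds T below by √c.
  set S := InnerProductSpace.continuousLinearMapOfBilin B with hS
  have hSB : ∀ v w, (inner ℂ (S v) w : ℂ) = B v w :=
    InnerProductSpace.continuousLinearMapOfBilin_apply B
  have hsymm : ∀ v w, B v w = (starRingEnd ℂ) (B w v) := fun v w => by
    rw [hB, hB, ← integral_conj]
    simp only [inner_conj_symm]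
  have hpos : S.IsPositive := by
    refine ⟨fun v w => ?_, fun v => ?_⟩
    · change (inner ℂ (S v) w : ℂ) = inner ℂ v (S w)
      rw [hSB, hsymm, ← hSB, inner_conj_symm]
    · change 0 ≤ (inner ℂ (S v) v : ℂ).re
      rw [hSB]
      exact (by positivity : 0 ≤ c * ‖v‖ ^ 2).trans (hcoer v)
  set T := CFC.sqrt S with hTdef
  have hTT : T * T = S :=
    CFC.sqrt_mul_sqrt_self S ((ContinuousLinearMap.nonneg_iff_isPositive S).2 hpos)
  have hTs : IsSelfAdjoint T := (CFC.sqrt_nonneg S).isSelfAdjoint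
  have hTB : ∀ v w, (inner ℂ (T v) (T w) : ℂ) = B v w := fun v w => by
    rw [← hSB, ← hTT]
    exact (hTs.isSymmetric (T v) w).symm
  refine ⟨T, ⟨(Real.sqrt c)⁻¹, by positivity⟩, ?_, fun k v w => by rw [hTB, hTB, hinv]⟩
  refine AddMonoidHomClass.antilipschitz_of_bound T fun v => ?_
  have h1 : c * ‖v‖ ^ 2 ≤ ‖T v‖ ^ 2 := by
    have h2 := hcoer v
    rw [← hTB, inner_self_eq_norm_sq_to_K] at h2
    norm_cast at h2
  change ‖v‖ ≤ (Real.sqrt c)⁻¹ * ‖T v‖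
  rw [← div_eq_inv_mul, le_div_iff₀ (by positivity), mul_comm]
  refine abs_le_of_sq_le_sq' ?_ (norm_nonneg _) |>.2
  rwa [mul_pow, Real.sq_sqrt hc0.le]

/-- The vectors of `D` whose orbits lie in finite-dimensional subspaces. -/
def finiteVectors {K W : Type*} [Group K] [NormedAddCommGroup W] [InnerProductSpace ℂ W]
    (ρ : K →* (W →L[ℂ] W)) (D : Submodule ℂ W) : Submodule ℂ W where
  carrier := {u | u ∈ D ∧ ∃ U : Submodule ℂ W, FiniteDimensional ℂ U ∧ ∀ k, ρ k u ∈ U}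
  zero_mem' := ⟨zero_mem _, ⊥, inferInstance, fun k => by simp⟩
  add_mem' := by
    rintro a b ⟨ha, U, hU, hUa⟩ ⟨hb, V, hV, hVb⟩
    refine ⟨add_mem ha hb, U ⊔ V, inferInstance, fun k => ?_⟩
    rw [map_add]
    exact Submodule.add_mem_sup (hUa k) (hVb k)
  smul_mem' := by
    rintro c a ⟨ha, U, hU, hUa⟩
    refine ⟨Submodule.smul_mem _ _ ha, U, hU, fun k => ?_⟩
    rw [map_smul]
    exact Submodule.smul_mem _ _ (hUa k)

open Module.End in
/-- For a representation of a compact group on a Hilbert space, the vectors of finite type are dense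
in every subspace that is stable under averaging. -/
theorem mem_closure_finiteVectors (μ : Measure K) [IsProbabilityMeasure μ]
    [μ.IsMulLeftInvariant] [μ.IsOpenPosMeasure]
    (ρ : K →* (W →L[ℂ] W)) (hρ : ∀ v, Continuous fun k => ρ k v) (D : Submodule ℂ W)
    (hD : ∀ v ∈ D, ∀ c : K → ℂ, Continuous c → ∫ k, c k • ρ k v ∂μ ∈ D) {v : W} (hv : v ∈ D) :
    v ∈ closure (finiteVectors ρ D : Set W) := by
  obtain ⟨T, c, hTc, hTinv⟩ := exists_unitarizing_operator μ ρ hρ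
  set a : K → W := fun k => T (ρ k v) with ha
  have hac : Continuous a := T.continuous.comp (hρ v)
  have hintc : ∀ {F : Type _} [NormedAddCommGroup F] {f : K → F}, Continuous f →
      Integrable f μ := fun hf =>
    hf.integrable_of_hasCompactSupport (HasCompactSupport.of_compactSpace _)
  -- The average of these rank-one operators along the transported orbit is compact and
  -- self-adjoint, since both properties define closed convex sets. It is built from v itself so
  -- that its nonzero eigenvectors come from D.
  set P : K → W →L[ℂ] W := fun k => InnerProductSpace.rankOne ℂ (a k) (a k) with hP
  have hPc : Continuous P :=
    ((ContinuousLinearMap.toSpanSingletonLIE ℂ W).continuous.comp hac).clm_comp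
      ((innerSL ℂ).continuous.comp hac)
  set A : W →L[ℂ] W := ∫ k, P k ∂μ with hA
  have hAu : ∀ u, A u = ∫ k, (inner ℂ (a k) u : ℂ) • a k ∂μ := fun u => by
    rw [hA, ContinuousLinearMap.integral_apply (hintc hPc)]
    rfl
  have hAcompact : IsCompactOperator A := by
    refine Convex.integral_mem (s := {f : W →L[ℂ] W | IsCompactOperator f}) ?_
      isClosed_setOfPred_isCompactOperator (Filter.Eventually.of_forall fun k => ?_) (hintc hPc)
    · intro f hf g hg s t _ _ _
      exact (IsCompactOperator.smul (hf : IsCompactOperator f) s).add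
        (IsCompactOperator.smul (hg : IsCompactOperator g) t)
    · have h : IsCompactOperator (ContinuousLinearMap.toSpanSingleton ℂ (a k)) :=
        isCompactOperator_of_locallyCompactSpace_rng _
      exact h.comp_clm (innerSL ℂ (a k))
  have hAsa : IsSelfAdjoint A := by
    refine Convex.integral_mem (s := {f : W →L[ℂ] W | star f = f}) ?_
      (isClosed_eq continuous_star continuous_id) (Filter.Eventually.of_forall fun k => ?_)
      (hintc hPc)
    · intro f hf g hg s t _ _ _
      have hf : star f = f := hf
      have hg : star g = g := hg
      change star (s • f + t • g) = s • f + t • g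
      rw [star_add, star_smul, star_smul, hf, hg, star_trivial, star_trivial]
    · exact InnerProductSpace.adjoint_rankOne _ _
  have hAsymm : (A : W →ₗ[ℂ] W).IsSymmetric := hAsa.isSymmetric
  set C : W → W := fun u => ∫ k, (inner ℂ (a k) u : ℂ) • ρ k v ∂μ with hC
  have hcoef : ∀ u, Continuous fun k => (inner ℂ (a k) u : ℂ) := fun u =>
    hac.inner continuous_const
  have hcsmul : ∀ u, Continuous fun k => (inner ℂ (a k) u : ℂ) • ρ k v := fun u =>
    (hcoef u).smul (hρ v)
  have hTC : ∀ u, A u = T (C u) := fun u => by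
    change _ = T (∫ k, (inner ℂ (a k) u : ℂ) • ρ k v ∂μ)
    rw [hAu, ← T.integral_comp_comm (hintc (hcsmul u))]
    simp only [map_smul, ha]
  have hCD : ∀ u, C u ∈ D := fun u => hD v hv _ (hcoef u)
  -- This expresses that A commutes with the transported action TρT⁻¹. The factorization A = TC lets
  -- it be stated without an inverse of T.
  have hAρ : ∀ k u, A (T (ρ k u)) = T (ρ k (C (T u))) := by
    intro k u
    change _ = T (ρ k (∫ x, (inner ℂ (a x) (T u) : ℂ) • ρ x v ∂μ))
    rw [hAu, ← (ρ k).integral_comp_comm (hintc (hcsmul _)),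
      ← T.integral_comp_comm ((ρ k).integrable_comp (hintc (hcsmul _))),
      ← integral_mul_left_eq_self _ k]
    refine integral_congr_ae (Filter.Eventually.of_forall fun x => ?_)
    simp only [ha, map_mul, mul_apply_eq_comp, map_smul, hTinv]
  -- eigenvectors for non-zero eigenvalues
  have heig : ∀ z : ℂ, z ≠ 0 → ∀ u' ∈ eigenspace (A : Module.End ℂ W) z,
      ∃ u ∈ finiteVectors ρ D, T u = u' := by
    intro z hz u' hu'
    have hAu' : A u' = z • u' := mem_eigenspace_iff.1 hu'
    have hTu : T (z⁻¹ • C u') = u' := by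
      rw [map_smul, ← hTC, hAu', smul_smul, inv_mul_cancel₀ hz, one_smul]
    refine ⟨z⁻¹ • C u', ⟨Submodule.smul_mem _ _ (hCD u'),
      (eigenspace (A : Module.End ℂ W) z).comap (T : W →ₗ[ℂ] W), ?_, fun k => ?_⟩, hTu⟩
    · have hfd : FiniteDimensional ℂ (eigenspace (A : Module.End ℂ W) z) :=
        ContinuousLinearMap.finite_dimensional_eigenspace hAcompact z hz
      refine FiniteDimensional.of_injective
        ((T : W →ₗ[ℂ] W).restrict (p := (eigenspace (A : Module.End ℂ W) z).comap (T : W →ₗ[ℂ] W))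
          (q := eigenspace (A : Module.End ℂ W) z) fun x hx => hx) ?_
      intro x y hxy
      exact Subtype.ext (hTc.injective (congrArg Subtype.val hxy))
    · rw [Submodule.mem_comap, mem_eigenspace_iff]
      change A (T (ρ k (z⁻¹ • C u'))) = z • T (ρ k (z⁻¹ • C u'))
      rw [hAρ, hTu, map_smul, map_smul, smul_smul, mul_inv_cancel₀ hz, one_smul]
  set M : Submodule ℂ W := ⨆ z : {z : ℂ // z ≠ 0}, eigenspace (A : Module.End ℂ W) z with hM
  have hMle : M ≤ (finiteVectors ρ D).map (T : W →ₗ[ℂ] W) :=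
    iSup_le fun z u' hu' => heig z z.2 u' hu'
  -- If w is orthogonal to the nonzero eigenspaces, then Aw is orthogonal to all of them, so Aw = 0
  -- by the spectral theorem. Then ⟨w, Aw⟩, the integral of |⟨a(k), w⟩|², vanishes; by continuity so
  -- does its integrand at k = 1, where a(1) = Tv.
  have hTv : T v ∈ Mᗮᗮ := by
    refine (Submodule.mem_orthogonal _ _).2 fun w hw => ?_
    have hAw : A w = 0 := by
      have hbot := ContinuousLinearMap.orthogonalComplement_iSup_eigenspaces_eq_bot hAcompact hAsymm
      rw [← Submodule.mem_bot ℂ, ← hbot, ← Submodule.iInf_orthogonal, Submodule.mem_iInf]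
      intro z
      refine (Submodule.mem_orthogonal _ _).2 fun x hx => ?_
      have hx' : A x = z • x := mem_eigenspace_iff.1 hx
      have h1 : (inner ℂ x (A w) : ℂ) = inner ℂ (A x) w := (hAsymm x w).symm
      rw [h1, hx', inner_smul_left]
      by_cases hz : z = 0
      · simp [hz]
      · rw [(Submodule.mem_orthogonal _ _).1 hw x
          ((le_iSup (fun z : {z : ℂ // z ≠ 0} => eigenspace (A : Module.End ℂ W) z) ⟨z, hz⟩) hx),
          mul_zero]
    have h0 : ∫ k, ‖(inner ℂ (a k) w : ℂ)‖ ^ 2 ∂μ = 0 := by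
      have h1 : (inner ℂ w (A w) : ℂ) = 0 := by rw [hAw, inner_zero_right]
      have hcw : Continuous fun k => (inner ℂ (a k) w : ℂ) • a k := (hcoef w).smul hac
      rw [hAu, ← integral_inner (hintc hcw)] at h1
      have h2 : ∀ k, (inner ℂ w ((inner ℂ (a k) w : ℂ) • a k) : ℂ) =
          ((‖(inner ℂ (a k) w : ℂ)‖ ^ 2 : ℝ) : ℂ) := by
        intro k
        rw [inner_smul_right, ← inner_conj_symm w (a k), Complex.mul_conj,
          Complex.normSq_eq_norm_sq]
      simp only [h2] at h1
      rw [integral_complex_ofReal] at h1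
      exact_mod_cast h1
    by_contra hne
    have hpos := Continuous.integral_pos_of_hasCompactSupport_nonneg_nonzero (μ := μ)
      (f := fun k => ‖(inner ℂ (a k) w : ℂ)‖ ^ 2) (x := 1) ((hcoef w).norm.pow 2)
      (HasCompactSupport.of_compactSpace _) (fun k => by positivity) (by
        have : (inner ℂ (T v) w : ℂ) ≠ 0 := fun h => hne (by
          rw [← inner_conj_symm, h, map_zero])
        simpa [ha] using this)
    exact hpos.ne' h0
  rw [Submodule.orthogonal_orthogonal_eq_closure] at hTv
  have hcl : T v ∈ closure (T '' (finiteVectors ρ D : Set W)) :=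
    closure_mono (fun x hx => hMle hx) hTv
  -- T is bounded below, so approximation of Tv by T of finite vectors pulls back to approximation
  -- of v.
  rwa [(hTc.isInducing T.continuous).closure_eq_preimage_closure_image]

end CompactGroup

/-! ### The adjoint action and `K`-invariance of `Δ` -/

section Adjoint

variable {E : Type*} [NormedAddCommGroup E] [NormedSpace ℝ E] [FiniteDimensional ℝ E]
  {G : Type*} [TopologicalSpace G] [ChartedSpace E G] [Group G] [LieGroup 𝓘(ℝ, E) ∞ G]
  {H : Type*} [NormedAddCommGroup H] [InnerProductSpace ℂ H]
  {F : Type*} [NormedAddCommGroup F] [NormedSpace ℝ F] {n : ℕ}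

/-- The adjoint action of `k⁻¹` on the Lie algebra: the differential at `1` of `h ↦ k⁻¹ h k`. -/
noncomputable def adInv (k : G) : GroupLieAlgebra 𝓘(ℝ, E) G →ₗ[ℝ] GroupLieAlgebra 𝓘(ℝ, E) G :=
  ContinuousLinearMap.toLinearMap
    (show E →L[ℝ] E from mfderiv 𝓘(ℝ, E) 𝓘(ℝ, E) (fun h : G => k⁻¹ * h * k) 1)

theorem contMDiff_conj (k : G) : ContMDiff 𝓘(ℝ, E) 𝓘(ℝ, E) ∞ fun h : G => k⁻¹ * h * k :=
  (contMDiff_const.mul contMDiff_id).mul contMDiff_const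

theorem mfderiv_comp_conj {f : G → F} (hf : ContMDiff 𝓘(ℝ, E) 𝓘(ℝ, F) ∞ f) (k : G)
    (X : GroupLieAlgebra 𝓘(ℝ, E) G) :
    (mfderiv 𝓘(ℝ, E) 𝓘(ℝ, F) (fun h => f (k⁻¹ * h * k)) 1 : E →L[ℝ] F) X =
      (mfderiv 𝓘(ℝ, E) 𝓘(ℝ, F) f 1 : E →L[ℝ] F) (adInv k X) := by
  have h1 : MDifferentiableAt 𝓘(ℝ, E) 𝓘(ℝ, F) f (k⁻¹ * 1 * k) := hf.mdifferentiableAt (by simp)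
  have h2 : MDifferentiableAt 𝓘(ℝ, E) 𝓘(ℝ, E) (fun h : G => k⁻¹ * h * k) 1 :=
    (contMDiff_conj k).mdifferentiableAt (by simp)
  have h3 := mfderiv_comp_apply (1 : G) h1 h2 X
  simp only [Function.comp_def] at h3
  refine h3.trans ?_
  have hg : ∀ (g g' : G) (w : E), g' = g →
      (mfderiv 𝓘(ℝ, E) 𝓘(ℝ, F) f g : E →L[ℝ] F) w =
        (mfderiv 𝓘(ℝ, E) 𝓘(ℝ, F) f g' : E →L[ℝ] F) w := by
    rintro _ _ _ rfl; rfl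
  exact hg (k⁻¹ * 1 * k) 1 _ (by simp)

theorem dp_adInv (R : ReductiveGroup n E G) (k : G) (X : GroupLieAlgebra 𝓘(ℝ, E) G) :
    dp R (adInv k X) = (R.p k⁻¹ : Matrix (Fin n) (Fin n) ℝ) * dp R X * (R.p k) := by
  ext i j
  refine (mfderiv_comp_conj (R.contMDiff_p i j) k X).symm.trans ?_
  have h1 := hasDerivAt_comp_chartLine ((R.contMDiff_p i j).comp (contMDiff_conj k)) (show E from X)
  have h2 : HasDerivAt (fun t => ∑ b, (∑ a, (R.p k⁻¹ : Matrix (Fin n) (Fin n) ℝ) i a *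
      (R.p (chartLine (show E from X) t) : Matrix (Fin n) (Fin n) ℝ) a b) *
        (R.p k : Matrix (Fin n) (Fin n) ℝ) b j)
      (∑ b, (∑ a, (R.p k⁻¹ : Matrix (Fin n) (Fin n) ℝ) i a * dp R X a b) *
        (R.p k : Matrix (Fin n) (Fin n) ℝ) b j) 0 :=
    HasDerivAt.fun_sum fun b _ => HasDerivAt.mul_const (HasDerivAt.fun_sum fun a _ =>
      (hasDerivAt_comp_chartLine (R.contMDiff_p a b) (show E from X)).const_mul _) _
  refine (h1.unique (h2.congr_of_eventuallyEq (Filter.Eventually.of_forall fun t => ?_))).trans ?_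
  · simp [Matrix.mul_apply]
  · simp [Matrix.mul_apply]

theorem p_inv_of_mem (R : ReductiveGroup n E G) {k : G} (hk : k ∈ maxCompact R) :
    (R.p k⁻¹ : Matrix (Fin n) (Fin n) ℝ) = (R.p k : Matrix (Fin n) (Fin n) ℝ).transpose := by
  rw [map_inv, Matrix.coe_units_inv]
  exact Matrix.inv_eq_right_inv ((Matrix.mem_orthogonalGroup_iff _ _).1 hk)

/-- For k in K the matrix p(k) is orthogonal, so conjugation by it commutes with transposition and
preserves the trace. -/
theorem trace_dp_adInv (R : ReductiveGroup n E G) {k : G} (hk : k ∈ maxCompact R)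
    (X Y : GroupLieAlgebra 𝓘(ℝ, E) G) :
    (dp R (adInv k X) * (dp R (adInv k Y)).transpose).trace =
      (dp R X * (dp R Y).transpose).trace := by
  have hQ : (R.p k : Matrix (Fin n) (Fin n) ℝ) *
      (R.p k : Matrix (Fin n) (Fin n) ℝ).transpose = 1 := (Matrix.mem_orthogonalGroup_iff _ _).1 hk
  rw [dp_adInv, dp_adInv, p_inv_of_mem R hk]
  set Q := (R.p k : Matrix (Fin n) (Fin n) ℝ)
  simp only [Matrix.transpose_mul, Matrix.transpose_transpose]
  have h : Q.transpose * dp R X * Q * (Q.transpose * ((dp R Y).transpose * Q)) =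
      Q.transpose * (dp R X * (Q * Q.transpose) * (dp R Y).transpose * Q) := by
    simp only [Matrix.mul_assoc]
  rw [h, Matrix.trace_mul_comm, hQ, Matrix.mul_one, Matrix.mul_assoc, hQ, Matrix.mul_one]

theorem adInv_injective (R : ReductiveGroup n E G) (k : G) :
    Function.Injective (adInv (E := E) k) := by
  refine (injective_iff_map_eq_zero _).2 fun X hX => dp_injective R ?_
  have h := dp_adInv R k X
  rw [hX, map_zero] at h
  have h2 : (R.p k : Matrix (Fin n) (Fin n) ℝ) * ((R.p k⁻¹ : Matrix (Fin n) (Fin n) ℝ) * dp R X *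
      (R.p k)) * (R.p k⁻¹ : Matrix (Fin n) (Fin n) ℝ) = dp R X := by
    have e1 : (R.p k : Matrix (Fin n) (Fin n) ℝ) * (R.p k⁻¹ : Matrix (Fin n) (Fin n) ℝ) = 1 := by
      rw [← Units.val_mul, ← map_mul, mul_inv_cancel, map_one, Units.val_one]
    rw [Matrix.mul_assoc, Matrix.mul_assoc, e1, Matrix.mul_one, ← Matrix.mul_assoc, e1,
      Matrix.one_mul]
  rw [← h2, ← h, map_zero, Matrix.mul_zero, Matrix.zero_mul]

variable (π : HilbertRep G H)

variable (E) in
/-- The action of a group element on the smooth vectors. -/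
def translate (k : G) : Module.End ℂ (smoothVectors E π) where
  toFun v := ⟨π.toHom k v, by
    change ContMDiff _ _ _ _
    have h : orbit π (π.toHom k v) = orbit π (v : H) ∘ fun g => g * k := by
      ext g; simp [orbit]
    rw [h]
    exact ContMDiff.comp (I' := 𝓘(ℝ, E)) v.2 (contMDiff_mul_right (I := 𝓘(ℝ, E)) (n := ∞))⟩
  map_add' v w := Subtype.ext (map_add _ _ _)
  map_smul' c v := Subtype.ext (map_smul _ _ _)

/-- Differentiate π(h)π(k) = π(k)π(k⁻¹hk) at h = 1. -/
theorem lieAction_translate (k : G) (X : GroupLieAlgebra 𝓘(ℝ, E) G) :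
    lieAction π X * translate E π k = translate E π k * lieAction π (adInv k X) := by
  ext v
  have h1 : orbit π (π.toHom k v) =
      ((π.toHom k).restrictScalars ℝ : H →L[ℝ] H) ∘ fun h => orbit π (v : H) (k⁻¹ * h * k) := by
    ext h
    simp only [Function.comp_apply, ContinuousLinearMap.coe_restrictScalars']
    rw [← orbit_mul]
    simp [orbit, mul_assoc]
  have h2 : MDifferentiableAt 𝓘(ℝ, E) 𝓘(ℝ, H) (fun h => orbit π (v : H) (k⁻¹ * h * k)) 1 :=
    (ContMDiff.comp (I' := 𝓘(ℝ, E)) v.2 (contMDiff_conj k)).mdifferentiableAt (by simp)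
  have h3 := mfderiv_comp_apply (1 : G)
    ((π.toHom k).restrictScalars ℝ : H →L[ℝ] H).mdifferentiableAt h2 X
  change dpi π X (π.toHom k v) = π.toHom k (dpi π (adInv k X) v)
  rw [dpi, h1]
  refine h3.trans ?_
  rw [ContinuousLinearMap.mfderiv_eq]
  exact congrArg (π.toHom k) (mfderiv_comp_conj v.2 k X)

/-- The Laplacian commutes with the action of the maximal compact subgroup. -/
theorem commute_laplacian_translate (R : ReductiveGroup n E G) {k : G} (hk : k ∈ maxCompact R) :
    Commute (envAction π (laplacian R)) (translate E π k) := by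
  obtain ⟨m, X, hX⟩ := exists_orthonormal_basis_top R
  -- Ad(k⁻¹) sends an orthonormal basis to an orthonormal basis, and Δ is the same sum of squares in
  -- either.
  let Y := X.map (LinearEquiv.ofInjectiveEndo (adInv k) (adInv_injective R k))
  have hYi : ∀ i, Y i = adInv k (X i) := fun i => by simp [Y]
  have hY : ∀ i j, (dp R (Y i) * (dp R (Y j)).transpose).trace = if i = j then 1 else 0 := by
    intro i j
    rw [hYi, hYi, trace_dp_adInv R hk, hX]
  have h : ∀ i, lieAction π (X i) ^ 2 * translate E π k =
      translate E π k * lieAction π (Y i) ^ 2 := fun i => by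
    rw [hYi, pow_two, pow_two, mul_assoc, lieAction_translate, ← mul_assoc, lieAction_translate,
      mul_assoc]
  rw [commute_iff_eq]
  conv_lhs => rw [envAction_laplacian R π X hX]
  rw [envAction_laplacian R π Y hY, Finset.sum_mul, Finset.mul_sum]
  exact Finset.sum_congr rfl fun i _ => h i

theorem envAction_laplacian_pow_translate (R : ReductiveGroup n E G) {k : G}
    (hk : k ∈ maxCompact R) (l : ℕ) (v : smoothVectors E π) :
    (envAction π (laplacian R ^ l) (translate E π k v) : H) =
      π.toHom k (envAction π (laplacian R ^ l) v) := by
  rw [map_pow]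
  exact congrArg Subtype.val
    (DFunLike.congr_fun (((commute_laplacian_translate π R hk).pow_left l).eq) v)

end Adjoint

/-! ### Density of the `K`-finite vectors in the smooth vectors -/

section Density

open MeasureTheory Filter Topology

variable {E : Type*} [NormedAddCommGroup E] [NormedSpace ℝ E] [FiniteDimensional ℝ E]
  {G : Type*} [TopologicalSpace G] [ChartedSpace E G] [Group G] [LieGroup 𝓘(ℝ, E) ∞ G]
  {H : Type*} [NormedAddCommGroup H] [InnerProductSpace ℂ H] [CompleteSpace H] {n : ℕ}
  (π : HilbertRep G H) (R : ReductiveGroup n E G)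

/-- Averages of smooth vectors over the maximal compact subgroup are smooth, and the Laplacian
commutes with averaging. -/
theorem exists_smooth_average [MeasurableSpace (maxCompact R)] [BorelSpace (maxCompact R)]
    (μ : Measure (maxCompact R)) [IsProbabilityMeasure μ] (v : smoothVectors E π)
    {c : maxCompact R → ℂ} (hc : Continuous c) :
    ∃ w : smoothVectors E π, ∀ l, (envAction π (laplacian R ^ l) w : H) =
      ∫ k, c k • π.toHom k (envAction π (laplacian R ^ l) v : H) ∂μ := by
  have : CompactSpace (maxCompact R) := isCompact_iff_compactSpace.1 (isCompact_maxCompact R)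
  set z : ℕ → H := fun l => ∫ k, c k • π.toHom k (envAction π (laplacian R ^ l) v : H) ∂μ with hz
  have hcont : ∀ l, Continuous fun k : maxCompact R =>
      c k • π.toHom k (envAction π (laplacian R ^ l) v : H) := fun l =>
    hc.smul ((π.continuous_orbit _).comp continuous_subtype_val)
  -- This avoids integration in the Fréchet space H^∞. For finitely many powers of Δ, the integral
  -- in a finite product of copies of H lies in the closure of the convex set of tuples (Δ^l w);
  -- closedness of the range in the infinite product then gives an exact w.
  have happrox : ∀ N : ℕ, ∃ w : smoothVectors E π, ∀ l < N,
      dist (z l) (envAction π (laplacian R ^ l) w : H) < 1 / ((N : ℝ) + 1) := by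
    intro N
    let T : smoothVectors E π →ₗ[ℂ] (Fin N → H) := LinearMap.pi fun l =>
      (smoothVectors E π).subtype ∘ₗ envAction π (laplacian R ^ (l : ℕ))
    let f : maxCompact R → Fin N → H := fun k l =>
      c k • π.toHom k (envAction π (laplacian R ^ (l : ℕ)) v : H)
    have hf : Continuous f := continuous_pi fun l => hcont l
    have hfi : Integrable f μ := hf.integrable_of_hasCompactSupport
      (HasCompactSupport.of_compactSpace _)
    have hmem : ∫ k, f k ∂μ ∈ closure (LinearMap.range T : Set (Fin N → H)) := by
      refine Convex.integral_mem (Convex.closure ((LinearMap.range T).restrictScalars ℝ).convex)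
        isClosed_closure (Eventually.of_forall fun k => subset_closure ?_) hfi
      refine ⟨c k • translate E π (k : G) v, ?_⟩
      ext l
      simp only [T, f, LinearMap.pi_apply, LinearMap.comp_apply, map_smul, Submodule.subtype_apply,
        envAction_laplacian_pow_translate π R k.2]
    obtain ⟨_, ⟨w, rfl⟩, hw⟩ := Metric.mem_closure_iff.1 hmem (1 / ((N : ℝ) + 1)) (by positivity)
    refine ⟨w, fun l hl => ?_⟩
    have h := (dist_le_pi_dist _ _ (⟨l, hl⟩ : Fin N)).trans_lt hw
    rwa [eval_integral fun i : Fin N => (hcont i).integrable_of_hasCompactSupport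
      (HasCompactSupport.of_compactSpace _)] at h
  choose w hw using happrox
  have hlim : Tendsto (fun N l => (envAction π (laplacian R ^ l) (w N) : H)) atTop (𝓝 z) := by
    refine tendsto_pi_nhds.2 fun l => ?_
    refine tendsto_iff_dist_tendsto_zero.2 (squeeze_zero' (Eventually.of_forall fun _ =>
      dist_nonneg) ?_ tendsto_one_div_add_atTop_nhds_zero_nat)
    filter_upwards [eventually_gt_atTop l] with N hN
    rw [dist_comm]
    exact (hw N l hN).le
  obtain ⟨w, hw⟩ := (isClosed_range_laplacian_powers π R).mem_of_tendsto hlim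
    (Eventually.of_forall fun N => ⟨w N, rfl⟩)
  exact ⟨w, fun l => congrFun hw l⟩

/-- The diagonal action of the maximal compact subgroup on a power of the representation space. -/
noncomputable def diagonalAction (N : ℕ) :
    maxCompact R →* (PiLp 2 (fun _ : Fin N => H) →L[ℂ] PiLp 2 (fun _ : Fin N => H)) where
  toFun k := ((PiLp.continuousLinearEquiv 2 ℂ fun _ : Fin N => H).symm :
      (Fin N → H) →L[ℂ] PiLp 2 fun _ : Fin N => H) ∘L
    ContinuousLinearMap.pi fun l => π.toHom (k : G) ∘L PiLp.proj 2 (fun _ : Fin N => H) l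
  map_one' := by ext x l; simp
  map_mul' k k' := by ext x l; simp

/-- The `K`-finite smooth vectors are dense in the smooth vectors. -/
theorem exists_kFinite_near (v : smoothVectors E π) (N : ℕ) {ε : ℝ} (hε : 0 < ε) :
    ∃ u ∈ kFinite R π, ∀ l ≤ N, dist (envAction π (laplacian R ^ l) v : H)
      (envAction π (laplacian R ^ l) u) < ε := by
  have : IsTopologicalGroup G := topologicalGroup_of_lieGroup 𝓘(ℝ, E) ∞
  have : CompactSpace (maxCompact R) := isCompact_iff_compactSpace.1 (isCompact_maxCompact R)
  let _ : MeasurableSpace (maxCompact R) := borel _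
  have : BorelSpace (maxCompact R) := ⟨rfl⟩
  -- Taking the whole compact group as reference set normalizes Haar measure to mass one.
  let μ : Measure (maxCompact R) := Measure.haarMeasure ⊤
  have : IsProbabilityMeasure μ := ⟨Measure.haarMeasure_self⟩
  -- The ℓ² product makes tuples (w, Δw, …, Δ^N w) live in a Hilbert space, so one approximation
  -- there controls all N + 1 seminorms at once.
  let T : smoothVectors E π →ₗ[ℂ] PiLp 2 (fun _ : Fin (N + 1) => H) :=
    (PiLp.continuousLinearEquiv 2 ℂ fun _ : Fin (N + 1) => H).symm.toLinearEquiv.toLinearMap ∘ₗ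
      LinearMap.pi fun l : Fin (N + 1) =>
        (smoothVectors E π).subtype ∘ₗ envAction π (laplacian R ^ (l : ℕ))
  have hT : ∀ w l, T w l = (envAction π (laplacian R ^ (l : ℕ)) w : H) := fun w l => rfl
  have hρ : ∀ x, Continuous fun k => diagonalAction π R (N + 1) k x := fun x =>
    (PiLp.continuous_toLp 2 _).comp (continuous_pi fun l =>
      (π.continuous_orbit (x l)).comp continuous_subtype_val)
  have hmem := mem_closure_finiteVectors μ (diagonalAction π R (N + 1)) hρ (LinearMap.range T) (by
    rintro _ ⟨w, rfl⟩ c hc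
    obtain ⟨w', hw'⟩ := exists_smooth_average π R μ w hc
    refine ⟨w', ?_⟩
    ext l
    have hint : Integrable (fun k => c k • diagonalAction π R (N + 1) k (T w)) μ :=
      (hc.smul (hρ _)).integrable_of_hasCompactSupport (HasCompactSupport.of_compactSpace _)
    have h := (PiLp.proj 2 (𝕜 := ℂ) (fun _ : Fin (N + 1) => H) l).integral_comp_comm hint
    rw [hT, hw']
    exact h) ⟨v, rfl⟩
  obtain ⟨_, ⟨⟨u, rfl⟩, U, hU, hUu⟩, hdist⟩ := Metric.mem_closure_iff.1 hmem ε hε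
  refine ⟨u, ?_, fun l hl => ?_⟩
  · change FiniteDimensional ℂ _
    -- The component of index 0 is u itself, so projecting the finite-dimensional space U to it
    -- contains the K-orbit of u.
    have h := Submodule.span_le.2 (show (fun k => π.toHom k (u : H)) '' (maxCompact R : Set G) ⊆
        U.map (PiLp.proj 2 (𝕜 := ℂ) (fun _ : Fin (N + 1) => H) 0 : _ →ₗ[ℂ] H) by
      rintro _ ⟨k, hk, rfl⟩
      refine ⟨_, hUu ⟨k, hk⟩, ?_⟩
      change π.toHom k (T u 0) = _
      rw [hT]
      simp)
    exact Submodule.finiteDimensional_of_le h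
  · rw [dist_eq_norm] at hdist ⊢
    exact (PiLp.norm_apply_le (T v - T u) ⟨l, Nat.lt_succ_of_le hl⟩).trans_lt hdist

end Density

/-! ### Identification of the completion -/

section Completion

variable {E : Type*} [NormedAddCommGroup E] [NormedSpace ℝ E] [FiniteDimensional ℝ E]
  {G : Type*} [TopologicalSpace G] [ChartedSpace E G] [Group G] [LieGroup 𝓘(ℝ, E) ∞ G]
  {H : Type*} [NormedAddCommGroup H] [InnerProductSpace ℂ H] {n : ℕ}
  (R : ReductiveGroup n E G) (π : HilbertRep G H)

/-- The smooth vectors, as a uniform space with the seminorms of the enveloping algebra. -/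
def SmoothSpace : Type _ := smoothVectors E π

/-- The `K`-finite smooth vectors, as a uniform space with the seminorms `q_l`. -/
def KFiniteSpace : Type _ := kFinite R π

noncomputable instance : UniformSpace (SmoothSpace (E := E) π) :=
  (seminormUniformity (envSeminorm (E := E) π) : UniformSpace (smoothVectors E π))

noncomputable instance : UniformSpace (KFiniteSpace R π) :=
  (kFiniteUniformity R π : UniformSpace (kFinite R π))

variable {π} in
/-- The inclusion of the smooth vectors in the representation space. -/
def SmoothSpace.val (v : SmoothSpace (E := E) π) : H := Subtype.val (p := (· ∈ smoothVectors E π)) v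

variable {R π} in
/-- The inclusion of the `K`-finite smooth vectors in the smooth vectors. -/
def KFiniteSpace.val (v : KFiniteSpace R π) : SmoothSpace (E := E) π :=
  Subtype.val (p := (· ∈ kFinite R π)) v

/-- The sequence `Δ^l v`, `l = 0, 1, 2, …`. -/
noncomputable def laplacianPowers (v : SmoothSpace (E := E) π) (l : ℕ) : H :=
  envAction π (laplacian R ^ l) v

theorem laplacianPowers_zero (v : SmoothSpace (E := E) π) : laplacianPowers R π v 0 = v.val := by
  rw [laplacianPowers, pow_zero, map_one]
  rfl

theorem isUniformInducing_laplacianPowers [CompleteSpace H] :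
    IsUniformInducing (laplacianPowers R π) := by
  have h := (seminormUniformity_env_eq_lap R π).trans (seminormUniformity_eq_comap fun l =>
    (smoothVectors E π).subtype ∘ₗ envAction π (laplacian R ^ l))
  exact isUniformInducing_iff_uniformSpace.2 h.symm

/-- By definition of the q_l, the powers of Δ induce the uniformity of V. By the elliptic estimate
they also induce that of H^∞, so the inclusion is inducing. -/
theorem isUniformInducing_kFinite_val [CompleteSpace H] :
    IsUniformInducing (KFiniteSpace.val : KFiniteSpace R π → SmoothSpace (E := E) π) := by
  have h : kFiniteUniformity R π = _ := seminormUniformity_eq_comap fun l =>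
    ((smoothVectors E π).subtype ∘ₗ envAction π (laplacian R ^ l)) ∘ₗ (kFinite R π).subtype
  have h2 : IsUniformInducing (laplacianPowers R π ∘ KFiniteSpace.val) :=
    isUniformInducing_iff_uniformSpace.2 h.symm
  exact (isUniformInducing_laplacianPowers R π).of_comp_iff.1 h2

theorem uniformContinuous_val [CompleteSpace H] (R : ReductiveGroup n E G) (π : HilbertRep G H) :
    UniformContinuous (SmoothSpace.val : SmoothSpace (E := E) π → H) := by
  have h := (Pi.uniformContinuous_proj (fun _ : ℕ => H) 0).comp
    (isUniformInducing_laplacianPowers R π).uniformContinuous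
  exact (funext (laplacianPowers_zero R π) :
    (fun v => laplacianPowers R π v 0) = SmoothSpace.val) ▸ h

theorem denseRange_kFinite_val [CompleteSpace H] :
    DenseRange (KFiniteSpace.val : KFiniteSpace R π → SmoothSpace (E := E) π) := by
  intro v
  rw [(isUniformInducing_laplacianPowers R π).isInducing.closure_eq_preimage_closure_image]
  -- A diagonal sequence: the N-th vector approximates the first N + 1 powers of Δ to within 1/(N +
  -- 1), so every fixed power converges.
  choose w hwK hw using fun N : ℕ => exists_kFinite_near π R v N
    (Nat.one_div_pos_of_nat (α := ℝ) (n := N))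
  refine mem_closure_of_tendsto (b := Filter.atTop) (f := fun N => laplacianPowers R π (w N))
    (tendsto_pi_nhds.2 fun l => ?_)
    (Filter.Eventually.of_forall fun N => ⟨w N, ⟨⟨w N, hwK N⟩, rfl⟩, rfl⟩)
  refine tendsto_iff_dist_tendsto_zero.2 (squeeze_zero' (Filter.Eventually.of_forall fun _ =>
    dist_nonneg) ?_ tendsto_one_div_add_atTop_nhds_zero_nat)
  filter_upwards [Filter.eventually_ge_atTop l] with N hN
  rw [dist_comm]
  exact (hw N l hN).le

/-- The smooth vectors are a completion of the `K`-finite smooth vectors. -/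
noncomputable def smoothCompletion [CompleteSpace H] : AbstractCompletion (KFiniteSpace R π) where
  space := SmoothSpace (E := E) π
  coe := KFiniteSpace.val
  uniformStruct := inferInstance
  complete := completeSpace_smoothVectors E π
  separation := by
    have : T2Space (SmoothSpace (E := E) π) := T2Space.of_injective_continuous
      (f := SmoothSpace.val) Subtype.val_injective (uniformContinuous_val R π).continuous
    infer_instance
  isUniformInducing := isUniformInducing_kFinite_val R π
  dense := denseRange_kFinite_val R π

/-- The completion of the `K`-finite smooth vectors is the space of smooth vectors. -/
theorem exists_lapCompletion_equiv [CompleteSpace H] :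
    ∃ e : lapCompletion R π ≃ smoothVectors E π,
      (∀ z, (e z : H) = lapCompletionToH R π z) ∧
      @IsHomeomorph _ _ (lapCompletionTopology R π) (smoothTopology E π) e := by
  let e : UniformSpace.Completion (KFiniteSpace R π) ≃ᵤ SmoothSpace (E := E) π :=
    UniformSpace.Completion.cPkg.compareEquiv (smoothCompletion R π)
  have hecoe : ∀ v : KFiniteSpace R π, e (v : UniformSpace.Completion (KFiniteSpace R π)) = v.val :=
    UniformSpace.Completion.cPkg.compare_coe (smoothCompletion R π)
  have hu : UniformContinuous fun v : KFiniteSpace R π => v.val.val :=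
    (uniformContinuous_val R π).comp (isUniformInducing_kFinite_val R π).uniformContinuous
  -- Both sides are continuous and agree on the dense subspace V.
  have hval : ∀ z, (e z).val = UniformSpace.Completion.extension (fun v => v.val.val) z :=
    UniformSpace.Completion.ext' ((uniformContinuous_val R π).continuous.comp e.continuous)
      UniformSpace.Completion.continuous_extension fun v => by
        rw [UniformSpace.Completion.extension_coe hu, hecoe]
  exact ⟨e.toEquiv, hval, e.toHomeomorph.isHomeomorph⟩

end Completion

end RealReductive

theorem lemma15 {n : ℕ}
    {E : Type*} [NormedAddCommGroup E] [NormedSpace ℝ E] [FiniteDimensional ℝ E]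
    {G : Type*} [TopologicalSpace G] [ChartedSpace E G] [Group G] [LieGroup 𝓘(ℝ, E) ∞ G]
    (R : RealReductive.ReductiveGroup n E G)
    {H : Type*} [NormedAddCommGroup H] [InnerProductSpace ℂ H] [CompleteSpace H]
    (π : RealReductive.HilbertRep G H) :
    -- `Δ` is the elliptic element `∑ X_i ^ 2`, for any basis orthonormal with respect to `tr(XYᵀ)`
    (∀ (m : ℕ) (X : Module.Basis (Fin m) ℝ (GroupLieAlgebra 𝓘(ℝ, E) G)),
      (∀ i j, (RealReductive.dp R (X i) * (RealReductive.dp R (X j)).transpose).trace =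
        if i = j then 1 else 0) →
      RealReductive.laplacian R = ∑ i, UniversalEnvelopingAlgebra.ι ℝ (X i) ^ 2) ∧
    -- the canonical map `Z → H` is a homeomorphism of `Z` onto `H^∞` with its usual topology
    (∃ e : RealReductive.lapCompletion R π ≃ RealReductive.smoothVectors E π,
      (∀ z, (e z : H) = RealReductive.lapCompletionToH R π z) ∧
      @IsHomeomorph _ _ (RealReductive.lapCompletionTopology R π)
        (RealReductive.smoothTopology E π) e) ∧
    -- the usual topology of `H^∞` is defined by the seminorms `q_l`
    RealReductive.smoothTopology E π =
      RealReductive.seminormTopology (RealReductive.lapSeminorm R π) :=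
  ⟨fun _ X hX => RealReductive.laplacian_eq R X hX,
    RealReductive.exists_lapCompletion_equiv R π,
    congrArg (@UniformSpace.toTopologicalSpace _) (RealReductive.seminormUniformity_env_eq_lap R π)⟩
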